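/- **Proposition (A Gray-functor is a fibration iff it satisfies the adjoint-biequivalence-lifting property and is locally a fibration).** *Conventions.* 2-categories and 2-functors are strict, and all 2-categories and Gray-categories are small. A *Gray-category* is a category enriched in the category $\mathbf{2\text{-}Cat}$ with the (pseudo) Gray tensor product; $gf$ denotes the composite of 1-cells $f:A\to B$ and $g:B\to C$, and for 2-cells $\alpha:f\to f':A\to B$ and $\beta:g\to g':B\to C$ we write $\beta_\alpha:\beta f'.g\alpha\to g'\alpha.\beta f$ for the interchange isomorphism. $\mathbf{Gray\text{-}Cat}$ is the category of Gray-categories and Gray-functors. A 2-functor $P:\mathcal X\to\mathcal Y$ is a *fibration* if (a) for each object $x\in\mathcal X$ and each equivalence $f:y\to Px$ in $\mathcal Y$ there is an equivalence $f':x'\to x$ in $\mathcal X$ with $Pf'=f$, and (b) for each 1-cell $f$ of $\mathcal X$ and each invertible 2-cell $\beta:g\cong Pf$ there is an invertible 2-cell $\beta':g'\cong f$ with $P\beta'=\beta$. For a Gray-category $\mathbb B$, let $\pi_*\mathbb B$ be the category with the same objects, whose morphisms $B\to C$ are the equivalence classes of 1-cells $B\to C$ (two being identified when they are equivalent in the 2-category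 $\mathbb B(B,C)$). A Gray-functor $F:\mathbb A\to\mathbb B$ is *locally a fibration* if each 2-functor $F:\mathbb A(A,B)\to\mathbb B(FA,FB)$ is a fibration; it is a *fibration* if it is locally a fibration and $\pi_*F:\pi_*\mathbb A\to\pi_*\mathbb B$ is an isofibration: for every $A\in\mathbb A$ and every isomorphism $i:B\cong FA$ in $\pi_*\mathbb B$ there are $A'\in\mathbb A$ with $FA'=B$ and an isomorphism $i':A'\cong A$ in $\pi_*\mathbb A$ with $(\pi_*F)i'=i$. An *adjoint biequivalence* in $\mathbb B$ consists of 1-cells $f:A\to B$ and $g:B\to A$, adjoint equivalences $\eta:1\simeq gf$ and $\epsilon:fg\simeq1$ in $\mathbb B(A,A)$ and $\mathbb B(B,B)$ (including chosen inverse adjoints, units and counits), and invertible 3-cells $S:\epsilon f.f\eta\cong1$ and $T:1\cong g\epsilon.\eta g$ such that the two composites $$\eta\xrightarrow{Tf.\eta}g\epsilon f.\eta gf.\eta\xrightarrow{g\epsilon f.\eta_\eta}g\epsilon f.gf\eta.\eta\xrightarrow{gS.\eta}\eta,\qquad \epsilon\xrightarrow{\epsilon.fT}\epsilon.fg\epsilon.f\eta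 g\xrightarrow{\epsilon_\epsilon.f\eta g}\epsilon.\epsilon fg.f\eta g\xrightarrow{\epsilon.Sg}\epsilon$$ are identities (the tetrahedron equations). A Gray-functor $F:\mathbb A\to\mathbb B$ has the *adjoint-biequivalence-lifting property* if for every $E\in\mathbb A$ and every adjoint biequivalence $(f:B\to FE,\,g,\eta,\epsilon,S,T)$ in $\mathbb B$ there is an adjoint biequivalence $(f':D\to E,\,g',\eta',\epsilon',S',T')$ in $\mathbb A$ which $F$ sends to it (with all of its structure). *Statement.* 1. A Gray-functor $F:\mathbb A\to\mathbb B$ is a fibration if and only if it has the adjoint-biequivalence-lifting property and is locally a fibration. 2. There is a universal adjoint biequivalence: a Gray-category $\mathbb U$ such that Gray-functors $\mathbb U\to\mathbb A$ are in bijection, naturally in $\mathbb A$, with adjoint biequivalences in $\mathbb A$. Any such $\mathbb U$ has exactly two objects, and, for either of the Gray-functors $p:1\to\mathbb U$ from the terminal Gray-category, a Gray-functor $F$ has the adjoint-biequivalence-lifting property if and only if it has the right lifting property with respect to $p$. 3. There is a cofibrantly generated weak factorization system on $\mathbf{Gray\text{-}Cat}$ whose right class is the class of fibrations. More precisely, there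 is a small set $I$ of Gray-functors such that the Gray-functors with the right lifting property with respect to $I$ are those which are locally fibrations; for any $p:1\to\mathbb U$ as in 2, the Gray-functors with the right lifting property with respect to $I\cup\{p\}$ are the fibrations; and the Gray-functors with the left lifting property with respect to all fibrations, together with the fibrations, form a weak factorization system. -/

import Mathlib

open CategoryTheory

universe u

/-! ## 2-categories

A small strict 2-category is presented by its sets of objects, 1-cells and 2-cells, with source and
target maps. Composites are only defined for composable cells, and are written in diagrammatic
order. Laws which need several composability conditions are stated for arbitrary proofs of these;
the redundant ones always follow from the others. -/

/-- A small (strict) 2-category. -/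
structure TwoCat : Type (u + 1) where
  /-- objects -/
  C0 : Type u
  /-- 1-cells -/
  C1 : Type u
  /-- 2-cells -/
  C2 : Type u
  s1 : C1 → C0
  t1 : C1 → C0
  s2 : C2 → C1
  t2 : C2 → C1
  s1_s2 : ∀ a, s1 (s2 a) = s1 (t2 a)
  t1_s2 : ∀ a, t1 (s2 a) = t1 (t2 a)
  id1 : C0 → C1
  s1_id1 : ∀ x, s1 (id1 x) = x
  t1_id1 : ∀ x, t1 (id1 x) = x
  id2 : C1 → C2
  s2_id2 : ∀ f, s2 (id2 f) = f
  t2_id2 : ∀ f, t2 (id2 f) = f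
  /-- composition of 1-cells, `f` first -/
  comp1 : ∀ f g : C1, t1 f = s1 g → C1
  s1_comp1 : ∀ f g h, s1 (comp1 f g h) = s1 f
  t1_comp1 : ∀ f g h, t1 (comp1 f g h) = t1 g
  /-- vertical composition of 2-cells, `a` first -/
  vcomp : ∀ a b : C2, t2 a = s2 b → C2
  s2_vcomp : ∀ a b h, s2 (vcomp a b h) = s2 a
  t2_vcomp : ∀ a b h, t2 (vcomp a b h) = t2 b
  /-- horizontal composition of 2-cells, `a` first -/
  hcomp : ∀ a b : C2, t1 (s2 a) = s1 (s2 b) → C2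
  s2_hcomp : ∀ a b h, s2 (hcomp a b h) = comp1 (s2 a) (s2 b) h
  t2_hcomp : ∀ a b h, t2 (hcomp a b h) = comp1 (t2 a) (t2 b) (by rw [← t1_s2, ← s1_s2, h])
  id1_comp1 : ∀ x f h, comp1 (id1 x) f h = f
  comp1_id1 : ∀ f x h, comp1 f (id1 x) h = f
  comp1_assoc : ∀ f g k h₁ h₂ h₃ h₄,
    comp1 (comp1 f g h₁) k h₂ = comp1 f (comp1 g k h₃) h₄
  id2_vcomp : ∀ f a h, vcomp (id2 f) a h = a
  vcomp_id2 : ∀ a f h, vcomp a (id2 f) h = a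
  vcomp_assoc : ∀ a b c h₁ h₂ h₃ h₄,
    vcomp (vcomp a b h₁) c h₂ = vcomp a (vcomp b c h₃) h₄
  id1_hcomp : ∀ x a h, hcomp (id2 (id1 x)) a h = a
  hcomp_id1 : ∀ a x h, hcomp a (id2 (id1 x)) h = a
  hcomp_assoc : ∀ a b c h₁ h₂ h₃ h₄,
    hcomp (hcomp a b h₁) c h₂ = hcomp a (hcomp b c h₃) h₄
  id2_hcomp_id2 : ∀ f g h h', hcomp (id2 f) (id2 g) h = id2 (comp1 f g h')
  /-- middle-four interchange -/
  vcomp_hcomp_vcomp : ∀ a b c d h₁ h₂ h₃ h₄ h₅ h₆,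
    hcomp (vcomp a b h₁) (vcomp c d h₂) h₃ = vcomp (hcomp a c h₄) (hcomp b d h₅) h₆

namespace TwoCat

attribute [simp] s1_id1 t1_id1 s2_id2 t2_id2 s1_comp1 t1_comp1 s2_vcomp t2_vcomp s2_hcomp t2_hcomp
  id1_comp1 comp1_id1 id2_vcomp vcomp_id2 id1_hcomp hcomp_id1

variable (X : TwoCat.{u})

/-- The 2-cell `a` is (strictly) invertible. -/
def IsIso2 (a : X.C2) : Prop :=
  ∃ (b : X.C2) (h : X.t2 a = X.s2 b) (h' : X.t2 b = X.s2 a),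
    X.vcomp a b h = X.id2 (X.s2 a) ∧ X.vcomp b a h' = X.id2 (X.s2 b)

/-- The 1-cell `f : x → y` is an equivalence: there is some `g : y → x` and there are invertible
2-cells between `1` and `f` followed by `g`, and between `g` followed by `f` and `1`. -/
def IsEquivalence (f : X.C1) : Prop :=
  ∃ (g : X.C1) (h : X.t1 f = X.s1 g) (h' : X.t1 g = X.s1 f) (a b : X.C2),
    X.IsIso2 a ∧ X.s2 a = X.id1 (X.s1 f) ∧ X.t2 a = X.comp1 f g h ∧
    X.IsIso2 b ∧ X.s2 b = X.comp1 g f h' ∧ X.t2 b = X.id1 (X.s1 g)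

/-- The objects `x` and `y` are equivalent. -/
def Equivalent (x y : X.C0) : Prop :=
  ∃ f : X.C1, X.IsEquivalence f ∧ X.s1 f = x ∧ X.t1 f = y

/-- The set of equivalence classes of objects of `X`: the quotient by the relation `Equivalent`, which
is an equivalence relation. -/
def Pi : Type u := Quot X.Equivalent

/-- An adjoint equivalence in `X`: 1-cells `l : x → y` and `r : y → x`, an invertible unit from `1`
to `l` followed by `r`, and an invertible counit from `r` followed by `l` to `1`, satisfying the
triangle equations. The inverse adjoint `r`, the unit and the counit are part of the data. -/
@[ext]
structure AdjEquiv where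
  l : X.C1
  r : X.C1
  t_l : X.t1 l = X.s1 r
  t_r : X.t1 r = X.s1 l
  unit : X.C2
  counit : X.C2
  s_unit : X.s2 unit = X.id1 (X.s1 l)
  t_unit : X.t2 unit = X.comp1 l r t_l
  s_counit : X.s2 counit = X.comp1 r l t_r
  t_counit : X.t2 counit = X.id1 (X.s1 r)
  unit_iso : X.IsIso2 unit
  counit_iso : X.IsIso2 counit
  triangle_l :
    X.vcomp (X.hcomp unit (X.id2 l) (by simp [s_unit]))
      (X.hcomp (X.id2 l) counit (by simp [s_counit, t_l]))
      (by
        simp only [t2_hcomp, s2_hcomp, t_unit, s_counit, s2_id2, t2_id2]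
        apply X.comp1_assoc) = X.id2 l
  triangle_r :
    X.vcomp (X.hcomp (X.id2 r) unit (by simp [s_unit, t_r]))
      (X.hcomp counit (X.id2 r) (by simp [s_counit, t_l]))
      (by
        simp only [t2_hcomp, s2_hcomp, t_unit, s_counit, s2_id2, t2_id2]
        exact (X.comp1_assoc _ _ _ _ _ _ _).symm) = X.id2 r

end TwoCat

/-- A (strict) 2-functor. -/
@[ext]
structure TwoFunctor (X Y : TwoCat.{u}) where
  f0 : X.C0 → Y.C0
  f1 : X.C1 → Y.C1
  f2 : X.C2 → Y.C2
  s1_f1 : ∀ a, Y.s1 (f1 a) = f0 (X.s1 a)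
  t1_f1 : ∀ a, Y.t1 (f1 a) = f0 (X.t1 a)
  s2_f2 : ∀ a, Y.s2 (f2 a) = f1 (X.s2 a)
  t2_f2 : ∀ a, Y.t2 (f2 a) = f1 (X.t2 a)
  map_id1 : ∀ x, f1 (X.id1 x) = Y.id1 (f0 x)
  map_id2 : ∀ a, f2 (X.id2 a) = Y.id2 (f1 a)
  map_comp1 : ∀ a b h, f1 (X.comp1 a b h) = Y.comp1 (f1 a) (f1 b) (by rw [t1_f1, s1_f1, h])
  map_vcomp : ∀ a b h, f2 (X.vcomp a b h) = Y.vcomp (f2 a) (f2 b) (by rw [t2_f2, s2_f2, h])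
  map_hcomp : ∀ a b h, f2 (X.hcomp a b h) =
    Y.hcomp (f2 a) (f2 b) (by rw [s2_f2, s2_f2, t1_f1, s1_f1, h])

namespace TwoFunctor

attribute [simp] s1_f1 t1_f1 s2_f2 t2_f2 map_id1 map_id2 map_comp1 map_vcomp map_hcomp

/-- The identity 2-functor. -/
@[simps]
def id (X : TwoCat.{u}) : TwoFunctor X X where
  f0 x := x
  f1 x := x
  f2 x := x
  s1_f1 _ := rfl
  t1_f1 _ := rfl
  s2_f2 _ := rfl
  t2_f2 _ := rfl
  map_id1 _ := rfl
  map_id2 _ := rfl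
  map_comp1 _ _ _ := rfl
  map_vcomp _ _ _ := rfl
  map_hcomp _ _ _ := rfl

/-- The composite of 2-functors, `P` first. -/
@[simps]
def comp {X Y Z : TwoCat.{u}} (P : TwoFunctor X Y) (Q : TwoFunctor Y Z) : TwoFunctor X Z where
  f0 x := Q.f0 (P.f0 x)
  f1 x := Q.f1 (P.f1 x)
  f2 x := Q.f2 (P.f2 x)
  s1_f1 _ := by simp
  t1_f1 _ := by simp
  s2_f2 _ := by simp
  t2_f2 _ := by simp
  map_id1 _ := by simp
  map_id2 _ := by simp
  map_comp1 _ _ _ := by simp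
  map_vcomp _ _ _ := by simp
  map_hcomp _ _ _ := by simp

variable {X Y : TwoCat.{u}} (P : TwoFunctor X Y)

theorem isIso2 {a : X.C2} (ha : X.IsIso2 a) : Y.IsIso2 (P.f2 a) := by
  obtain ⟨b, h, h', e, e'⟩ := ha
  refine ⟨P.f2 b, by simp [h], by simp [h'], ?_, ?_⟩
  · rw [← P.map_vcomp _ _ h, e]; simp
  · rw [← P.map_vcomp _ _ h', e']; simp

theorem isEquivalence {f : X.C1} (hf : X.IsEquivalence f) : Y.IsEquivalence (P.f1 f) := by
  obtain ⟨g, h, h', a, b, ha, ha1, ha2, hb, hb1, hb2⟩ := hf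
  exact ⟨P.f1 g, by simp [h], by simp [h'], P.f2 a, P.f2 b, P.isIso2 ha, by simp [ha1],
    by simp [ha2], P.isIso2 hb, by simp [hb1], by simp [hb2]⟩

theorem equivalent {x y : X.C0} (h : X.Equivalent x y) : Y.Equivalent (P.f0 x) (P.f0 y) := by
  obtain ⟨f, hf, rfl, rfl⟩ := h
  exact ⟨P.f1 f, P.isEquivalence hf, by simp, by simp⟩

/-- The image of an adjoint equivalence under a 2-functor. -/
@[simps]
def mapAdjEquiv (e : X.AdjEquiv) : Y.AdjEquiv where
  l := P.f1 e.l
  r := P.f1 e.r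
  t_l := by simp [e.t_l]
  t_r := by simp [e.t_r]
  unit := P.f2 e.unit
  counit := P.f2 e.counit
  s_unit := by simp [e.s_unit]
  t_unit := by simp [e.t_unit]
  s_counit := by simp [e.s_counit]
  t_counit := by simp [e.t_counit]
  unit_iso := P.isIso2 e.unit_iso
  counit_iso := P.isIso2 e.counit_iso
  triangle_l := by simpa using congrArg P.f2 e.triangle_l
  triangle_r := by simpa using congrArg P.f2 e.triangle_r

/-- Fibrations of 2-categories: the 2-functors along which equivalences, and invertible 2-cells, can
be lifted, given a lift of their codomain. -/
def IsFibration : Prop :=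
  (∀ (x : X.C0) (f : Y.C1), Y.IsEquivalence f → Y.t1 f = P.f0 x →
    ∃ f' : X.C1, X.IsEquivalence f' ∧ X.t1 f' = x ∧ P.f1 f' = f) ∧
  (∀ (f : X.C1) (b : Y.C2), Y.IsIso2 b → Y.t2 b = P.f1 f →
    ∃ b' : X.C2, X.IsIso2 b' ∧ X.t2 b' = f ∧ P.f2 b' = b)

end TwoFunctor

/-! ## Gray-categories -/

/-- A cubical functor of two variables `X, Y → Z`. By the defining universal property of the Gray
tensor product, this is the same as a 2-functor `X ⊗ Y → Z`: it is a 2-functor in each variable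
separately, together with an invertible 2-cell for each pair of 1-cells `a : x → x'` of `X` and
`b : y → y'` of `Y`, filling the square of `a` and `b`, which is natural and compatible with
identities and composition in each variable. -/
structure CubicalFunctor (X Y Z : TwoCat.{u}) where
  /-- the 2-functor of the first variable, for a fixed value of the second -/
  fst : Y.C0 → TwoFunctor X Z
  /-- the 2-functor of the second variable, for a fixed value of the first -/
  snd : X.C0 → TwoFunctor Y Z
  fst_f0 : ∀ x y, (fst y).f0 x = (snd x).f0 y
  /-- the interchange 2-cells -/
  inter : X.C1 → Y.C1 → Z.C2
  s2_inter : ∀ a b, Z.s2 (inter a b) =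
    Z.comp1 ((fst (Y.s1 b)).f1 a) ((snd (X.t1 a)).f1 b) (by simp [fst_f0])
  t2_inter : ∀ a b, Z.t2 (inter a b) =
    Z.comp1 ((snd (X.s1 a)).f1 b) ((fst (Y.t1 b)).f1 a) (by simp [fst_f0])
  inter_iso : ∀ a b, Z.IsIso2 (inter a b)
  id1_inter : ∀ x b, inter (X.id1 x) b = Z.id2 ((snd x).f1 b)
  inter_id1 : ∀ a y, inter a (Y.id1 y) = Z.id2 ((fst y).f1 a)
  comp1_inter : ∀ a a' b (h : X.t1 a = X.s1 a') h₁ h₂ h₃,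
    inter (X.comp1 a a' h) b =
      Z.vcomp (Z.hcomp (Z.id2 ((fst (Y.s1 b)).f1 a)) (inter a' b) h₁)
        (Z.hcomp (inter a b) (Z.id2 ((fst (Y.t1 b)).f1 a')) h₂) h₃
  inter_comp1 : ∀ a b b' (h : Y.t1 b = Y.s1 b') h₁ h₂ h₃,
    inter a (Y.comp1 b b' h) =
      Z.vcomp (Z.hcomp (inter a b) (Z.id2 ((snd (X.t1 a)).f1 b')) h₁)
        (Z.hcomp (Z.id2 ((snd (X.s1 a)).f1 b)) (inter a b') h₂) h₃
  fst_inter : ∀ (p : X.C2) (b : Y.C1) h₁ h₂ h₃ h₄,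
    Z.vcomp (Z.hcomp ((fst (Y.s1 b)).f2 p) (Z.id2 ((snd (X.t1 (X.s2 p))).f1 b)) h₁)
        (inter (X.t2 p) b) h₂ =
      Z.vcomp (inter (X.s2 p) b)
        (Z.hcomp (Z.id2 ((snd (X.s1 (X.s2 p))).f1 b)) ((fst (Y.t1 b)).f2 p) h₃) h₄
  snd_inter : ∀ (a : X.C1) (q : Y.C2) h₁ h₂ h₃ h₄,
    Z.vcomp (Z.hcomp (Z.id2 ((fst (Y.s1 (Y.s2 q))).f1 a)) ((snd (X.t1 a)).f2 q) h₁)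
        (inter a (Y.t2 q)) h₂ =
      Z.vcomp (inter a (Y.s2 q))
        (Z.hcomp ((snd (X.s1 a)).f2 q) (Z.id2 ((fst (Y.t1 (Y.s2 q))).f1 a)) h₃) h₄

/-- A small Gray-category: a category enriched in 2-categories with the Gray tensor product.
For objects `A`, `B` the 2-category `Hom A B` has the 1-cells `A → B` as objects, and the 2-cells
and 3-cells between them as 1-cells and 2-cells. The unit of the Gray tensor product is the terminal
2-category, so that identities are given by objects of `Hom A A`; associativity and unit laws are
equations between 2-functors out of tensor products, which are checked on generating cells. -/
structure GrayCat : Type (u + 1) where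
  Obj : Type u
  Hom : Obj → Obj → TwoCat.{u}
  one : ∀ A, (Hom A A).C0
  comp : ∀ A B C, CubicalFunctor (Hom A B) (Hom B C) (Hom A C)
  snd_one : ∀ A B, (comp A A B).snd (one A) = TwoFunctor.id (Hom A B)
  fst_one : ∀ A B, (comp A B B).fst (one B) = TwoFunctor.id (Hom A B)
  fst_fst : ∀ {A B C D} (g : (Hom B C).C0) (h : (Hom C D).C0),
    ((comp A B C).fst g).comp ((comp A C D).fst h) =
      (comp A B D).fst (((comp B C D).fst h).f0 g)
  snd_fst : ∀ {A B C D} (f : (Hom A B).C0) (h : (Hom C D).C0),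
    ((comp A B C).snd f).comp ((comp A C D).fst h) =
      ((comp B C D).fst h).comp ((comp A B D).snd f)
  snd_snd : ∀ {A B C D} (f : (Hom A B).C0) (g : (Hom B C).C0),
    ((comp B C D).snd g).comp ((comp A B D).snd f) =
      (comp A C D).snd (((comp A B C).snd f).f0 g)
  fst_inter : ∀ {A B C D} (α : (Hom A B).C1) (β : (Hom B C).C1) (h : (Hom C D).C0),
    ((comp A C D).fst h).f2 ((comp A B C).inter α β) =
      (comp A B D).inter α (((comp B C D).fst h).f1 β)
  inter_assoc : ∀ {A B C D} (α : (Hom A B).C1) (g : (Hom B C).C0) (γ : (Hom C D).C1),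
    (comp A C D).inter (((comp A B C).fst g).f1 α) γ =
      (comp A B D).inter α (((comp B C D).snd g).f1 γ)
  snd_inter : ∀ {A B C D} (f : (Hom A B).C0) (β : (Hom B C).C1) (γ : (Hom C D).C1),
    (comp A C D).inter (((comp A B C).snd f).f1 β) γ =
      ((comp A B D).snd f).f2 ((comp B C D).inter β γ)

namespace GrayCat

variable (A : GrayCat.{u}) {X Y Z W : A.Obj}

/-- The 2-functor sending a cell `α` of `Hom X Y` to the whiskering `gα`. -/
abbrev post (g : (A.Hom Y Z).C0) : TwoFunctor (A.Hom X Y) (A.Hom X Z) := (A.comp X Y Z).fst g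

/-- The 2-functor sending a cell `β` of `Hom Y Z` to the whiskering `βf`. -/
abbrev pre (f : (A.Hom X Y).C0) : TwoFunctor (A.Hom Y Z) (A.Hom X Z) := (A.comp X Y Z).snd f

/-- The composite 1-cell `gf`: first `f`, then `g`. -/
abbrev cmp (f : (A.Hom X Y).C0) (g : (A.Hom Y Z).C0) : (A.Hom X Z).C0 := (A.pre f).f0 g

/-- The interchange isomorphism `β_α : βf'.gα → g'α.βf`, for `α : f → f'` and `β : g → g'`. -/
abbrev inter (α : (A.Hom X Y).C1) (β : (A.Hom Y Z).C1) : (A.Hom X Z).C2 :=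
  (A.comp X Y Z).inter α β

end GrayCat

/-- A Gray-functor. -/
@[ext]
structure GrayFunctor (A B : GrayCat.{u}) where
  obj : A.Obj → B.Obj
  hom : ∀ X Y, TwoFunctor (A.Hom X Y) (B.Hom (obj X) (obj Y))
  map_one : ∀ X, (hom X X).f0 (A.one X) = B.one (obj X)
  map_post : ∀ {X Y Z} (g : (A.Hom Y Z).C0),
    (A.post (X := X) g).comp (hom X Z) = (hom X Y).comp (B.post ((hom Y Z).f0 g))
  map_pre : ∀ {X Y Z} (f : (A.Hom X Y).C0),
    (A.pre (Z := Z) f).comp (hom X Z) = (hom Y Z).comp (B.pre ((hom X Y).f0 f))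
  map_inter : ∀ {X Y Z} (α : (A.Hom X Y).C1) (β : (A.Hom Y Z).C1),
    (hom X Z).f2 (A.inter α β) = B.inter ((hom X Y).f1 α) ((hom Y Z).f1 β)

namespace GrayFunctor

variable {A B C : GrayCat.{u}}

theorem map_post_f0 (F : GrayFunctor A B) {X Y Z} (g : (A.Hom Y Z).C0) (x : (A.Hom X Y).C0) :
    (F.hom X Z).f0 ((A.post g).f0 x) = (B.post ((F.hom Y Z).f0 g)).f0 ((F.hom X Y).f0 x) :=
  congrArg (fun P => P.f0 x) (F.map_post g)

theorem map_post_f1 (F : GrayFunctor A B) {X Y Z} (g : (A.Hom Y Z).C0) (x : (A.Hom X Y).C1) :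
    (F.hom X Z).f1 ((A.post g).f1 x) = (B.post ((F.hom Y Z).f0 g)).f1 ((F.hom X Y).f1 x) :=
  congrArg (fun P => P.f1 x) (F.map_post g)

theorem map_post_f2 (F : GrayFunctor A B) {X Y Z} (g : (A.Hom Y Z).C0) (x : (A.Hom X Y).C2) :
    (F.hom X Z).f2 ((A.post g).f2 x) = (B.post ((F.hom Y Z).f0 g)).f2 ((F.hom X Y).f2 x) :=
  congrArg (fun P => P.f2 x) (F.map_post g)

theorem map_pre_f0 (F : GrayFunctor A B) {X Y Z} (f : (A.Hom X Y).C0) (x : (A.Hom Y Z).C0) :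
    (F.hom X Z).f0 ((A.pre f).f0 x) = (B.pre ((F.hom X Y).f0 f)).f0 ((F.hom Y Z).f0 x) :=
  congrArg (fun P => P.f0 x) (F.map_pre f)

theorem map_pre_f1 (F : GrayFunctor A B) {X Y Z} (f : (A.Hom X Y).C0) (x : (A.Hom Y Z).C1) :
    (F.hom X Z).f1 ((A.pre f).f1 x) = (B.pre ((F.hom X Y).f0 f)).f1 ((F.hom Y Z).f1 x) :=
  congrArg (fun P => P.f1 x) (F.map_pre f)

theorem map_pre_f2 (F : GrayFunctor A B) {X Y Z} (f : (A.Hom X Y).C0) (x : (A.Hom Y Z).C2) :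
    (F.hom X Z).f2 ((A.pre f).f2 x) = (B.pre ((F.hom X Y).f0 f)).f2 ((F.hom Y Z).f2 x) :=
  congrArg (fun P => P.f2 x) (F.map_pre f)

attribute [simp] map_one map_post_f0 map_post_f1 map_post_f2 map_pre_f0 map_pre_f1 map_pre_f2
  map_inter

/-- The identity Gray-functor. -/
@[simps]
def id (A : GrayCat.{u}) : GrayFunctor A A where
  obj X := X
  hom X Y := TwoFunctor.id (A.Hom X Y)
  map_one _ := rfl
  map_post _ := rfl
  map_pre _ := rfl
  map_inter _ _ := rfl

/-- The composite of Gray-functors, `F` first. -/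
@[simps]
def comp (F : GrayFunctor A B) (G : GrayFunctor B C) : GrayFunctor A C where
  obj X := G.obj (F.obj X)
  hom X Y := (F.hom X Y).comp (G.hom (F.obj X) (F.obj Y))
  map_one _ := by simp
  map_post _ := by ext <;> simp
  map_pre _ := by ext <;> simp
  map_inter _ _ := by simp

end GrayFunctor

/-- The category of small Gray-categories and Gray-functors. -/
instance : Category GrayCat.{u} where
  Hom A B := GrayFunctor A B
  id A := GrayFunctor.id A
  comp F G := GrayFunctor.comp F G

namespace GrayCat

/-! ### The category of 1-cells up to equivalence, and fibrations -/

section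

variable (A : GrayCat.{u})

theorem one_cmp {X Y : A.Obj} (f : (A.Hom X Y).C0) : A.cmp (A.one X) f = f :=
  congrArg (fun P => P.f0 f) (A.snd_one X Y)

theorem cmp_one {X Y : A.Obj} (f : (A.Hom X Y).C0) : A.cmp f (A.one Y) = f :=
  ((A.comp X Y Y).fst_f0 f (A.one Y)).symm.trans (congrArg (fun P => P.f0 f) (A.fst_one X Y))

theorem post_f0 {X Y Z : A.Obj} (f : (A.Hom X Y).C0) (g : (A.Hom Y Z).C0) :
    (A.post g).f0 f = A.cmp f g :=
  (A.comp X Y Z).fst_f0 f g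

theorem cmp_assoc {X Y Z W : A.Obj} (f : (A.Hom X Y).C0) (g : (A.Hom Y Z).C0)
    (h : (A.Hom Z W).C0) : A.cmp (A.cmp f g) h = A.cmp f (A.cmp g h) :=
  (congrArg (fun P => P.f0 h) (A.snd_snd f g)).symm

theorem equivalent_cmp {X Y Z : A.Obj} {f f' : (A.Hom X Y).C0} (g : (A.Hom Y Z).C0)
    (h : (A.Hom X Y).Equivalent f f') : (A.Hom X Z).Equivalent (A.cmp f g) (A.cmp f' g) := by
  rw [← post_f0, ← post_f0]
  exact (A.post g).equivalent h

/-- The objects of `A`, as the objects of the category `π_* A`. -/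
def PiStar : Type u := A.Obj

/-- The category `π_* A` has the objects of `A` as objects, and equivalence classes of 1-cells
`X → Y` (that is, of objects of the 2-category `Hom X Y`) as morphisms. -/
instance : Category.{u} A.PiStar where
  Hom X Y := (A.Hom X Y).Pi
  id X := Quot.mk _ (A.one X)
  comp {X Y Z} p q := Quot.map₂ (fun f g => A.cmp f g)
    (fun f _ _ h => (A.pre f).equivalent h)
    (fun _ _ g h => A.equivalent_cmp g h) p q
  id_comp := by
    rintro X Y ⟨f⟩
    exact congrArg (Quot.mk _) (A.one_cmp f)
  comp_id := by
    rintro X Y ⟨f⟩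
    exact congrArg (Quot.mk _) (A.cmp_one f)
  assoc := by
    rintro X Y Z W ⟨f⟩ ⟨g⟩ ⟨h⟩
    exact congrArg (Quot.mk _) (A.cmp_assoc f g h)

end

end GrayCat

namespace GrayFunctor

/-- The functor `π_* F : π_* A ⥤ π_* B` induced by a Gray-functor `F`. -/
def piStar {A B : GrayCat.{u}} (F : A ⟶ B) : A.PiStar ⥤ B.PiStar where
  obj X := F.obj X
  map {X Y} p := Quot.map (F.hom X Y).f0 (fun _ _ h => (F.hom X Y).equivalent h) p
  map_id X := congrArg (Quot.mk _) (F.map_one X)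
  map_comp := by
    rintro X Y Z ⟨f⟩ ⟨g⟩
    exact congrArg (Quot.mk _) (F.map_pre_f0 f g)

/-- A functor is an isofibration if isomorphisms can be lifted along it, given a lift of their
codomain. -/
def IsIsofibration {C D : Type u} [Category.{u} C] [Category.{u} D] (P : C ⥤ D) : Prop :=
  ∀ (c : C) (d : D) (i : d ≅ P.obj c),
    ∃ (c' : C) (h : P.obj c' = d) (i' : c' ≅ c), P.map i'.hom = eqToHom h ≫ i.hom

/-- `F` is locally a fibration: it is a fibration of 2-categories on each hom. -/
def IsLocallyFibration : MorphismProperty GrayCat.{u} :=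
  fun A _ F => ∀ X Y : A.Obj, (F.hom X Y).IsFibration

/-- Fibrations of Gray-categories. -/
def IsFibration : MorphismProperty GrayCat.{u} :=
  fun _ _ F => IsLocallyFibration F ∧ IsIsofibration (piStar F)

end GrayFunctor

/-! ## Adjoint biequivalences -/

namespace GrayCat

section

variable (A : GrayCat.{u}) {X Y Z W : A.Obj}

theorem pre_one_f1 (x : (A.Hom X Y).C1) : (A.pre (A.one X)).f1 x = x :=
  congrArg (fun P => P.f1 x) (A.snd_one X Y)

theorem post_one_f1 (x : (A.Hom X Y).C1) : (A.post (A.one Y)).f1 x = x :=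
  congrArg (fun P => P.f1 x) (A.fst_one X Y)

theorem post_post_f1 (g : (A.Hom Y Z).C0) (h : (A.Hom Z W).C0) (x : (A.Hom X Y).C1) :
    (A.post h).f1 ((A.post g).f1 x) = (A.post (A.cmp g h)).f1 x := by
  rw [← A.post_f0]
  exact congrArg (fun P => P.f1 x) (A.fst_fst g h)

theorem post_pre_f1 (f : (A.Hom X Y).C0) (h : (A.Hom Z W).C0) (x : (A.Hom Y Z).C1) :
    (A.post h).f1 ((A.pre f).f1 x) = (A.pre f).f1 ((A.post h).f1 x) :=
  congrArg (fun P => P.f1 x) (A.snd_fst f h)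

theorem pre_pre_f1 (f : (A.Hom X Y).C0) (g : (A.Hom Y Z).C0) (x : (A.Hom Z W).C1) :
    (A.pre f).f1 ((A.pre g).f1 x) = (A.pre (A.cmp f g)).f1 x :=
  congrArg (fun P => P.f1 x) (A.snd_snd f g)

theorem s1_inter (α : (A.Hom X Y).C1) (β : (A.Hom Y Z).C1) :
    (A.Hom X Z).s1 ((A.Hom X Z).s2 (A.inter α β)) =
      A.cmp ((A.Hom X Y).s1 α) ((A.Hom Y Z).s1 β) := by
  simp [(A.comp X Y Z).s2_inter, post_f0]

theorem t1_inter (α : (A.Hom X Y).C1) (β : (A.Hom Y Z).C1) :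
    (A.Hom X Z).t1 ((A.Hom X Z).s2 (A.inter α β)) =
      A.cmp ((A.Hom X Y).t1 α) ((A.Hom Y Z).t1 β) := by
  simp [(A.comp X Y Z).s2_inter]

end

/-- The data of an adjoint biequivalence in `B`, before the tetrahedron equations. -/
@[ext]
structure AdjBiequivData (B : GrayCat.{u}) where
  src : B.Obj
  tgt : B.Obj
  f : (B.Hom src tgt).C0
  g : (B.Hom tgt src).C0
  /-- an adjoint equivalence `1 ≃ gf` -/
  η : (B.Hom src src).AdjEquiv
  /-- an adjoint equivalence `fg ≃ 1` -/
  ε : (B.Hom tgt tgt).AdjEquiv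
  s_η : (B.Hom src src).s1 η.l = B.one src
  t_η : (B.Hom src src).t1 η.l = B.cmp f g
  s_ε : (B.Hom tgt tgt).s1 ε.l = B.cmp g f
  t_ε : (B.Hom tgt tgt).t1 ε.l = B.one tgt
  /-- an isomorphism `εf.fη ≅ 1` -/
  S : (B.Hom src tgt).C2
  s_S : (B.Hom src tgt).s2 S =
    (B.Hom src tgt).comp1 ((B.post f).f1 η.l) ((B.pre f).f1 ε.l)
      (by simp [t_η, s_ε, post_f0, cmp_assoc])
  t_S : (B.Hom src tgt).t2 S = (B.Hom src tgt).id1 f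
  S_iso : (B.Hom src tgt).IsIso2 S
  /-- an isomorphism `1 ≅ gε.ηg` -/
  T : (B.Hom tgt src).C2
  s_T : (B.Hom tgt src).s2 T = (B.Hom tgt src).id1 g
  t_T : (B.Hom tgt src).t2 T =
    (B.Hom tgt src).comp1 ((B.pre g).f1 η.l) ((B.post g).f1 ε.l)
      (by simp [t_η, s_ε, post_f0, cmp_assoc])
  T_iso : (B.Hom tgt src).IsIso2 T

namespace AdjBiequivData

variable {B : GrayCat.{u}} (e : B.AdjBiequivData)

/-- The 3-cell `Tf.η : η → gεf.ηgf.η`. -/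
def Tfη : (B.Hom e.src e.src).C2 :=
  (B.Hom e.src e.src).hcomp ((B.Hom e.src e.src).id2 e.η.l) ((B.pre e.f).f2 e.T)
    (by simp [e.t_η, e.s_T])

/-- The 3-cell `gεf.η_η : gεf.ηgf.η → gεf.gfη.η`. -/
def gεfηη : (B.Hom e.src e.src).C2 :=
  (B.Hom e.src e.src).hcomp (B.inter e.η.l e.η.l)
    ((B.Hom e.src e.src).id2 ((B.pre e.f).f1 ((B.post e.g).f1 e.ε.l)))
    (by simp [t1_inter, e.t_η, e.s_ε, post_f0, cmp_assoc])

/-- The 3-cell `gS.η : gεf.gfη.η → η`. -/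
def gSη : (B.Hom e.src e.src).C2 :=
  (B.Hom e.src e.src).hcomp ((B.Hom e.src e.src).id2 e.η.l) ((B.post e.g).f2 e.S)
    (by simp [e.t_η, e.s_S, e.s_η, post_f0, one_cmp])

/-- The 3-cell `ε.fT : ε → ε.fgε.fηg`. -/
def εfT : (B.Hom e.tgt e.tgt).C2 :=
  (B.Hom e.tgt e.tgt).hcomp ((B.post e.f).f2 e.T) ((B.Hom e.tgt e.tgt).id2 e.ε.l)
    (by simp [e.s_ε, e.s_T, post_f0])

/-- The 3-cell `ε_ε.fηg : ε.fgε.fηg → ε.εfg.fηg`. -/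
def εεfηg : (B.Hom e.tgt e.tgt).C2 :=
  (B.Hom e.tgt e.tgt).hcomp
    ((B.Hom e.tgt e.tgt).id2 ((B.post e.f).f1 ((B.pre e.g).f1 e.η.l))) (B.inter e.ε.l e.ε.l)
    (by simp [s1_inter, e.t_η, e.s_ε, post_f0, cmp_assoc])

/-- The 3-cell `ε.Sg : ε.εfg.fηg → ε`. -/
def εSg : (B.Hom e.tgt e.tgt).C2 :=
  (B.Hom e.tgt e.tgt).hcomp ((B.pre e.g).f2 e.S) ((B.Hom e.tgt e.tgt).id2 e.ε.l)
    (by simp [e.s_ε, e.s_S, e.t_ε, cmp_one])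

theorem t2_Tfη : (B.Hom e.src e.src).t2 e.Tfη = (B.Hom e.src e.src).s2 e.gεfηη := by
  simp only [Tfη, gεfηη, TwoCat.t2_hcomp, TwoCat.s2_hcomp, TwoCat.t2_id2, TwoCat.s2_id2,
    TwoFunctor.t2_f2, e.t_T, TwoFunctor.map_comp1, (B.comp _ _ _).s2_inter, e.s_η, e.t_η,
    post_one_f1, pre_pre_f1]
  exact ((B.Hom e.src e.src).comp1_assoc _ _ _ _ _ _ _).symm

theorem t2_gεfηη : (B.Hom e.src e.src).t2 e.gεfηη = (B.Hom e.src e.src).s2 e.gSη := by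
  simp only [gSη, gεfηη, TwoCat.t2_hcomp, TwoCat.s2_hcomp, TwoCat.t2_id2, TwoCat.s2_id2,
    TwoFunctor.s2_f2, e.s_S, TwoFunctor.map_comp1, (B.comp _ _ _).t2_inter, e.s_η, e.t_η,
    pre_one_f1, post_post_f1, post_pre_f1]
  apply (B.Hom e.src e.src).comp1_assoc

theorem t2_εfT : (B.Hom e.tgt e.tgt).t2 e.εfT = (B.Hom e.tgt e.tgt).s2 e.εεfηg := by
  simp only [εfT, εεfηg, TwoCat.t2_hcomp, TwoCat.s2_hcomp, TwoCat.t2_id2, TwoCat.s2_id2,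
    TwoFunctor.t2_f2, e.t_T, TwoFunctor.map_comp1, (B.comp _ _ _).s2_inter, e.s_ε, e.t_ε,
    pre_one_f1, post_post_f1]
  apply (B.Hom e.tgt e.tgt).comp1_assoc

theorem t2_εεfηg : (B.Hom e.tgt e.tgt).t2 e.εεfηg = (B.Hom e.tgt e.tgt).s2 e.εSg := by
  simp only [εSg, εεfηg, TwoCat.t2_hcomp, TwoCat.s2_hcomp, TwoCat.t2_id2, TwoCat.s2_id2,
    TwoFunctor.s2_f2, e.s_S, TwoFunctor.map_comp1, (B.comp _ _ _).t2_inter, e.s_ε, e.t_ε,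
    post_one_f1, pre_pre_f1, post_pre_f1]
  exact ((B.Hom e.tgt e.tgt).comp1_assoc _ _ _ _ _ _ _).symm

end AdjBiequivData

/-- An adjoint biequivalence in `B`: 1-cells `f : src → tgt` and `g : tgt → src`, adjoint
equivalences `η : 1 ≃ gf` and `ε : fg ≃ 1`, and isomorphisms `S` and `T` satisfying the two
tetrahedron equations. -/
@[ext]
structure AdjBiequiv (B : GrayCat.{u}) extends AdjBiequivData B where
  tetrahedron_η :
    (B.Hom src src).vcomp
      ((B.Hom src src).vcomp toAdjBiequivData.Tfη toAdjBiequivData.gεfηη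
        toAdjBiequivData.t2_Tfη)
      toAdjBiequivData.gSη (by rw [TwoCat.t2_vcomp, toAdjBiequivData.t2_gεfηη]) =
    (B.Hom src src).id2 η.l
  tetrahedron_ε :
    (B.Hom tgt tgt).vcomp
      ((B.Hom tgt tgt).vcomp toAdjBiequivData.εfT toAdjBiequivData.εεfηg
        toAdjBiequivData.t2_εfT)
      toAdjBiequivData.εSg (by rw [TwoCat.t2_vcomp, toAdjBiequivData.t2_εεfηg]) =
    (B.Hom tgt tgt).id2 ε.l

end GrayCat

namespace GrayFunctor

variable {A B : GrayCat.{u}} (F : GrayFunctor A B)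

/-- The image of the data of an adjoint biequivalence under a Gray-functor. -/
@[simps]
def mapAdjBiequivData (e : A.AdjBiequivData) : B.AdjBiequivData where
  src := F.obj e.src
  tgt := F.obj e.tgt
  f := (F.hom _ _).f0 e.f
  g := (F.hom _ _).f0 e.g
  η := (F.hom _ _).mapAdjEquiv e.η
  ε := (F.hom _ _).mapAdjEquiv e.ε
  s_η := by simp [e.s_η]
  t_η := by simp [e.t_η]
  s_ε := by simp [e.s_ε]
  t_ε := by simp [e.t_ε]
  S := (F.hom _ _).f2 e.S
  s_S := by simp [e.s_S]
  t_S := by simp [e.t_S]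
  S_iso := (F.hom _ _).isIso2 e.S_iso
  T := (F.hom _ _).f2 e.T
  s_T := by simp [e.s_T]
  t_T := by simp [e.t_T]
  T_iso := (F.hom _ _).isIso2 e.T_iso

/-- The image of an adjoint biequivalence under a Gray-functor. -/
def mapAdjBiequiv (e : A.AdjBiequiv) : B.AdjBiequiv where
  toAdjBiequivData := F.mapAdjBiequivData e.toAdjBiequivData
  tetrahedron_η := by
    have h := congrArg (F.hom _ _).f2 e.tetrahedron_η
    simp [GrayCat.AdjBiequivData.Tfη, GrayCat.AdjBiequivData.gεfηη, GrayCat.AdjBiequivData.gSη] at h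
    exact h
  tetrahedron_ε := by
    have h := congrArg (F.hom _ _).f2 e.tetrahedron_ε
    simp [GrayCat.AdjBiequivData.εfT, GrayCat.AdjBiequivData.εεfηg, GrayCat.AdjBiequivData.εSg] at h
    exact h

/-- The adjoint-biequivalence-lifting property: adjoint biequivalences (with all of their structure)
can be lifted along `F`, given a lift of the codomain of `f`. -/
def LiftsAdjBiequiv : MorphismProperty GrayCat.{u} :=
  fun A B F => ∀ (X : A.Obj) (e : B.AdjBiequiv), e.tgt = F.obj X →
    ∃ e' : A.AdjBiequiv, e'.tgt = X ∧ mapAdjBiequiv F e' = e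

end GrayFunctor

/-- The functor sending a Gray-category to the set of adjoint biequivalences in it. -/
def adjBiequivFunctor : GrayCat.{u} ⥤ Type u where
  obj A := A.AdjBiequiv
  map F := TypeCat.ofHom (GrayFunctor.mapAdjBiequiv F)

/-- The terminal 2-category. -/
def TwoCat.point : TwoCat.{u} where
  C0 := PUnit
  C1 := PUnit
  C2 := PUnit
  s1 _ := ⟨⟩
  t1 _ := ⟨⟩
  s2 _ := ⟨⟩
  t2 _ := ⟨⟩
  s1_s2 _ := rfl
  t1_s2 _ := rfl
  id1 _ := ⟨⟩
  s1_id1 _ := rfl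
  t1_id1 _ := rfl
  id2 _ := ⟨⟩
  s2_id2 _ := rfl
  t2_id2 _ := rfl
  comp1 _ _ _ := ⟨⟩
  s1_comp1 _ _ _ := rfl
  t1_comp1 _ _ _ := rfl
  vcomp _ _ _ := ⟨⟩
  s2_vcomp _ _ _ := rfl
  t2_vcomp _ _ _ := rfl
  hcomp _ _ _ := ⟨⟩
  s2_hcomp _ _ _ := rfl
  t2_hcomp _ _ _ := rfl
  id1_comp1 _ _ _ := rfl
  comp1_id1 _ _ _ := rfl
  comp1_assoc _ _ _ _ _ _ _ := rfl
  id2_vcomp _ _ _ := rfl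
  vcomp_id2 _ _ _ := rfl
  vcomp_assoc _ _ _ _ _ _ _ := rfl
  id1_hcomp _ _ _ := rfl
  hcomp_id1 _ _ _ := rfl
  hcomp_assoc _ _ _ _ _ _ _ := rfl
  id2_hcomp_id2 _ _ _ _ := rfl
  vcomp_hcomp_vcomp _ _ _ _ _ _ _ _ _ _ := rfl

/-- The terminal Gray-category `1`, with a single cell in each dimension. -/
def GrayCat.point : GrayCat.{u} where
  Obj := PUnit
  Hom _ _ := TwoCat.point
  one _ := ⟨⟩
  comp _ _ _ :=
    { fst := fun _ => TwoFunctor.id _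
      snd := fun _ => TwoFunctor.id _
      fst_f0 := fun _ _ => rfl
      inter := fun _ _ => ⟨⟩
      s2_inter := fun _ _ => rfl
      t2_inter := fun _ _ => rfl
      inter_iso := fun _ _ => ⟨⟨⟩, rfl, rfl, rfl, rfl⟩
      id1_inter := fun _ _ => rfl
      inter_id1 := fun _ _ => rfl
      comp1_inter := fun _ _ _ _ _ _ _ => rfl
      inter_comp1 := fun _ _ _ _ _ _ _ => rfl
      fst_inter := fun _ _ _ _ _ _ => rfl
      snd_inter := fun _ _ _ _ _ _ => rfl }
  snd_one _ _ := rfl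
  fst_one _ _ := rfl
  fst_fst _ _ := rfl
  snd_fst _ _ := rfl
  snd_snd _ _ := rfl
  fst_inter _ _ _ := rfl
  inter_assoc _ _ _ := rfl
  snd_inter _ _ _ := rfl

/-! The first equivalence rests on the redundancy in the notion of adjoint biequivalence. If `f` is
a biequivalence, then composing with `f` on either side is a biequivalence of 2-categories
(`IsBiequiv.pre`, `IsBiequiv.post`), because composing with a 1-cell equivalent to an identity is
pseudonaturally equivalent to the identity 2-functor, the interchange cells being the naturality
constraints. Hence cells can be cancelled and solved for after whiskering. The `η`-tetrahedron
equation has a unique solution for `T` in terms of `S`, and for `S` in terms of `T`; and it implies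
the `ε`-tetrahedron equation (`tetrahedronEps_of_eta`). So an adjoint biequivalence amounts to `f`,
`g`, `η`, `ε` and a single invertible 3-cell (`equivSCell`, `equivTCell`).

Let `F` be a fibration. The class of `f` is invertible in `π_*`, so it lifts to the class of some
1-cell, and the local fibration property replaces that 1-cell by one lying strictly over `f`. Then
`g`, `η`, `ε` and `S` are lifted in turn (`lift_core`): at each stage a solution is found in the
domain, compared with the prescribed one downstairs by an equivalence or an invertible 3-cell, and
corrected by lifting this comparison. `T` needs no attention, being determined by the rest.
Conversely, a representative of an isomorphism of `π_*` is a biequivalence, which extends to an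
adjoint one (`exists_adjBiequiv`), and a lift of the latter gives a lift of the isomorphism.

All existence statements about Gray-categories come from one construction. In the product of a
possibly large family of Gray-categories, take the cells generated by a small set of operations of
small arity. They form a small Gray-category, since each of them is the value of a term and the
terms form a small set (`Closure.small`). Applied to all pairs of a Gray-category and a structure in
it, this yields a corepresenting object (`exists_corepresentableBy`), and in particular the
universal adjoint biequivalence. Its objects are the source and the target of the universal
structure because these span a full sub-Gray-category that already contains the structure; they
differ because they do so in a codiscrete example. Lifting the source instead of the target is no
different, because adjoint biequivalences can be reversed by a natural bijection
(`AdjBiequiv.swap`), which takes the mate of `T` as the new `S`.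

Being locally a fibration means lifting adjoint equivalences and invertible 3-cells in the homs
against their codomains. These structures are corepresentable, so two maps generate the property.
For the factorization system no transfinite argument is used: the same construction applied to all
factorizations of `F` with chosen liftings gives an initial one
(`LiftFactorization.exists_initial`), and initiality forces its first part to have the left lifting
property (`hasFactorization`). -/

namespace TwoCat

variable {X : TwoCat.{u}}

/-! ### Invertible 2-cells and whiskering -/

theorem t1_t2 (a : X.C2) : X.t1 (X.t2 a) = X.t1 (X.s2 a) := (X.t1_s2 a).symm

theorem s1_t2 (a : X.C2) : X.s1 (X.t2 a) = X.s1 (X.s2 a) := (X.s1_s2 a).symm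

attribute [simp] t1_t2 s1_t2

@[simp]
theorem comp1_comp1 (f g k : X.C1) (h₁ h₂) :
    X.comp1 (X.comp1 f g h₁) k h₂ =
      X.comp1 f (X.comp1 g k (by simpa using h₂)) (by simpa using h₁) :=
  X.comp1_assoc _ _ _ _ _ _ _

@[simp]
theorem vcomp_vcomp (a b c : X.C2) (h₁ h₂) :
    X.vcomp (X.vcomp a b h₁) c h₂ =
      X.vcomp a (X.vcomp b c (by simpa using h₂)) (by simpa using h₁) :=
  X.vcomp_assoc _ _ _ _ _ _ _

/-- The whiskering of a 2-cell by a 1-cell in front of it. -/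
def wl (f : X.C1) (a : X.C2) (h : X.t1 f = X.s1 (X.s2 a)) : X.C2 :=
  X.hcomp (X.id2 f) a (by simpa using h)

/-- The whiskering of a 2-cell by a 1-cell after it. -/
def wr (a : X.C2) (f : X.C1) (h : X.t1 (X.s2 a) = X.s1 f) : X.C2 :=
  X.hcomp a (X.id2 f) (by simpa using h)

@[simp]
theorem s2_wl (f : X.C1) (a : X.C2) (h) : X.s2 (X.wl f a h) = X.comp1 f (X.s2 a) h := by
  simp [wl]

@[simp]
theorem t2_wl (f : X.C1) (a : X.C2) (h) :
    X.t2 (X.wl f a h) = X.comp1 f (X.t2 a) (by simpa using h) := by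
  simp [wl]

@[simp]
theorem s2_wr (a : X.C2) (f : X.C1) (h) : X.s2 (X.wr a f h) = X.comp1 (X.s2 a) f h := by
  simp [wr]

@[simp]
theorem t2_wr (a : X.C2) (f : X.C1) (h) :
    X.t2 (X.wr a f h) = X.comp1 (X.t2 a) f (by simpa using h) := by
  simp [wr]

@[simp]
theorem wl_id2 (f g : X.C1) (h) : X.wl f (X.id2 g) h = X.id2 (X.comp1 f g (by simpa using h)) :=
  X.id2_hcomp_id2 _ _ _ _

@[simp]
theorem wr_id2 (f g : X.C1) (h) : X.wr (X.id2 f) g h = X.id2 (X.comp1 f g (by simpa using h)) :=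
  X.id2_hcomp_id2 _ _ _ _

theorem wl_vcomp (f : X.C1) (a b : X.C2) (h h') :
    X.wl f (X.vcomp a b h) h' = X.vcomp (X.wl f a (by simpa using h'))
      (X.wl f b (by rw [← h]; simpa using h')) (by simp [h]) := by
  unfold wl
  have := X.vcomp_hcomp_vcomp (X.id2 f) (X.id2 f) a b (by simp) h (by simpa using h')
    (by simpa using h') (by rw [← h]; simpa using h') (by simp [h])
  simpa using this

theorem wr_vcomp (a b : X.C2) (f : X.C1) (h h') :
    X.wr (X.vcomp a b h) f h' = X.vcomp (X.wr a f (by simpa using h'))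
      (X.wr b f (by rw [← h]; simpa using h')) (by simp [h]) := by
  unfold wr
  have := X.vcomp_hcomp_vcomp a b (X.id2 f) (X.id2 f) h (by simp) (by simpa using h')
    (by simpa using h') (by rw [← h]; simpa using h') (by simp [h])
  simpa using this

theorem wl_wl (f g : X.C1) (a : X.C2) (h h') :
    X.wl f (X.wl g a h) h' = X.wl (X.comp1 f g (by simpa using h')) a (by simpa using h) := by
  unfold wl
  rw [← X.hcomp_assoc _ _ _ (by simpa [wl] using h') (by simpa using h) _ _]
  congr 1
  exact X.id2_hcomp_id2 _ _ _ _

theorem wr_wr (a : X.C2) (f g : X.C1) (h h') :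
    X.wr (X.wr a f h) g h' = X.wr a (X.comp1 f g (by simpa using h')) (by simpa using h) := by
  unfold wr
  rw [X.hcomp_assoc _ _ _ _ _ (by simpa [wr] using h') (by simpa using h)]
  congr 1
  exact X.id2_hcomp_id2 _ _ _ _

theorem wr_wl (f : X.C1) (a : X.C2) (g : X.C1) (h h') :
    X.wr (X.wl f a h) g h' = X.wl f (X.wr a g (by simpa using h')) (by simpa using h) :=
  X.hcomp_assoc _ _ _ _ _ _ _

@[simp]
theorem wl_id1 (x : X.C0) (a : X.C2) (h) : X.wl (X.id1 x) a h = a := X.id1_hcomp _ _ _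

@[simp]
theorem wr_id1 (a : X.C2) (x : X.C0) (h) : X.wr a (X.id1 x) h = a := X.hcomp_id1 _ _ _

theorem wr_vcomp_wl (a b : X.C2) (h : X.t1 (X.s2 a) = X.s1 (X.s2 b)) :
    X.vcomp (X.wr a (X.s2 b) h) (X.wl (X.t2 a) b (by simpa using h)) (by simp) =
      X.hcomp a b h := by
  unfold wl wr
  have := X.vcomp_hcomp_vcomp a (X.id2 (X.t2 a)) (X.id2 (X.s2 b)) b (by simp) (by simp)
    (by simpa using h) (by simpa using h) (by simpa using h) (by simp)
  simpa using this.symm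

theorem wl_vcomp_wr (a b : X.C2) (h : X.t1 (X.s2 a) = X.s1 (X.s2 b)) :
    X.vcomp (X.wl (X.s2 a) b h) (X.wr a (X.t2 b) (by simpa using h)) (by simp) =
      X.hcomp a b h := by
  unfold wl wr
  have := X.vcomp_hcomp_vcomp (X.id2 (X.s2 a)) a b (X.id2 (X.t2 b)) (by simp) (by simp)
    (by simpa using h) (by simpa using h) (by simpa using h) (by simp)
  simpa using this.symm

theorem exchange (a b : X.C2) {f f' g g' : X.C1} (hf : X.s2 a = f) (hf' : X.t2 a = f')
    (hg : X.s2 b = g) (hg' : X.t2 b = g') (h₁ h₂ h₃ h₄ h₅ h₆) :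
    X.vcomp (X.wr a g h₁) (X.wl f' b h₂) h₃ = X.vcomp (X.wl f b h₄) (X.wr a g' h₅) h₆ := by
  subst hf hf' hg hg'
  rw [wr_vcomp_wl, wl_vcomp_wr]

/-- The inverse of an invertible 2-cell. -/
noncomputable def inv (a : X.C2) (ha : X.IsIso2 a) : X.C2 := ha.choose

section

variable {a : X.C2} (ha : X.IsIso2 a)

@[simp]
theorem s2_inv : X.s2 (X.inv a ha) = X.t2 a := ha.choose_spec.choose.symm

@[simp]
theorem t2_inv : X.t2 (X.inv a ha) = X.s2 a := ha.choose_spec.choose_spec.choose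

@[simp]
theorem vcomp_inv (h) : X.vcomp a (X.inv a ha) h = X.id2 (X.s2 a) :=
  ha.choose_spec.choose_spec.choose_spec.1

@[simp]
theorem inv_vcomp (h) : X.vcomp (X.inv a ha) a h = X.id2 (X.t2 a) := by
  rw [← s2_inv ha]
  exact ha.choose_spec.choose_spec.choose_spec.2

@[simp]
theorem vcomp_inv_assoc (b : X.C2) (h h') : X.vcomp a (X.vcomp (X.inv a ha) b h) h' = b := by
  rw [← X.vcomp_assoc _ _ _ (by simp) (by simpa using h)]
  simp only [vcomp_inv]
  apply X.id2_vcomp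

@[simp]
theorem inv_vcomp_assoc (b : X.C2) (h h') : X.vcomp (X.inv a ha) (X.vcomp a b h) h' = b := by
  rw [← X.vcomp_assoc _ _ _ (by simp) (by simpa using h)]
  simp only [inv_vcomp]
  apply X.id2_vcomp

theorem isIso2_inv : X.IsIso2 (X.inv a ha) :=
  ⟨a, by simp, by simp, by simp, by simp⟩

theorem eq_inv_of_vcomp {b : X.C2} (h) (hb : X.vcomp a b h = X.id2 (X.s2 a)) :
    b = X.inv a ha := by
  have h' := inv_vcomp_assoc ha b h (by simp)
  simp only [hb] at h'
  rw [← h', X.vcomp_id2]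

include ha in
theorem IsIso2.cancel_left {b c : X.C2} (h h') (e : X.vcomp a b h = X.vcomp a c h') : b = c := by
  rw [← inv_vcomp_assoc ha b h (by simp), ← inv_vcomp_assoc ha c h' (by simp)]
  simp only [e]

include ha in
theorem IsIso2.cancel_right {b c : X.C2} (h h') (e : X.vcomp b a h = X.vcomp c a h') : b = c := by
  have hb : X.vcomp (X.vcomp b a h) (X.inv a ha) (by simp) = b := by
    simp [← h]
  have hc : X.vcomp (X.vcomp c a h') (X.inv a ha) (by simp) = c := by
    simp [← h']
  rw [← hb, ← hc]
  simp only [e]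

end

theorem isIso2_id2 (f : X.C1) : X.IsIso2 (X.id2 f) := ⟨X.id2 f, by simp, by simp, by simp, by simp⟩

theorem IsIso2.vcomp {a b : X.C2} (ha : X.IsIso2 a) (hb : X.IsIso2 b) (h) :
    X.IsIso2 (X.vcomp a b h) :=
  ⟨X.vcomp (X.inv b hb) (X.inv a ha) (by simp [h]), by simp, by simp, by simp, by simp⟩

theorem IsIso2.wl {a : X.C2} (ha : X.IsIso2 a) (f : X.C1) (h) : X.IsIso2 (X.wl f a h) :=
  ⟨X.wl f (X.inv a ha) (by simpa using h), by simp, by simp,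
    by rw [← wl_vcomp _ _ _ (by simp) (by simpa using h)]; simp,
    by rw [← wl_vcomp _ _ _ (by simp) (by simpa using h)]; simp⟩

theorem IsIso2.wr {a : X.C2} (ha : X.IsIso2 a) (f : X.C1) (h) : X.IsIso2 (X.wr a f h) :=
  ⟨X.wr (X.inv a ha) f (by simpa using h), by simp, by simp,
    by rw [← wr_vcomp _ _ _ (by simp) (by simpa using h)]; simp,
    by rw [← wr_vcomp _ _ _ (by simp) (by simpa using h)]; simp⟩

/-- Two 1-cells are isomorphic. -/
def Iso1 (X : TwoCat.{u}) (f g : X.C1) : Prop := ∃ a, X.IsIso2 a ∧ X.s2 a = f ∧ X.t2 a = g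

namespace Iso1

theorem refl (f : X.C1) : X.Iso1 f f := ⟨X.id2 f, X.isIso2_id2 f, by simp, by simp⟩

theorem symm {f g : X.C1} : X.Iso1 f g → X.Iso1 g f := by
  rintro ⟨a, ha, rfl, rfl⟩
  exact ⟨_, isIso2_inv ha, by simp, by simp⟩

theorem trans {f g k : X.C1} : X.Iso1 f g → X.Iso1 g k → X.Iso1 f k := by
  rintro ⟨a, ha, rfl, rfl⟩ ⟨b, hb, h, rfl⟩
  exact ⟨_, ha.vcomp hb h.symm, by simp, by simp⟩

theorem s1_eq {f g : X.C1} : X.Iso1 f g → X.s1 f = X.s1 g := by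
  rintro ⟨a, ha, rfl, rfl⟩
  simp

theorem t1_eq {f g : X.C1} : X.Iso1 f g → X.t1 f = X.t1 g := by
  rintro ⟨a, ha, rfl, rfl⟩
  simp

theorem comp_left {f g : X.C1} (h : X.Iso1 f g) (l : X.C1) (h₁ h₂) :
    X.Iso1 (X.comp1 l f h₁) (X.comp1 l g h₂) := by
  obtain ⟨a, ha, rfl, rfl⟩ := h
  exact ⟨_, ha.wl l h₁, by simp, by simp⟩

theorem comp_right {f g : X.C1} (h : X.Iso1 f g) (l : X.C1) (h₁ h₂) :
    X.Iso1 (X.comp1 f l h₁) (X.comp1 g l h₂) := by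
  obtain ⟨a, ha, rfl, rfl⟩ := h
  exact ⟨_, ha.wr l h₁, by simp, by simp⟩

theorem map {Y : TwoCat.{u}} (P : TwoFunctor X Y) {f g : X.C1} (h : X.Iso1 f g) :
    Y.Iso1 (P.f1 f) (P.f1 g) := by
  obtain ⟨a, ha, rfl, rfl⟩ := h
  exact ⟨_, P.isIso2 ha, by simp, by simp⟩

end Iso1

/-! ### Equivalences -/

theorem isEquivalence_iff {f : X.C1} : X.IsEquivalence f ↔
    ∃ (g : X.C1) (h : X.t1 f = X.s1 g) (h' : X.t1 g = X.s1 f),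
      X.Iso1 (X.id1 (X.s1 f)) (X.comp1 f g h) ∧ X.Iso1 (X.comp1 g f h') (X.id1 (X.s1 g)) := by
  constructor
  · rintro ⟨g, h, h', a, b, ha, ha1, ha2, hb, hb1, hb2⟩
    exact ⟨g, h, h', ⟨a, ha, ha1, ha2⟩, ⟨b, hb, hb1, hb2⟩⟩
  · rintro ⟨g, h, h', ⟨a, ha, ha1, ha2⟩, ⟨b, hb, hb1, hb2⟩⟩
    exact ⟨g, h, h', a, b, ha, ha1, ha2, hb, hb1, hb2⟩

theorem isEquivalence_id1 (x : X.C0) : X.IsEquivalence (X.id1 x) := by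
  rw [isEquivalence_iff]
  refine ⟨X.id1 x, by simp, by simp, ?_, ?_⟩ <;> simpa using Iso1.refl _

theorem IsEquivalence.exists_inverse {f : X.C1} (hf : X.IsEquivalence f) :
    ∃ (g : X.C1) (h : X.t1 f = X.s1 g) (h' : X.t1 g = X.s1 f), X.IsEquivalence g ∧
      X.Iso1 (X.id1 (X.s1 f)) (X.comp1 f g h) ∧ X.Iso1 (X.comp1 g f h') (X.id1 (X.s1 g)) := by
  obtain ⟨g, h, h', a, b⟩ := isEquivalence_iff.1 hf
  exact ⟨g, h, h', isEquivalence_iff.2 ⟨f, h', h, b.symm, a.symm⟩, a, b⟩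

theorem IsEquivalence.comp1 {f g : X.C1} (hf : X.IsEquivalence f) (hg : X.IsEquivalence g) (h) :
    X.IsEquivalence (X.comp1 f g h) := by
  obtain ⟨f', h₁, h₂, a, b⟩ := isEquivalence_iff.1 hf
  obtain ⟨g', h₃, h₄, c, d⟩ := isEquivalence_iff.1 hg
  rw [isEquivalence_iff]
  refine ⟨X.comp1 g' f' (by rw [h₄, ← h, h₁]), by simpa using h₃, by simpa using h₂, ?_, ?_⟩
  · have := ((c.comp_right f' (by simp [← h, h₁]) (by simp [h₄, ← h, h₁])).comp_left f
      (by rw [s1_comp1, s1_id1, h]) (by rw [s1_comp1, s1_comp1, h]))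
    simp only [comp1_comp1, id1_comp1] at this
    simpa using a.trans this
  · have := (b.comp_right g (by simp [h]) (by simp [← h, h₁])).comp_left g'
      (by simp [h₄, ← h, h₁]) (by simp [h₄, ← h, h₁])
    simp [← h₁] at this
    simpa using this.trans (by simpa using d)

theorem IsEquivalence.of_iso1 {f g : X.C1} (hf : X.IsEquivalence f) (h : X.Iso1 f g) :
    X.IsEquivalence g := by
  obtain ⟨f', h₁, h₂, a, b⟩ := isEquivalence_iff.1 hf
  rw [isEquivalence_iff]
  refine ⟨f', by rw [← h.t1_eq, h₁], by rw [← h.s1_eq, h₂], ?_, ?_⟩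
  · rw [← h.s1_eq]
    exact a.trans (h.comp_right _ _ _)
  · exact (h.symm.comp_left _ _ _).trans b

theorem equivalent_equivalence : Equivalence X.Equivalent where
  refl x := ⟨X.id1 x, isEquivalence_id1 x, by simp, by simp⟩
  symm := by
    rintro x y ⟨f, hf, rfl, rfl⟩
    obtain ⟨g, h, h', hg, -⟩ := hf.exists_inverse
    exact ⟨g, hg, h.symm, h'⟩
  trans := by
    rintro x y z ⟨f, hf, rfl, rfl⟩ ⟨g, hg, h, rfl⟩
    exact ⟨X.comp1 f g h.symm, hf.comp1 hg _, by simp, by simp⟩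

theorem quot_mk_eq_iff {x y : X.C0} :
    (Quot.mk _ x : X.Pi) = Quot.mk _ y ↔ X.Equivalent x y :=
  equivalent_equivalence.quot_mk_eq_iff x y

end TwoCat

/-! ### Duality for 1-cells, and cancellation of equivalences. -/

namespace TwoCat

variable {X : TwoCat.{u}}

/-- The 2-category with the 1-cells reversed. -/
def op (X : TwoCat.{u}) : TwoCat.{u} where
  C0 := X.C0
  C1 := X.C1
  C2 := X.C2
  s1 := X.t1
  t1 := X.s1
  s2 := X.s2
  t2 := X.t2
  s1_s2 := X.t1_s2
  t1_s2 := X.s1_s2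
  id1 := X.id1
  s1_id1 := X.t1_id1
  t1_id1 := X.s1_id1
  id2 := X.id2
  s2_id2 := X.s2_id2
  t2_id2 := X.t2_id2
  comp1 f g h := X.comp1 g f h.symm
  s1_comp1 _ _ _ := X.t1_comp1 _ _ _
  t1_comp1 _ _ _ := X.s1_comp1 _ _ _
  vcomp := X.vcomp
  s2_vcomp := X.s2_vcomp
  t2_vcomp := X.t2_vcomp
  hcomp a b h := X.hcomp b a h.symm
  s2_hcomp _ _ _ := X.s2_hcomp _ _ _
  t2_hcomp _ _ _ := X.t2_hcomp _ _ _
  id1_comp1 _ _ _ := X.comp1_id1 _ _ _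
  comp1_id1 _ _ _ := X.id1_comp1 _ _ _
  comp1_assoc _ _ _ _ _ _ _ := (X.comp1_assoc _ _ _ _ _ _ _).symm
  id2_vcomp := X.id2_vcomp
  vcomp_id2 := X.vcomp_id2
  vcomp_assoc := X.vcomp_assoc
  id1_hcomp _ _ _ := X.hcomp_id1 _ _ _
  hcomp_id1 _ _ _ := X.id1_hcomp _ _ _
  hcomp_assoc _ _ _ _ _ _ _ := (X.hcomp_assoc _ _ _ _ _ _ _).symm
  id2_hcomp_id2 _ _ _ _ := X.id2_hcomp_id2 _ _ _ _
  vcomp_hcomp_vcomp _ _ _ _ _ _ _ _ _ _ := X.vcomp_hcomp_vcomp _ _ _ _ _ _ _ _ _ _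

theorem IsEquivalence.op {f : X.C1} (hf : X.IsEquivalence f) : X.op.IsEquivalence f := by
  obtain ⟨g, h, h', a, b⟩ := isEquivalence_iff.1 hf
  exact isEquivalence_iff.2 ⟨g, h'.symm, h.symm, by rw [← h] at b; exact b.symm,
    by rw [← h'] at a; exact a.symm⟩

namespace IsEquivalence

variable {l : X.C1} (hl : X.IsEquivalence l)

/-- Interchanging `a` with the counit `c` expresses `a`, up to whiskerings of `c`, through `l ◁ a`.
This is the source of both faithfulness and fullness of whiskering by `l`. -/
theorem conj_counit {l r : X.C1} (h : X.t1 r = X.s1 l) {c : X.C2} (sc : X.s2 c = X.comp1 r l h)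
    (tc : X.t2 c = X.id1 (X.t1 l)) (a : X.C2) {f g : X.C1} (sa : X.s2 a = f) (ta : X.t2 a = g)
    (ha : X.t1 l = X.s1 (X.s2 a)) (h₁ h₂ h₃ h₄ h₅) :
    X.vcomp (X.wr c f h₁) a h₂ = X.vcomp (X.wl r (X.wl l a ha) h₃) (X.wr c g h₄) h₅ := by
  have := exchange c a sc tc sa ta h₁ (by simpa using ha) (by simp [sa, tc])
    (by simpa using ha) h₄ (by simp [ta, sc])
  simpa [wl_wl] using this

include hl

theorem wl_cancel {a b : X.C2} (ha hb) (hs : X.s2 a = X.s2 b) (ht : X.t2 a = X.t2 b)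
    (h : X.wl l a ha = X.wl l b hb) : a = b := by
  obtain ⟨r, h₁, h₂, -, c, hc, sc, tc⟩ := isEquivalence_iff.1 hl
  rw [← h₁] at tc
  have e₁ := conj_counit h₂ sc tc a hs ht ha (by simp [sc, ← hs, ha]) (by simp [hs, tc])
    (by simp [h₂]) (by simp [sc, ← ht, ha]) (by simp [sc, ht])
  have e₂ := conj_counit h₂ sc tc b rfl rfl hb (by simp [sc, hb]) (by simp [tc])
    (by simp [h₂]) (by simp [sc, hb]) (by simp [sc])
  simp only [h] at e₁
  exact (hc.wr _ _).cancel_left _ _ (e₁.trans e₂.symm)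

/-- `conj_counit` dictates the only possible preimage: the conjugate of `r ◁ c` by the counit `d`.
That it works is checked after whiskering with `r`, which is also an equivalence and hence
cancellable. -/
theorem exists_wl_eq {c : X.C2} {f g : X.C1} (hf : X.t1 l = X.s1 f) (hg : X.t1 l = X.s1 g)
    (sc : X.s2 c = X.comp1 l f hf) (tc : X.t2 c = X.comp1 l g hg) :
    ∃ (a : X.C2) (sa : X.s2 a = f) (_ : X.t2 a = g), X.wl l a (by rw [sa, hf]) = c := by
  obtain ⟨r, h₁, h₂, hr, -, d, hd, sd, td⟩ := hl.exists_inverse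
  rw [← h₁] at td
  have hdf : X.t1 (X.s2 d) = X.s1 f := by simp [sd, hf]
  have hdg : X.t1 (X.s2 d) = X.s1 g := by simp [sd, hg]
  have hrc : X.t1 r = X.s1 (X.s2 c) := by simp [sc, h₂]
  have hdc : X.t2 (X.wl r c hrc) = X.s2 (X.wr d g hdg) := by simp [tc, sd]
  have hdm : X.s2 (X.vcomp (X.wl r c hrc) (X.wr d g hdg) hdc) = X.s2 (X.wr d f hdf) := by
    simp [sd, sc]
  obtain ⟨a, sa, ta, hda, ha⟩ : ∃ (a : X.C2) (_ : X.s2 a = f) (_ : X.t2 a = g)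
      (h : X.t2 (X.wr d f hdf) = X.s2 a),
      X.vcomp (X.wr d f hdf) a h = X.vcomp (X.wl r c hrc) (X.wr d g hdg) hdc :=
    ⟨X.vcomp (X.inv _ (hd.wr f hdf)) _ (by rw [t2_inv, hdm]), by simp [td, hf], by simp [td, hg],
      by simp, vcomp_inv_assoc _ _ _ _⟩
  refine ⟨a, sa, ta, ?_⟩
  apply hr.wl_cancel (by simp [h₂]) hrc (by simp [sa, sc]) (by simp [ta, tc])
  have e := conj_counit h₂ sd td a sa ta (by simp [sa, hf]) hdf hda (by simp [h₂]) hdg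
    (by simp [ta, sd])
  exact (hd.wr g hdg).cancel_right _ _ (e.symm.trans ha)

theorem exists_comp1_iso (k : X.C1) (hk : X.s1 k = X.s1 l) :
    ∃ (f : X.C1) (hf : X.t1 l = X.s1 f), X.Iso1 (X.comp1 l f hf) k := by
  obtain ⟨r, h₁, h₂, hr, a, -⟩ := hl.exists_inverse
  refine ⟨X.comp1 r k (by rw [h₂, hk]), by simp [h₁], ?_⟩
  have := (a.comp_right k (by simpa using hk.symm) (by simp [hk, h₂])).symm
  simp only [comp1_comp1, id1_comp1] at this
  exact this

theorem isIso2_of_wl {a : X.C2} (h) (ha : X.IsIso2 (X.wl l a h)) : X.IsIso2 a := by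
  obtain ⟨b, sb, tb, e⟩ := hl.exists_wl_eq (c := X.inv _ ha) (f := X.t2 a) (g := X.s2 a)
    (by simpa using h) h (by simp) (by simp)
  refine ⟨b, sb.symm, tb, ?_, ?_⟩
  · apply hl.wl_cancel (by simpa using h) (by simpa using h) (by simp) (by simp [tb])
    rw [wl_vcomp _ _ _ _ (by simpa using h)]
    simp [e]
  · apply hl.wl_cancel (by simp [sb, h]) (by simp [sb, h]) (by simp) (by simp [sb])
    rw [wl_vcomp _ _ _ _ (by simp [sb, h])]
    simp [e, sb]

theorem wr_cancel {a b : X.C2} (ha hb) (hs : X.s2 a = X.s2 b) (ht : X.t2 a = X.t2 b)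
    (h : X.wr a l ha = X.wr b l hb) : a = b :=
  hl.op.wl_cancel ha.symm hb.symm hs ht h

theorem exists_wr_eq {c : X.C2} {f g : X.C1} (hf : X.t1 f = X.s1 l) (hg : X.t1 g = X.s1 l)
    (sc : X.s2 c = X.comp1 f l hf) (tc : X.t2 c = X.comp1 g l hg) :
    ∃ (a : X.C2) (sa : X.s2 a = f) (_ : X.t2 a = g), X.wr a l (by rw [sa, hf]) = c :=
  hl.op.exists_wl_eq hf.symm hg.symm sc tc

theorem exists_comp1_iso' (k : X.C1) (hk : X.t1 k = X.t1 l) :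
    ∃ (f : X.C1) (hf : X.t1 f = X.s1 l), X.Iso1 (X.comp1 f l hf) k := by
  obtain ⟨f, hf, h⟩ := hl.op.exists_comp1_iso k hk
  exact ⟨f, hf.symm, h⟩

theorem iso1_of_comp_left {f g : X.C1} (hf : X.t1 l = X.s1 f) (hg : X.t1 l = X.s1 g)
    (h : X.Iso1 (X.comp1 l f hf) (X.comp1 l g hg)) : X.Iso1 f g := by
  obtain ⟨c, hc, sc, tc⟩ := h
  obtain ⟨a, sa, ta, rfl⟩ := hl.exists_wl_eq hf hg sc tc
  exact ⟨a, hl.isIso2_of_wl _ hc, sa, ta⟩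

theorem iso1_of_comp_right {f g : X.C1} (hf : X.t1 f = X.s1 l) (hg : X.t1 g = X.s1 l)
    (h : X.Iso1 (X.comp1 f l hf) (X.comp1 g l hg)) : X.Iso1 f g :=
  hl.op.iso1_of_comp_left hf.symm hg.symm h

theorem of_comp_left {f : X.C1} (hf : X.t1 l = X.s1 f) (h : X.IsEquivalence (X.comp1 l f hf)) :
    X.IsEquivalence f := by
  obtain ⟨r, h₁, h₂, hr, a, b⟩ := hl.exists_inverse
  refine (hr.comp1 h (by simpa using h₂)).of_iso1 ?_
  rw [← X.comp1_assoc _ _ _ h₂ (by simpa using hf)]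
  have := b.comp_right f (by simpa using hf) (by simp [← h₁, hf])
  rwa [id1_comp1] at this

theorem of_comp_right {f : X.C1} (hf : X.t1 f = X.s1 l) (h : X.IsEquivalence (X.comp1 f l hf)) :
    X.IsEquivalence f :=
  (hl.op.of_comp_left hf.symm h.op).op

end IsEquivalence

/-! ### Adjoint equivalences -/

theorem AdjEquiv.isEquivalence (e : X.AdjEquiv) : X.IsEquivalence e.l :=
  ⟨e.r, e.t_l, e.t_r, e.unit, e.counit, e.unit_iso, e.s_unit, e.t_unit, e.counit_iso, e.s_counit,
    e.t_counit⟩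

theorem AdjEquiv.isEquivalence_r (e : X.AdjEquiv) : X.IsEquivalence e.r :=
  isEquivalence_iff.2 ⟨e.l, e.t_r, e.t_l,
    Iso1.symm ⟨e.counit, e.counit_iso, e.s_counit, e.t_counit⟩,
    Iso1.symm ⟨e.unit, e.unit_iso, e.s_unit, e.t_unit⟩⟩

/-- An inverse of an equivalence together with a unit extends to an adjoint equivalence. -/
theorem IsEquivalence.exists_adjEquiv {l r : X.C1} (hl : X.IsEquivalence l)
    (t_l : X.t1 l = X.s1 r) (t_r : X.t1 r = X.s1 l) {unit : X.C2} (hu : X.IsIso2 unit)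
    (s_unit : X.s2 unit = X.id1 (X.s1 l)) (t_unit : X.t2 unit = X.comp1 l r t_l) :
    ∃ e : X.AdjEquiv, e.l = l ∧ e.r = r ∧ e.unit = unit := by
  have hul : X.t1 (X.s2 unit) = X.s1 l := by simp [s_unit]
  -- The first triangle equation says exactly that `l ◁ c` is inverse to `unit ▷ l`, so it serves as
  -- the definition of the counit.
  obtain ⟨c, sc, tc, e⟩ := hl.exists_wl_eq (c := X.inv _ (hu.wr l hul)) (f := X.comp1 r l t_r)
    (g := X.id1 (X.t1 l)) (by simp [t_l]) (by simp) (by simp [t_unit]) (by simp [s_unit])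
  have hc : X.IsIso2 c := hl.isIso2_of_wl _ (by rw [e]; exact isIso2_inv _)
  have hlc : X.t1 l = X.s1 (X.s2 c) := by simp [sc, t_l]
  refine ⟨⟨l, r, t_l, t_r, unit, c, s_unit, t_unit, sc, by rw [tc, t_l], hu, hc, ?_, ?_⟩,
    rfl, rfl, rfl⟩
  · change X.vcomp (X.wr unit l hul) (X.wl l c hlc) _ = _
    simp [e, s_unit]
  · have hru : X.t1 r = X.s1 (X.s2 unit) := by simp [s_unit, t_r]
    have hcr : X.t1 (X.s2 c) = X.s1 r := by simp [sc, t_l]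
    have hruc : X.t2 (X.wl r unit hru) = X.s2 (X.wr c r hcr) := by simp [t_unit, sc]
    change X.vcomp (X.wl r unit hru) (X.wr c r hcr) hruc = _
    refine hl.wl_cancel (by simp [s_unit, t_l]) (by simp [t_l]) (by simp [s_unit, ← t_r])
      (by simp [tc, t_l]) ?_
    rw [wl_vcomp _ _ _ _ (by simp [s_unit, t_l])]
    -- Interchanging the unit with itself and cancelling it makes its two whiskerings by `l`
    -- followed by `r` agree. The second triangle, whiskered by `l`, then becomes `unit ▷ l`
    -- composed with its inverse, all whiskered by `r`.
    have hx := exchange unit unit s_unit t_unit s_unit t_unit (by simp [s_unit])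
      (by simp [s_unit, t_r]) (by simp [s_unit, t_unit]) (by simp [s_unit])
      (by simp [s_unit]) (by simp [s_unit, t_unit])
    simp only [wr_id1, wl_id1] at hx
    have e₁ : X.wl l (X.wl r unit hru) (by simp [s_unit, t_l]) = X.wr (X.wr unit l hul) r
        (by simp [t_l]) := by
      rw [wl_wl, wr_wr]
      exact hu.cancel_left _ _ hx
    have e₂ : X.wl l (X.wr c r hcr) (by simp [sc, t_l]) = X.wr (X.inv _ (hu.wr l hul)) r
        (by simp [t_l]) := by
      rw [← wr_wl _ _ _ hlc (by simp [sc, t_l])]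
      simp only [e]
    simp only [e₁, e₂]
    rw [← wr_vcomp _ _ _ (by simp) (by simp [s_unit, t_l])]
    simp [s_unit]

theorem IsEquivalence.exists_adjEquiv' {l : X.C1} (hl : X.IsEquivalence l) :
    ∃ e : X.AdjEquiv, e.l = l := by
  obtain ⟨r, h, h', -, ⟨u, hu, su, tu⟩, -⟩ := hl.exists_inverse
  obtain ⟨e, he, -⟩ := hl.exists_adjEquiv h h' hu su tu
  exact ⟨e, he⟩

/-- The first triangle equation determines `l ◁ counit`, and whiskering by the equivalence `l` is
faithful. -/
theorem AdjEquiv.ext_of_unit {e e' : X.AdjEquiv} (hl : e.l = e'.l) (hr : e.r = e'.r)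
    (hu : e.unit = e'.unit) : e = e' := by
  refine AdjEquiv.ext hl hr hu ?_
  obtain ⟨l, r, t_l, t_r, unit, c, su, tu, sc, tc, iu, ic, h, h'⟩ := e
  obtain ⟨l', r', t_l', t_r', unit', c', su', tu', sc', tc', iu', ic', k, k'⟩ := e'
  dsimp at *
  subst hl hr hu
  have el : X.IsEquivalence l := isEquivalence_iff.2 ⟨r, t_l, t_r, ⟨_, iu, su, tu⟩, ⟨_, ic, sc, tc⟩⟩
  refine el.wl_cancel (by simp [sc, t_l]) (by simp [sc', t_l]) (by simp [sc, sc'])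
    (by simp [tc, tc']) ?_
  exact (iu.wr l (by simp [su])).cancel_left (by simp [sc, tu]) (by simp [sc', tu])
    (h.trans k.symm)

/-- Adjoint equivalences can be lifted along a fibration, given a lift of the left adjoint to an
equivalence. -/
theorem _root_.TwoFunctor.IsFibration.exists_adjEquiv {Y : TwoCat.{u}} {P : TwoFunctor X Y}
    (hP : P.IsFibration) {l : X.C1} (hl : X.IsEquivalence l) (e : Y.AdjEquiv)
    (he : P.f1 l = e.l) : ∃ e' : X.AdjEquiv, e'.l = l ∧ P.mapAdjEquiv e' = e := by
  obtain ⟨r₀, h₁, h₂, hr₀, ⟨u₀, hu₀, su₀, tu₀⟩, -⟩ := hl.exists_inverse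
  have hcomp : Y.s2 (Y.inv e.unit e.unit_iso) = Y.comp1 e.l e.r e.t_l := by simp [e.t_unit]
  have hr : Y.t1 e.l = Y.s1 (P.f1 r₀) := by simp [← he, h₁]
  have hs : Y.s1 e.l = P.f0 (X.s1 l) := by simp [← he]
  -- Both `e.r` and `P.f1 r₀` are inverse to `e.l`. Comparing the two units gives an isomorphism `b`
  -- between them, whose lift corrects `r₀`.
  obtain ⟨b, sb, tb, eb⟩ := e.isEquivalence.exists_wl_eq
    (c := Y.vcomp (Y.inv e.unit e.unit_iso) (P.f2 u₀) (by simp [e.s_unit, su₀, hs]))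
    (f := e.r) (g := P.f1 r₀) e.t_l hr (by simp [hcomp]) (by simp [tu₀, he])
  have hb : Y.IsIso2 b := e.isEquivalence.isIso2_of_wl _
    (by rw [eb]; exact (isIso2_inv _).vcomp (P.isIso2 hu₀) _)
  obtain ⟨b', hb', tb', rfl⟩ := hP.2 r₀ b hb tb
  have hlb' : X.t1 l = X.s1 (X.s2 b') := by rw [← s1_t2, tb', h₁]
  -- The unit `u₀` is transported along the lifted isomorphism, so that its image is `e.unit`; the
  -- counit is then taken care of by `AdjEquiv.ext_of_unit`.
  obtain ⟨e', rfl, er, eu⟩ := hl.exists_adjEquiv (r := X.s2 b')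
    (unit := X.vcomp u₀ (X.inv _ (hb'.wl l hlb')) (by simp [tu₀, tb'])) hlb'
    (by rw [← t1_t2, tb', h₂]) (hu₀.vcomp (isIso2_inv _) _) (by simp [su₀]) (by simp)
  refine ⟨e', rfl, AdjEquiv.ext_of_unit he (by simp [er, ← sb]) ?_⟩
  have hi : Y.IsIso2 (P.f2 (X.wl e'.l b' hlb')) := P.isIso2 (hb'.wl _ hlb')
  refine hi.cancel_right (by simp [eu]) (by simp [e.t_unit, he, ← sb]) ?_
  simp only [TwoFunctor.mapAdjEquiv_unit]
  rw [← P.map_vcomp _ _ (by simp [eu])]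
  have : P.f2 (X.wl e'.l b' hlb') =
      Y.vcomp (Y.inv e.unit e.unit_iso) (P.f2 u₀) (by simp [e.s_unit, su₀, hs]) := by
    rw [← eb]
    simp [wl, he]
  simp only [this, vcomp_inv_assoc, eu]
  simp [tb']

end TwoCat

/-! ### Biequivalences of 2-categories -/

namespace TwoFunctor

variable {X Y : TwoCat.{u}}

/-- A 2-functor which is bijective on the 2-cells between two given 1-cells. -/
structure IsLocallyFullyFaithful (P : TwoFunctor X Y) : Prop where
  faithful : ∀ {a b : X.C2}, X.s2 a = X.s2 b → X.t2 a = X.t2 b → P.f2 a = P.f2 b → a = b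
  full : ∀ {f g : X.C1} {c : Y.C2}, X.s1 f = X.s1 g → X.t1 f = X.t1 g → Y.s2 c = P.f1 f →
    Y.t2 c = P.f1 g → ∃ a, X.s2 a = f ∧ X.t2 a = g ∧ P.f2 a = c

/-- A 2-functor which is an equivalence on hom-categories. -/
structure IsLocalEquivalence (P : TwoFunctor X Y) : Prop extends P.IsLocallyFullyFaithful where
  exists_iso1 : ∀ (x y : X.C0) (k : Y.C1), Y.s1 k = P.f0 x → Y.t1 k = P.f0 y →
    ∃ f, X.s1 f = x ∧ X.t1 f = y ∧ Y.Iso1 (P.f1 f) k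

/-- A biequivalence of 2-categories. -/
structure IsBiequivalence (P : TwoFunctor X Y) : Prop extends P.IsLocalEquivalence where
  exists_equivalent : ∀ y : Y.C0, ∃ x, Y.Equivalent (P.f0 x) y

namespace IsLocallyFullyFaithful

variable {P : TwoFunctor X Y} (hP : P.IsLocallyFullyFaithful)

include hP

theorem isIso2 {a : X.C2} (ha : Y.IsIso2 (P.f2 a)) : X.IsIso2 a := by
  obtain ⟨b, sb, tb, e⟩ := hP.full (f := X.t2 a) (g := X.s2 a) (c := Y.inv _ ha) (by simp)
    (by simp) (by simp) (by simp)
  refine ⟨b, sb.symm, tb, ?_, ?_⟩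
  · apply hP.faithful <;> simp [tb, e]
  · apply hP.faithful <;> simp [sb, e]

theorem iso1 {f g : X.C1} (hs : X.s1 f = X.s1 g) (ht : X.t1 f = X.t1 g)
    (h : Y.Iso1 (P.f1 f) (P.f1 g)) : X.Iso1 f g := by
  obtain ⟨c, hc, sc, tc⟩ := h
  obtain ⟨a, sa, ta, rfl⟩ := hP.full hs ht sc tc
  exact ⟨a, hP.isIso2 hc, sa, ta⟩

end IsLocallyFullyFaithful

/-- An inverse of `P.f1 f` lifts up to isomorphism, and the isomorphisms exhibiting it as an inverse
are reflected by `P`. -/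
theorem IsLocalEquivalence.isEquivalence {P : TwoFunctor X Y} (hP : P.IsLocalEquivalence)
    {f : X.C1} (hf : Y.IsEquivalence (P.f1 f)) : X.IsEquivalence f := by
  obtain ⟨k, h, h', a, b⟩ := TwoCat.isEquivalence_iff.1 hf
  obtain ⟨g, hg, hg', c⟩ := hP.exists_iso1 (X.t1 f) (X.s1 f) k (by simp [← h]) (by simp [h'])
  refine TwoCat.isEquivalence_iff.2 ⟨g, hg.symm, hg', hP.iso1 (by simp) (by simp [hg']) ?_,
    hP.iso1 (by simp) (by simp [hg]) ?_⟩
  · simp only [map_id1, map_comp1]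
    rw [P.s1_f1] at a
    exact a.trans (c.symm.comp_left _ _ _)
  · simp only [map_id1, map_comp1]
    rw [← h, P.t1_f1] at b
    rw [hg]
    exact (c.comp_right _ _ _).trans b

theorem isLocallyFullyFaithful_of_comp {P : TwoFunctor X Y} {Q : TwoFunctor Y X}
    (h : (P.comp Q).IsLocallyFullyFaithful) (h' : (Q.comp P).IsLocallyFullyFaithful) :
    P.IsLocallyFullyFaithful where
  faithful hs ht e := h.faithful hs ht (congrArg Q.f2 e)
  full {f g c} hs ht sc tc := by
    obtain ⟨a, sa, ta, e⟩ := h.full (c := Q.f2 c) hs ht (by simp [sc]) (by simp [tc])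
    exact ⟨a, sa, ta, h'.faithful (by simp [sa, sc]) (by simp [ta, tc]) (congrArg P.f2 e)⟩

/-- A case of two-out-of-six. Local full faithfulness is shown first, for `P` and by symmetry for
`Q`; an isomorphism found after applying `Q` can then be reflected. -/
theorem isBiequivalence_of_comp {P : TwoFunctor X Y} {Q : TwoFunctor Y X}
    (h : (P.comp Q).IsBiequivalence) (h' : (Q.comp P).IsBiequivalence) : P.IsBiequivalence where
  toIsLocallyFullyFaithful :=
    isLocallyFullyFaithful_of_comp h.toIsLocallyFullyFaithful h'.toIsLocallyFullyFaithful
  exists_iso1 x y k hk hk' := by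
    obtain ⟨f, hf, hf', e⟩ := h.exists_iso1 x y (Q.f1 k) (by simp [hk]) (by simp [hk'])
    exact ⟨f, hf, hf', (isLocallyFullyFaithful_of_comp h'.toIsLocallyFullyFaithful
      h.toIsLocallyFullyFaithful).iso1 (by simp [hf, hk]) (by simp [hf', hk']) e⟩
  exists_equivalent y := by
    obtain ⟨x, hx⟩ := h'.exists_equivalent y
    exact ⟨Q.f0 x, hx⟩

end TwoFunctor

/-! ### Biequivalences in a Gray-category -/

namespace GrayCat

variable (A : GrayCat.{u}) {X Y Z W : A.Obj}

theorem pre_one (X Y : A.Obj) : A.pre (Z := Y) (A.one X) = TwoFunctor.id _ := A.snd_one X Y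

theorem post_one (X Y : A.Obj) : A.post (X := X) (A.one Y) = TwoFunctor.id _ := A.fst_one X Y

theorem pre_comp_pre (f : (A.Hom X Y).C0) (g : (A.Hom Y Z).C0) :
    (A.pre (Z := W) g).comp (A.pre f) = A.pre (A.cmp f g) := A.snd_snd f g

theorem post_comp_post (f : (A.Hom X Y).C0) (g : (A.Hom Y Z).C0) :
    (A.post (X := W) f).comp (A.post g) = A.post (A.cmp f g) := by
  rw [← A.post_f0]
  exact A.fst_fst f g

/-- A 1-cell of a Gray-category which has an inverse up to equivalence. -/
def IsBiequiv (f : (A.Hom X Y).C0) : Prop :=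
  ∃ g : (A.Hom Y X).C0, (A.Hom X X).Equivalent (A.one X) (A.cmp f g) ∧
    (A.Hom Y Y).Equivalent (A.cmp g f) (A.one Y)

section whisker

variable {A}

open TwoCat

theorem s2_inter (α : (A.Hom X Y).C1) (β : (A.Hom Y Z).C1) : (A.Hom X Z).s2 (A.inter α β) =
    (A.Hom X Z).comp1 ((A.post ((A.Hom Y Z).s1 β)).f1 α) ((A.pre ((A.Hom X Y).t1 α)).f1 β)
      (by simp [post_f0]) :=
  (A.comp X Y Z).s2_inter α β

theorem t2_inter (α : (A.Hom X Y).C1) (β : (A.Hom Y Z).C1) : (A.Hom X Z).t2 (A.inter α β) =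
    (A.Hom X Z).comp1 ((A.pre ((A.Hom X Y).s1 α)).f1 β) ((A.post ((A.Hom Y Z).t1 β)).f1 α)
      (by simp [post_f0]) :=
  (A.comp X Y Z).t2_inter α β

theorem inter_iso (α : (A.Hom X Y).C1) (β : (A.Hom Y Z).C1) :
    (A.Hom X Z).IsIso2 (A.inter α β) :=
  (A.comp X Y Z).inter_iso α β

/-- The interchange is natural in the second variable. -/
theorem inter_natural_right (α : (A.Hom X Y).C1) (q : (A.Hom Y Z).C2) {f f' : (A.Hom X Y).C0}
    {g g' : (A.Hom Y Z).C0} {β β' : (A.Hom Y Z).C1} (hf : (A.Hom X Y).s1 α = f)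
    (hf' : (A.Hom X Y).t1 α = f') (hg : (A.Hom Y Z).s1 β = g) (hg' : (A.Hom Y Z).t1 β = g')
    (hq : (A.Hom Y Z).s2 q = β) (hq' : (A.Hom Y Z).t2 q = β') (h₁ h₂ h₃ h₄) :
    (A.Hom X Z).vcomp ((A.Hom X Z).wl ((A.post g).f1 α) ((A.pre f').f2 q) h₁)
        (A.inter α β') h₂ =
      (A.Hom X Z).vcomp (A.inter α β)
        ((A.Hom X Z).wr ((A.pre f).f2 q) ((A.post g').f1 α) h₃) h₄ := by
  subst hf hf' hq hq' hg hg'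
  exact (A.comp X Y Z).snd_inter α q _ _ _ _

/-- The interchange is natural in the first variable. -/
theorem inter_natural_left (p : (A.Hom X Y).C2) (β : (A.Hom Y Z).C1) {f f' : (A.Hom X Y).C0}
    {g g' : (A.Hom Y Z).C0} {α α' : (A.Hom X Y).C1} (hf : (A.Hom X Y).s1 α = f)
    (hf' : (A.Hom X Y).t1 α = f') (hg : (A.Hom Y Z).s1 β = g) (hg' : (A.Hom Y Z).t1 β = g')
    (hp : (A.Hom X Y).s2 p = α) (hp' : (A.Hom X Y).t2 p = α') (h₁ h₂ h₃ h₄) :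
    (A.Hom X Z).vcomp ((A.Hom X Z).wr ((A.post g).f2 p) ((A.pre f').f1 β) h₁)
        (A.inter α' β) h₂ =
      (A.Hom X Z).vcomp (A.inter α β)
        ((A.Hom X Z).wl ((A.pre f).f1 β) ((A.post g').f2 p) h₃) h₄ := by
  subst hf hf' hp hp' hg hg'
  exact (A.comp X Y Z).fst_inter p β _ _ _ _

/-- The equivalence `α : 1 → h` gives equivalences `gα : g → gh`, and the cells `β_α` make them
pseudonatural in `g`. A 2-functor pseudonaturally equivalent to the identity is a biequivalence. -/
theorem pre_isBiequivalence {h : (A.Hom X X).C0} (hh : (A.Hom X X).Equivalent (A.one X) h) :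
    (A.pre (Z := Z) h).IsBiequivalence := by
  obtain ⟨α, hα, sα, tα⟩ := hh
  have hp (g : (A.Hom X Z).C0) : (A.Hom X Z).IsEquivalence ((A.post g).f1 α) :=
    (A.post g).isEquivalence hα
  have id0 (b) : (A.pre (Z := Z) (A.one X)).f0 b = b := by rw [pre_one]; rfl
  have id1 (b) : (A.pre (Z := Z) (A.one X)).f1 b = b := by rw [pre_one]; rfl
  have id2 (b) : (A.pre (Z := Z) (A.one X)).f2 b = b := by rw [pre_one]; rfl
  have sp (g : (A.Hom X Z).C0) : (A.Hom X Z).s1 ((A.post g).f1 α) = g := by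
    simp [sα, post_f0, id0]
  have tp (g : (A.Hom X Z).C0) : (A.Hom X Z).t1 ((A.post g).f1 α) = (A.pre h).f0 g := by
    simp [tα, post_f0]
  have si (β : (A.Hom X Z).C1) : (A.Hom X Z).s2 (A.inter α β) =
      (A.Hom X Z).comp1 ((A.post ((A.Hom X Z).s1 β)).f1 α) ((A.pre h).f1 β) (by simp [tp]) := by
    simp only [s2_inter, tα]
  have ti (β : (A.Hom X Z).C1) : (A.Hom X Z).t2 (A.inter α β) =
      (A.Hom X Z).comp1 β ((A.post ((A.Hom X Z).t1 β)).f1 α) (by simp [sp]) := by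
    simp only [t2_inter, sα, id1]
  have nat (q : (A.Hom X Z).C2) {g g' : (A.Hom X Z).C0} {β β' : (A.Hom X Z).C1}
      (hg : (A.Hom X Z).s1 β = g) (hg' : (A.Hom X Z).t1 β = g') (hq : (A.Hom X Z).s2 q = β)
      (hq' : (A.Hom X Z).t2 q = β') (h₁ h₂ h₃ h₄) :
      (A.Hom X Z).vcomp ((A.Hom X Z).wl ((A.post g).f1 α) ((A.pre h).f2 q) h₁)
        (A.inter α β') h₂ =
      (A.Hom X Z).vcomp (A.inter α β) ((A.Hom X Z).wr q ((A.post g').f1 α) h₃) h₄ := by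
    have := inter_natural_right α q sα tα hg hg' hq hq' h₁ h₂ (by simpa [id2] using h₃)
      (by simpa [id2] using h₄)
    simpa only [id2] using this
  have full : ∀ {β β' : (A.Hom X Z).C1} {c : (A.Hom X Z).C2},
      (A.Hom X Z).s1 β = (A.Hom X Z).s1 β' → (A.Hom X Z).t1 β = (A.Hom X Z).t1 β' →
      (A.Hom X Z).s2 c = (A.pre h).f1 β → (A.Hom X Z).t2 c = (A.pre h).f1 β' →
      ∃ a, (A.Hom X Z).s2 a = β ∧ (A.Hom X Z).t2 a = β' ∧ (A.pre h).f2 a = c := by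
    intro β β' c hs ht sc tc
    have h₁ : (A.Hom X Z).t1 ((A.post ((A.Hom X Z).s1 β)).f1 α) =
        (A.Hom X Z).s1 ((A.Hom X Z).s2 c) := by simp [tp, sc]
    have h₂ : (A.Hom X Z).t2 ((A.Hom X Z).wl _ c h₁) = (A.Hom X Z).s2 (A.inter α β') := by
      simp only [t2_wl, tc, si, hs]
    -- Naturality of the interchange prescribes the whiskering of `a` by `α`: it must be the
    -- conjugate of the whiskering of `c`. Since whiskering by an equivalence is full, such an `a`
    -- exists.
    obtain ⟨a, sa, ta, ha⟩ := (hp ((A.Hom X Z).t1 β)).exists_wr_eq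
      (c := (A.Hom X Z).vcomp ((A.Hom X Z).inv _ (inter_iso α β))
        ((A.Hom X Z).vcomp ((A.Hom X Z).wl _ c h₁) (A.inter α β') h₂)
        (by simp [si, sc])) (f := β) (g := β') (sp _).symm (by rw [sp, ht])
        (by simp [ti]) (by simp [ti, ht])
    refine ⟨a, sa, ta, (hp ((A.Hom X Z).s1 β)).wl_cancel (by simp [tp, sa]) h₁ (by simp [sa, sc])
      (by simp [ta, tc]) ?_⟩
    have n := nat a rfl rfl sa ta (by simp [tp, sa]) (by simp [si, ta, hs]) (by simp [sa, sp])
      (by simp [sa, ti])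
    simp only [ha, vcomp_inv_assoc] at n
    exact (inter_iso α β').cancel_right _ _ n
  have faithful : ∀ {a b : (A.Hom X Z).C2}, (A.Hom X Z).s2 a = (A.Hom X Z).s2 b →
      (A.Hom X Z).t2 a = (A.Hom X Z).t2 b → (A.pre h).f2 a = (A.pre h).f2 b → a = b := by
    intro a b hs ht e
    have n₁ := nat a rfl rfl rfl rfl (by simp [tp]) (by simp [si]) (by simp [sp]) (by simp [ti])
    have n₂ := nat b rfl rfl hs.symm ht.symm (by simp [hs, tp]) (by simp [si, hs, ht])
      (by simp [sp, hs]) (by simp [ti, hs])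
    simp only [e] at n₁
    exact (hp _).wr_cancel _ _ hs ht
      ((inter_iso α _).cancel_left _ _ (n₁.symm.trans n₂))
  refine ⟨⟨⟨faithful, full⟩, fun g g' k sk tk => ?_⟩, fun g => ⟨g, ?_⟩⟩
  · obtain ⟨β, hβ, e⟩ := (hp g').exists_comp1_iso'
      ((A.Hom X Z).comp1 ((A.post g).f1 α) k (by rw [sk, tp])) (by simp [tk, tp])
    have sβ : (A.Hom X Z).s1 β = g := by
      simpa [sp] using e.s1_eq
    rw [sp] at hβ
    refine ⟨β, sβ, hβ, ?_⟩
    refine (hp g).iso1_of_comp_left (by simp [tp, sβ]) (by rw [sk, tp]) (Iso1.trans ?_ e)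
    refine ⟨A.inter α β, inter_iso _ _, ?_, ?_⟩
    · simp only [si, sβ]
    · simp only [ti, hβ]
  · exact equivalent_equivalence.symm ⟨_, hp g, sp g, tp g⟩

/-- As in `pre_isBiequivalence`, but `α` is now the second argument of the interchange, so the
naturality constraints point in the opposite direction. -/
theorem post_isBiequivalence {h : (A.Hom X X).C0} (hh : (A.Hom X X).Equivalent (A.one X) h) :
    (A.post (X := Z) h).IsBiequivalence := by
  obtain ⟨α, hα, sα, tα⟩ := hh
  have hp (g : (A.Hom Z X).C0) : (A.Hom Z X).IsEquivalence ((A.pre g).f1 α) :=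
    (A.pre g).isEquivalence hα
  have id0 (b) : (A.post (X := Z) (A.one X)).f0 b = b := by rw [post_one]; rfl
  have id1 (b) : (A.post (X := Z) (A.one X)).f1 b = b := by rw [post_one]; rfl
  have id2 (b) : (A.post (X := Z) (A.one X)).f2 b = b := by rw [post_one]; rfl
  have sp (g : (A.Hom Z X).C0) : (A.Hom Z X).s1 ((A.pre g).f1 α) = g := by
    simp [sα, ← post_f0, id0]
  have tp (g : (A.Hom Z X).C0) : (A.Hom Z X).t1 ((A.pre g).f1 α) = (A.post h).f0 g := by
    simp [tα, post_f0]
  have si (β : (A.Hom Z X).C1) : (A.Hom Z X).s2 (A.inter β α) =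
      (A.Hom Z X).comp1 β ((A.pre ((A.Hom Z X).t1 β)).f1 α) (by simp [sp]) := by
    simp only [s2_inter, sα, id1]
  have ti (β : (A.Hom Z X).C1) : (A.Hom Z X).t2 (A.inter β α) =
      (A.Hom Z X).comp1 ((A.pre ((A.Hom Z X).s1 β)).f1 α) ((A.post h).f1 β) (by simp [tp]) := by
    simp only [t2_inter, tα]
  have nat (q : (A.Hom Z X).C2) {g g' : (A.Hom Z X).C0} {β β' : (A.Hom Z X).C1}
      (hg : (A.Hom Z X).s1 β = g) (hg' : (A.Hom Z X).t1 β = g') (hq : (A.Hom Z X).s2 q = β)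
      (hq' : (A.Hom Z X).t2 q = β') (h₁ h₂ h₃ h₄) :
      (A.Hom Z X).vcomp ((A.Hom Z X).wr q ((A.pre g').f1 α) h₁) (A.inter β' α) h₂ =
      (A.Hom Z X).vcomp (A.inter β α)
        ((A.Hom Z X).wl ((A.pre g).f1 α) ((A.post h).f2 q) h₃) h₄ := by
    have := inter_natural_left q α hg hg' sα tα hq hq' (by simpa [id2] using h₁)
      (by simpa [id2] using h₂) h₃ h₄
    simpa only [id2] using this
  have full : ∀ {β β' : (A.Hom Z X).C1} {c : (A.Hom Z X).C2},
      (A.Hom Z X).s1 β = (A.Hom Z X).s1 β' → (A.Hom Z X).t1 β = (A.Hom Z X).t1 β' →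
      (A.Hom Z X).s2 c = (A.post h).f1 β → (A.Hom Z X).t2 c = (A.post h).f1 β' →
      ∃ a, (A.Hom Z X).s2 a = β ∧ (A.Hom Z X).t2 a = β' ∧ (A.post h).f2 a = c := by
    intro β β' c hs ht sc tc
    have h₁ : (A.Hom Z X).t1 ((A.pre ((A.Hom Z X).s1 β)).f1 α) =
        (A.Hom Z X).s1 ((A.Hom Z X).s2 c) := by simp [tp, sc]
    have h₂ : (A.Hom Z X).t2 (A.inter β α) = (A.Hom Z X).s2 ((A.Hom Z X).wl _ c h₁) := by
      simp only [s2_wl, sc, ti]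
    obtain ⟨a, sa, ta, ha⟩ := (hp ((A.Hom Z X).t1 β)).exists_wr_eq
      (c := (A.Hom Z X).vcomp (A.inter β α) ((A.Hom Z X).vcomp ((A.Hom Z X).wl _ c h₁)
        ((A.Hom Z X).inv _ (inter_iso β' α)) (by simp [ti, tc, hs])) (by simp [h₂]))
        (f := β) (g := β') (sp _).symm (by rw [sp, ht])
        (by simp [si]) (by simp [si, ht])
    refine ⟨a, sa, ta, (hp ((A.Hom Z X).s1 β)).wl_cancel (by simp [tp, sa]) h₁ (by simp [sa, sc])
      (by simp [ta, tc]) ?_⟩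
    have n := nat a rfl rfl sa ta (by simp [sp, sa]) (by simp [si, ta, ht]) (by simp [sa, tp])
      (by simp [sa, ti])
    simp only [ha, vcomp_vcomp, inv_vcomp] at n
    have n' := (inter_iso β α).cancel_left _ _ n
    rw [← n', (A.Hom Z X).vcomp_id2]
  have faithful : ∀ {a b : (A.Hom Z X).C2}, (A.Hom Z X).s2 a = (A.Hom Z X).s2 b →
      (A.Hom Z X).t2 a = (A.Hom Z X).t2 b → (A.post h).f2 a = (A.post h).f2 b → a = b := by
    intro a b hs ht e
    have n₁ := nat a rfl rfl rfl rfl (by simp [sp]) (by simp [si]) (by simp [tp]) (by simp [ti])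
    have n₂ := nat b rfl rfl hs.symm ht.symm (by simp [hs, sp]) (by simp [si, hs, ht])
      (by simp [tp, hs]) (by simp [ti, hs])
    simp only [e] at n₁
    exact (hp _).wr_cancel _ _ hs ht
      ((inter_iso _ α).cancel_right _ _ (n₁.trans n₂.symm))
  refine ⟨⟨⟨faithful, full⟩, fun g g' k sk tk => ?_⟩, fun g => ⟨g, ?_⟩⟩
  · obtain ⟨β, hβ, e⟩ := (hp g').exists_comp1_iso'
      ((A.Hom Z X).comp1 ((A.pre g).f1 α) k (by rw [sk, tp])) (by simp [tk, tp])
    have sβ : (A.Hom Z X).s1 β = g := by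
      simpa [sp] using e.s1_eq
    rw [sp] at hβ
    refine ⟨β, sβ, hβ, ?_⟩
    refine (hp g).iso1_of_comp_left (by simp [tp, sβ]) (by rw [sk, tp]) (Iso1.trans ?_ e)
    refine Iso1.symm ⟨A.inter β α, inter_iso _ _, ?_, ?_⟩
    · simp only [si, hβ]
    · simp only [ti, sβ]
  · exact equivalent_equivalence.symm ⟨_, hp g, sp g, tp g⟩

/-- With an inverse `g`, the two composites of `A.pre f` and `A.pre g` are whiskerings by `gf` and
`fg`, both equivalent to identities. -/
theorem IsBiequiv.pre {f : (A.Hom X Y).C0} (hf : A.IsBiequiv f) :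
    (A.pre (Z := Z) f).IsBiequivalence := by
  obtain ⟨g, h, h'⟩ := hf
  refine TwoFunctor.isBiequivalence_of_comp (Q := A.pre g) ?_ ?_
  · rw [pre_comp_pre]
    exact pre_isBiequivalence (equivalent_equivalence.symm h')
  · rw [pre_comp_pre]
    exact pre_isBiequivalence h

theorem IsBiequiv.post {f : (A.Hom X Y).C0} (hf : A.IsBiequiv f) :
    (A.post (X := Z) f).IsBiequivalence := by
  obtain ⟨g, h, h'⟩ := hf
  refine TwoFunctor.isBiequivalence_of_comp (Q := A.post g) ?_ ?_
  · rw [post_comp_post]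
    exact post_isBiequivalence h
  · rw [post_comp_post]
    exact post_isBiequivalence (equivalent_equivalence.symm h')

end whisker

end GrayCat

/-! ### The pasting identity relating the two tetrahedron equations. -/

namespace TwoCat

variable {X : TwoCat.{u}}

theorem vcomp_congr {a a' b b' : X.C2} (ha : a = a') (hb : b = b') (h : X.t2 a = X.s2 b) :
    X.vcomp a b h = X.vcomp a' b' (by rw [← ha, ← hb, h]) := by
  subst ha hb
  rfl

theorem vcomp_assoc_congr {a a' b b' c : X.C2} {h : X.t2 a = X.s2 b} {h' : X.t2 a' = X.s2 b'}
    (e : X.vcomp a b h = X.vcomp a' b' h') (h₁ h₂ h₃ h₄) :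
    X.vcomp a (X.vcomp b c h₁) h₂ = X.vcomp a' (X.vcomp b' c h₃) h₄ := by
  rw [← X.vcomp_assoc a b c h (by simpa using h₁), ← X.vcomp_assoc a' b' c h' (by simpa using h₃)]
  exact vcomp_congr e rfl _

theorem wl_congr {f f' : X.C1} {a a' : X.C2} (hf : f = f') (ha : a = a') (h) :
    X.wl f a h = X.wl f' a' (by rw [← hf, ← ha, h]) := by
  subst hf ha
  rfl

theorem wr_congr {f f' : X.C1} {a a' : X.C2} (ha : a = a') (hf : f = f') (h) :
    X.wr a f h = X.wr a' f' (by rw [← hf, ← ha, h]) := by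
  subst hf ha
  rfl

/-- Interchanging `a` with itself makes the two whiskerings agree after composing with `a`, which is
invertible. -/
theorem wl_wr_comm {f : X.C1} {a : X.C2} (ha : X.IsIso2 a) (sa : X.s2 a = f) {x : X.C0}
    (ta : X.t2 a = X.id1 x) (h h') : X.wl f a h = X.wr a f h' := by
  have h₁ : X.t1 f = x := by rw [← sa, ← t1_t2, ta, t1_id1]
  have h₂ : X.s1 f = x := by rw [← sa, ← s1_t2, ta, s1_id1]
  have := exchange a a sa ta sa ta h' (by simp [sa, h₂]) (by simp [sa, ta]) h (by simp [sa, h₁])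
    (by simp [sa, ta])
  simp only [wl_id1, wr_id1] at this
  exact (ha.cancel_right _ _ this).symm

local notation:65 a:66 " ⊚ " b:65 => TwoCat.vcomp _ a b (by simp [*])
local notation:70 f:71 " ◁ " a:70 => TwoCat.wl f a (by simp [*])
local notation:70 a:71 " ▷ " f:70 => TwoCat.wr a f (by simp [*])

/-- The calculation behind `tetrahedronEps_of_eta`, stripped of its Gray-category. There `p` is
`fη`, `q` is `εf`, the cells `H`, `E` and `K` are interchanges of `η` with itself, of `ε` with
itself and of `η` with `ε`, and `S₁`, `S₂` are whiskerings of `S`. Expanding `S₁` and `S₂` by the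
two naturality hypotheses turns the conclusion into the `q`-whiskering of the third hypothesis, once
`H` is interchanged with `E` and the two whiskerings of `S` by its own source are identified. -/
theorem swallowtail {x y z : X.C0} {p q a b c d : X.C1} {S H E K S₁ S₂ T : X.C2}
    (sp : X.s1 p = x) (tp : X.t1 p = y) (sq : X.s1 q = y) (tq : X.t1 q = x)
    (sa : X.s1 a = y) (ta : X.t1 a = z) (sb : X.s1 b = z) (tb : X.t1 b = y)
    (sc : X.s1 c = y) (tc : X.t1 c = z) (sd : X.s1 d = z) (td : X.t1 d = y)
    (sS : X.s2 S = X.comp1 p q (by simp [*])) (tS : X.t2 S = X.id1 x)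
    (sH : X.s2 H = X.comp1 p a (by simp [*])) (tH : X.t2 H = X.comp1 p c (by simp [*]))
    (sE : X.s2 E = X.comp1 b q (by simp [*])) (tE : X.t2 E = X.comp1 d q (by simp [*]))
    (sK : X.s2 K = X.comp1 c d (by simp [*])) (tK : X.t2 K = X.comp1 q p (by simp [*]))
    (sS₁ : X.s2 S₁ = X.comp1 a d (by simp [*])) (_ : X.t2 S₁ = X.id1 y)
    (sS₂ : X.s2 S₂ = X.comp1 c b (by simp [*])) (_ : X.t2 S₂ = X.id1 y)
    (sT : X.s2 T = X.id1 y) (tT : X.t2 T = X.comp1 a b (by simp [*])) (hS : X.IsIso2 S) :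
    S₂ ▷ q = (c ◁ E) ⊚ (K ▷ q) ⊚ (q ◁ S) →
    p ◁ S₁ = (H ▷ d) ⊚ (p ◁ K) ⊚ (S ▷ p) →
    (p ◁ T) ⊚ (H ▷ b) ⊚ (p ◁ S₂) = X.id2 p →
    p ◁ ((T ▷ q) ⊚ (a ◁ E) ⊚ (S₁ ▷ q)) = X.id2 (X.comp1 p q (by simp [*])) := by
  have e₁ : p ◁ S₁ ▷ q = (p ◁ S₁) ▷ q := (wr_wl _ _ _ _ _).symm
  have e₂ : ((H ▷ d) ⊚ (p ◁ K) ⊚ (S ▷ p)) ▷ q =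
      (H ▷ X.comp1 d q (by simp [*])) ⊚ (p ◁ K ▷ q) ⊚ (S ▷ X.comp1 p q (by simp [*])) := by
    rw [wr_vcomp _ _ _ _ (by simp [*])]
    refine vcomp_congr (wr_wr _ _ _ _ _) ?_ _
    rw [wr_vcomp _ _ _ _ (by simp [*])]
    exact vcomp_congr (wr_wl _ _ _ _ _) (wr_wr _ _ _ _ _) _
  have e₃ : p ◁ ((c ◁ E) ⊚ (K ▷ q) ⊚ (q ◁ S)) =
      (X.comp1 p c (by simp [*]) ◁ E) ⊚ (p ◁ K ▷ q) ⊚ (X.comp1 p q (by simp [*]) ◁ S) := by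
    rw [wl_vcomp _ _ _ _ (by simp [*])]
    refine vcomp_congr (wl_wl _ _ _ _ _) ?_ _
    rw [wl_vcomp _ _ _ _ (by simp [*])]
    exact vcomp_congr rfl (wl_wl _ _ _ _ _) _
  have e₄ : (X.comp1 p q (by simp [*]) ◁ S) = (S ▷ X.comp1 p q (by simp [*])) :=
    wl_wr_comm hS sS tS _ _
  have e₅ : (H ▷ X.comp1 b q (by simp [*])) ⊚ (X.comp1 p c (by simp [*]) ◁ E) =
      (X.comp1 p a (by simp [*]) ◁ E) ⊚ (H ▷ X.comp1 d q (by simp [*])) :=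
    exchange H E sH tH sE tE _ _ _ _ _ _
  have e₆ : ((p ◁ T) ⊚ (H ▷ b) ⊚ (p ◁ S₂)) ▷ q =
      (p ◁ T ▷ q) ⊚ (H ▷ X.comp1 b q (by simp [*])) ⊚ (p ◁ S₂ ▷ q) := by
    rw [wr_vcomp _ _ _ _ (by simp [*])]
    refine vcomp_congr (wr_wl _ _ _ _ _) ?_ _
    rw [wr_vcomp _ _ _ _ (by simp [*])]
    exact vcomp_congr (wr_wr _ _ _ _ _) (wr_wl _ _ _ _ _) _
  have e₇ : p ◁ ((T ▷ q) ⊚ (a ◁ E) ⊚ (S₁ ▷ q)) =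
      (p ◁ T ▷ q) ⊚ (X.comp1 p a (by simp [*]) ◁ E) ⊚ (p ◁ S₁ ▷ q) := by
    rw [wl_vcomp _ _ _ _ (by simp [*])]
    refine vcomp_congr rfl ?_ _
    rw [wl_vcomp _ _ _ _ (by simp [*])]
    exact vcomp_congr (wl_wl _ _ _ _ _) rfl _
  intro N₁ N₂ tet
  refine e₇.trans (Eq.trans ?_ (e₆.symm.trans ?_))
  swap
  · exact (wr_congr tet rfl _).trans (wr_id2 _ _ _)
  refine vcomp_congr rfl ?_ _
  simp only [N₁, e₃, e₄, e₁, N₂, e₂]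
  exact vcomp_assoc_congr e₅.symm _ _ _ _

end TwoCat

/-! ### The tetrahedron equation for `η` implies the one for `ε`. -/

namespace GrayCat

open TwoCat

section

variable (A : GrayCat.{u}) {X Y Z W : A.Obj}

theorem pre_one_f2 (x : (A.Hom X Y).C2) : (A.pre (A.one X)).f2 x = x :=
  congrArg (fun P => P.f2 x) (A.snd_one X Y)

theorem post_one_f2 (x : (A.Hom X Y).C2) : (A.post (A.one Y)).f2 x = x :=
  congrArg (fun P => P.f2 x) (A.fst_one X Y)

theorem post_post_f2 (g : (A.Hom Y Z).C0) (h : (A.Hom Z W).C0) (x : (A.Hom X Y).C2) :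
    (A.post h).f2 ((A.post g).f2 x) = (A.post (A.cmp g h)).f2 x := by
  rw [← A.post_f0]
  exact congrArg (fun P => P.f2 x) (A.fst_fst g h)

theorem post_pre_f2 (f : (A.Hom X Y).C0) (h : (A.Hom Z W).C0) (x : (A.Hom Y Z).C2) :
    (A.post h).f2 ((A.pre f).f2 x) = (A.pre f).f2 ((A.post h).f2 x) :=
  congrArg (fun P => P.f2 x) (A.snd_fst f h)

theorem pre_pre_f2 (f : (A.Hom X Y).C0) (g : (A.Hom Y Z).C0) (x : (A.Hom Z W).C2) :
    (A.pre f).f2 ((A.pre g).f2 x) = (A.pre (A.cmp f g)).f2 x :=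
  congrArg (fun P => P.f2 x) (A.snd_snd f g)

theorem post_inter (α : (A.Hom X Y).C1) (β : (A.Hom Y Z).C1) (h : (A.Hom Z W).C0) :
    (A.post h).f2 (A.inter α β) = A.inter α ((A.post h).f1 β) :=
  A.fst_inter α β h

theorem inter_post_left (α : (A.Hom X Y).C1) (g : (A.Hom Y Z).C0) (γ : (A.Hom Z W).C1) :
    A.inter ((A.post g).f1 α) γ = A.inter α ((A.pre g).f1 γ) :=
  A.inter_assoc α g γ

theorem pre_inter (f : (A.Hom X Y).C0) (β : (A.Hom Y Z).C1) (γ : (A.Hom Z W).C1) :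
    (A.pre f).f2 (A.inter β γ) = A.inter ((A.pre f).f1 β) γ :=
  (A.snd_inter f β γ).symm

theorem id1_inter (x : (A.Hom X Y).C0) (β : (A.Hom Y Z).C1) :
    A.inter ((A.Hom X Y).id1 x) β = (A.Hom X Z).id2 ((A.pre x).f1 β) :=
  (A.comp X Y Z).id1_inter x β

theorem inter_id1 (α : (A.Hom X Y).C1) (y : (A.Hom Y Z).C0) :
    A.inter α ((A.Hom Y Z).id1 y) = (A.Hom X Z).id2 ((A.post y).f1 α) :=
  (A.comp X Y Z).inter_id1 α y

theorem comp1_inter (α α' : (A.Hom X Y).C1) (h) (β : (A.Hom Y Z).C1) :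
    A.inter ((A.Hom X Y).comp1 α α' h) β =
      (A.Hom X Z).vcomp
        ((A.Hom X Z).wl ((A.post ((A.Hom Y Z).s1 β)).f1 α) (A.inter α' β)
          (by simp [s1_inter, post_f0, h]))
        ((A.Hom X Z).wr (A.inter α β) ((A.post ((A.Hom Y Z).t1 β)).f1 α')
          (by simp [t1_inter, post_f0, h]))
        (by simp [s2_inter, t2_inter, h]) :=
  (A.comp X Y Z).comp1_inter α α' β h _ _ _

theorem inter_comp1 (α : (A.Hom X Y).C1) (β β' : (A.Hom Y Z).C1) (h) :
    A.inter α ((A.Hom Y Z).comp1 β β' h) =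
      (A.Hom X Z).vcomp
        ((A.Hom X Z).wr (A.inter α β) ((A.pre ((A.Hom X Y).t1 α)).f1 β')
          (by simp [t1_inter, h]))
        ((A.Hom X Z).wl ((A.pre ((A.Hom X Y).s1 α)).f1 β) (A.inter α β')
          (by simp [s1_inter, h]))
        (by simp [s2_inter, t2_inter, h]) :=
  (A.comp X Y Z).inter_comp1 α β β' h _ _ _

end

namespace AdjBiequivData

variable {B : GrayCat.{u}} (e : B.AdjBiequivData)

/-- The tetrahedron equation for `η`. -/
def TetrahedronEta : Prop :=
  (B.Hom e.src e.src).vcomp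
      ((B.Hom e.src e.src).vcomp e.Tfη e.gεfηη e.t2_Tfη)
      e.gSη (by rw [TwoCat.t2_vcomp, e.t2_gεfηη]) =
    (B.Hom e.src e.src).id2 e.η.l

/-- The tetrahedron equation for `ε`. -/
def TetrahedronEps : Prop :=
  (B.Hom e.tgt e.tgt).vcomp
      ((B.Hom e.tgt e.tgt).vcomp e.εfT e.εεfηg e.t2_εfT)
      e.εSg (by rw [TwoCat.t2_vcomp, e.t2_εεfηg]) =
    (B.Hom e.tgt e.tgt).id2 e.ε.l

theorem isBiequiv_f : B.IsBiequiv e.f :=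
  ⟨e.g, ⟨e.η.l, e.η.isEquivalence, e.s_η, e.t_η⟩, ⟨e.ε.l, e.ε.isEquivalence, e.s_ε, e.t_ε⟩⟩

/-- Precomposing with `f` is faithful since `f` is a biequivalence, and whiskering by `fη` is
faithful since it is an equivalence. After both, the claim is `swallowtail`, whose hypotheses are
naturality of the interchange at `S`, against `ε` and against `η`, and the image of the `η`-equation
under composition with `f`. -/
theorem tetrahedronEps_of_eta (h : e.TetrahedronEta) : e.TetrahedronEps := by
  have norm₁ := @post_post_f1.{u} B
  have norm₂ := @post_pre_f1.{u} B
  have norm₃ := @pre_pre_f1.{u} B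
  have norm₄ := @post_f0.{u} B
  have norm₅ := @cmp_assoc.{u} B
  have key := swallowtail (X := B.Hom e.src e.tgt) (x := e.f)
    (y := B.cmp e.f (B.cmp e.g e.f)) (z := B.cmp e.f (B.cmp e.g (B.cmp e.f (B.cmp e.g e.f))))
    (p := (B.post e.f).f1 e.η.l) (q := (B.pre e.f).f1 e.ε.l)
    (a := (B.pre (B.cmp e.f e.g)).f1 ((B.post e.f).f1 e.η.l))
    (b := (B.pre e.f).f1 ((B.post (B.cmp e.g e.f)).f1 e.ε.l))
    (c := (B.post (B.cmp e.f (B.cmp e.g e.f))).f1 e.η.l)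
    (d := (B.pre (B.cmp e.f (B.cmp e.g e.f))).f1 e.ε.l)
    (S := e.S) (H := (B.post e.f).f2 (B.inter e.η.l e.η.l))
    (E := (B.pre e.f).f2 (B.inter e.ε.l e.ε.l))
    (K := B.inter e.η.l ((B.pre e.f).f1 e.ε.l))
    (S₁ := (B.pre (B.cmp e.f e.g)).f2 e.S) (S₂ := (B.post (B.cmp e.g e.f)).f2 e.S)
    (T := (B.pre e.f).f2 ((B.post e.f).f2 e.T))
    (by simp [*, e.s_η, one_cmp])
    (by simp [*, e.t_η])
    (by simp [*, e.s_ε])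
    (by simp [*, e.t_ε, cmp_one])
    (by simp [*, e.s_η, one_cmp])
    (by simp [*, e.t_η])
    (by simp [*, e.s_ε])
    (by simp [*, e.t_ε, one_cmp])
    (by simp [*, e.s_η, one_cmp])
    (by simp [*, e.t_η])
    (by simp [*, e.s_ε])
    (by simp [*, e.t_ε, cmp_one])
    (by simp [*, e.s_S]) (by simp [*, e.t_S])
    (by simp [*, s2_inter, e.s_η, e.t_η, post_one_f1])
    (by simp [*, t2_inter, e.s_η, e.t_η, pre_one_f1])
    (by simp [*, s2_inter, e.s_ε, e.t_ε, pre_one_f1])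
    (by simp [*, t2_inter, e.s_ε, e.t_ε, post_one_f1])
    (by simp [*, s2_inter, e.s_ε, e.t_η])
    (by simp [*, t2_inter, e.s_η, e.t_ε, one_cmp, cmp_one])
    (by simp [*, e.s_S]) (by simp [*, e.t_S]) (by simp [*, e.s_S]) (by simp [*, e.t_S])
    (by simp [*, e.s_T]) (by simp [*, e.t_T]) e.S_iso ?N₁ ?N₂ ?tet
  · apply e.isBiequiv_f.pre.faithful
    · simp [εfT, e.s_T, post_f0]
    · simp [εSg, e.t_S]
    refine ((B.post e.f).isEquivalence e.η.isEquivalence).wl_cancel ?_ ?_ ?_ ?_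
      (Eq.trans (wl_congr rfl ?_ _) (key.trans ?_))
    rotate_left 4
    · simp only [εfT, εεfηg, εSg, TwoFunctor.map_vcomp, TwoFunctor.map_hcomp, TwoFunctor.map_id2,
        post_pre_f1, pre_pre_f1, pre_pre_f2, vcomp_vcomp]
      exact rfl
    · simp
    · simp [εfT, e.s_T, e.s_ε, e.t_η, norm₄, norm₅]
    · simp [e.s_ε, e.t_η, norm₄, norm₅]
    · simp [εfT, e.s_T, norm₄]
    · simp [εSg, e.t_S]
  · have n := inter_natural_left e.S e.ε.l (f := e.f) (f' := e.f) (g := B.cmp e.g e.f)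
      (g' := B.one e.tgt) (α' := (B.Hom e.src e.tgt).id1 e.f)
      (by simp [*, e.s_η, one_cmp]) (by simp [*, e.t_ε, cmp_one]) e.s_ε e.t_ε e.s_S e.t_S
      (by simp [*, e.s_S, one_cmp, e.s_ε, e.t_ε]) (by simp [*, e.t_S, s2_inter, e.s_ε])
      (by simp [*, e.s_S, e.s_η, one_cmp, e.t_ε, cmp_one])
      (by simp [*, e.s_S, t2_inter, e.s_η, e.t_ε, one_cmp, post_one_f1])
    -- The source of `S` is a composite, so its interchange with `ε` splits into the cells called
    -- `E` and `K` in `swallowtail`. The next case splits the interchange with `η` into `H` and `K`.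
    have c := comp1_inter B ((B.post e.f).f1 e.η.l) ((B.pre e.f).f1 e.ε.l)
      (by simp [*, e.t_η, e.s_ε]) e.ε.l
    simp only [id1_inter, post_one_f2, vcomp_id2] at n
    simp only [e.s_ε, e.t_ε, post_one_f1, inter_post_left, ← pre_inter, norm₁] at c
    refine n.trans ((vcomp_congr c rfl _).trans (vcomp_vcomp _ _ _ _ _))
  · have n := inter_natural_right e.η.l e.S (f := B.one e.src) (f' := B.cmp e.f e.g) (g := e.f)
      (g' := e.f) (β' := (B.Hom e.src e.tgt).id1 e.f) e.s_η e.t_η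
      (by simp [*, e.s_η, one_cmp]) (by simp [*, e.t_ε, cmp_one]) e.s_S e.t_S
      (by simp [*, e.s_S, e.s_η, one_cmp, e.t_η]) (by simp [*, e.t_S, s2_inter, e.t_η])
      (by simp [*, e.s_S, e.s_η, one_cmp, e.t_ε, cmp_one])
      (by simp [*, e.s_S, t2_inter, e.s_η, e.t_ε, pre_one_f1, cmp_one])
    have c := inter_comp1 B e.η.l ((B.post e.f).f1 e.η.l) ((B.pre e.f).f1 e.ε.l)
      (by simp [*, e.t_η, e.s_ε])
    simp only [inter_id1, pre_one_f2, vcomp_id2] at n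
    simp only [e.s_η, e.t_η, pre_one_f1, ← post_inter, norm₃, norm₅] at c
    refine n.trans ((vcomp_congr c rfl _).trans (vcomp_vcomp _ _ _ _ _))
  · have t := congrArg (B.post e.f).f2 h
    simp only [Tfη, gεfηη, gSη, TwoFunctor.map_vcomp, TwoFunctor.map_hcomp, TwoFunctor.map_id2,
      post_pre_f1, post_pre_f2, post_post_f1, post_post_f2, vcomp_vcomp] at t
    exact t

end AdjBiequivData

end GrayCat

/-! ### Each of the 3-cells `S` and `T` determines the other. -/

namespace GrayCat

open TwoCat

namespace AdjBiequivData

variable {B : GrayCat.{u}} (e : B.AdjBiequivData)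

theorem gεfηη_iso : (B.Hom e.src e.src).IsIso2 e.gεfηη :=
  (inter_iso e.η.l e.η.l).wr _ (by simp [t1_inter, e.t_η, e.s_ε, post_f0, cmp_assoc])

theorem gSη_iso : (B.Hom e.src e.src).IsIso2 e.gSη :=
  ((B.post e.g).isIso2 e.S_iso).wl _ (by simp [e.t_η, e.s_S, e.s_η, post_f0, one_cmp])

theorem Tfη_iso : (B.Hom e.src e.src).IsIso2 e.Tfη :=
  ((B.pre e.f).isIso2 e.T_iso).wl _ (by simp [e.t_η, e.s_T])

end AdjBiequivData

/-- The part of the data of an adjoint biequivalence consisting of its 1-cells and its 2-cells,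
without the 3-cells `S` and `T`. -/
@[ext]
structure BiequivCore (B : GrayCat.{u}) where
  src : B.Obj
  tgt : B.Obj
  f : (B.Hom src tgt).C0
  g : (B.Hom tgt src).C0
  η : (B.Hom src src).AdjEquiv
  ε : (B.Hom tgt tgt).AdjEquiv
  s_η : (B.Hom src src).s1 η.l = B.one src
  t_η : (B.Hom src src).t1 η.l = B.cmp f g
  s_ε : (B.Hom tgt tgt).s1 ε.l = B.cmp g f
  t_ε : (B.Hom tgt tgt).t1 ε.l = B.one tgt

namespace BiequivCore

variable {B : GrayCat.{u}} (c : B.BiequivCore)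

/-- The invertible 3-cells `εf.fη ≅ 1`. -/
@[ext]
structure SCell where
  cell : (B.Hom c.src c.tgt).C2
  s_cell : (B.Hom c.src c.tgt).s2 cell =
    (B.Hom c.src c.tgt).comp1 ((B.post c.f).f1 c.η.l) ((B.pre c.f).f1 c.ε.l)
      (by simp [c.t_η, c.s_ε, post_f0, cmp_assoc])
  t_cell : (B.Hom c.src c.tgt).t2 cell = (B.Hom c.src c.tgt).id1 c.f
  iso : (B.Hom c.src c.tgt).IsIso2 cell

/-- The invertible 3-cells `1 ≅ gε.ηg`. -/
@[ext]
structure TCell where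
  cell : (B.Hom c.tgt c.src).C2
  s_cell : (B.Hom c.tgt c.src).s2 cell = (B.Hom c.tgt c.src).id1 c.g
  t_cell : (B.Hom c.tgt c.src).t2 cell =
    (B.Hom c.tgt c.src).comp1 ((B.pre c.g).f1 c.η.l) ((B.post c.g).f1 c.ε.l)
      (by simp [c.t_η, c.s_ε, post_f0, cmp_assoc])
  iso : (B.Hom c.tgt c.src).IsIso2 cell

variable {c}

/-- The data of an adjoint biequivalence given by its parts. -/
@[simps]
def data (S : c.SCell) (T : c.TCell) : B.AdjBiequivData where
  src := c.src
  tgt := c.tgt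
  f := c.f
  g := c.g
  η := c.η
  ε := c.ε
  s_η := c.s_η
  t_η := c.t_η
  s_ε := c.s_ε
  t_ε := c.t_ε
  S := S.cell
  s_S := S.s_cell
  t_S := S.t_cell
  S_iso := S.iso
  T := T.cell
  s_T := T.s_cell
  t_T := T.t_cell
  T_iso := T.iso

variable (c)

theorem isBiequiv_f : B.IsBiequiv c.f :=
  ⟨c.g, ⟨c.η.l, c.η.isEquivalence, c.s_η, c.t_η⟩, ⟨c.ε.l, c.ε.isEquivalence, c.s_ε, c.t_ε⟩⟩

theorem isBiequiv_g : B.IsBiequiv c.g :=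
  ⟨c.f, equivalent_equivalence.symm ⟨c.ε.l, c.ε.isEquivalence, c.s_ε, c.t_ε⟩,
    equivalent_equivalence.symm ⟨c.η.l, c.η.isEquivalence, c.s_η, c.t_η⟩⟩

variable {c}

/-- The equation asks that `Tf.η` be inverse to a cell built from `S` and the interchange. This can
be solved for `Tf` because `η` is an equivalence, and then for `T` because composing with `f` is
locally full. -/
theorem exists_tCell (S : c.SCell) : ∃ T : c.TCell, (data S T).TetrahedronEta := by
  have h₁ : (B.Hom c.src c.src).t1 ((B.Hom c.src c.src).s2 (B.inter c.η.l c.η.l)) =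
      (B.Hom c.src c.src).s1 ((B.pre c.f).f1 ((B.post c.g).f1 c.ε.l)) := by
    simp [t1_inter, c.t_η, c.s_ε, post_f0, cmp_assoc]
  have h₂ : (B.Hom c.src c.src).t1 c.η.l =
      (B.Hom c.src c.src).s1 ((B.Hom c.src c.src).s2 ((B.post c.g).f2 S.cell)) := by
    simp [c.t_η, S.s_cell, c.s_η, post_f0, one_cmp]
  have h₃ : (B.Hom c.src c.src).t2 (wr (B.inter c.η.l c.η.l) _ h₁) =
      (B.Hom c.src c.src).s2 (wl c.η.l _ h₂) := by
    simp [t2_inter, S.s_cell, c.s_η, c.t_η, pre_one_f1, post_post_f1, post_pre_f1]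
  have hM := ((inter_iso c.η.l c.η.l).wr _ h₁).vcomp (((B.post c.g).isIso2 S.iso).wl c.η.l h₂) h₃
  obtain ⟨d, sd, td, ed⟩ := c.η.isEquivalence.exists_wl_eq (c := inv _ hM)
    (f := (B.pre c.f).f1 ((B.Hom c.tgt c.src).id1 c.g))
    (g := (B.pre c.f).f1 ((B.Hom c.tgt c.src).comp1 ((B.pre c.g).f1 c.η.l)
      ((B.post c.g).f1 c.ε.l) (by simp [c.t_η, c.s_ε, post_f0, cmp_assoc])))
    (by simp [c.t_η]) (by simp [c.t_η, c.s_η, cmp_one])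
    (by simp [S.t_cell, post_f0])
    (by simp [s2_inter, c.t_η, c.s_η, post_one_f1, pre_pre_f1])
  obtain ⟨T, sT, tT, rfl⟩ := c.isBiequiv_f.pre.full (by simp [c.s_η, cmp_one])
    (by simp [c.t_ε, post_f0, one_cmp]) sd td
  have hd := c.η.isEquivalence.isIso2_of_wl _ (by rw [ed]; exact isIso2_inv hM)
  refine ⟨⟨T, sT, tT, c.isBiequiv_f.pre.isIso2 hd⟩, ?_⟩
  refine (vcomp_vcomp _ _ _ _ _).trans ((vcomp_congr ed rfl _).trans ((inv_vcomp hM _).trans ?_))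
  simp [S.t_cell, post_f0]
  rfl

theorem tCell_unique (S : c.SCell) {T T' : c.TCell} (h : (data S T).TetrahedronEta)
    (h' : (data S T').TetrahedronEta) : T = T' := by
  have hg : (B.Hom c.src c.src).IsIso2 (data S T).gεfηη := (data S T).gεfηη_iso
  have hs : (B.Hom c.src c.src).IsIso2 (data S T).gSη := (data S T).gSη_iso
  have e := hg.cancel_right _ (data S T').t2_Tfη (hs.cancel_right
    ((TwoCat.t2_vcomp _ _ _ _).trans (data S T).t2_gεfηη)
    ((TwoCat.t2_vcomp _ _ _ _).trans (data S T).t2_gεfηη) (h.trans h'.symm))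
  refine TCell.ext (c.isBiequiv_f.pre.faithful (by rw [T.s_cell, T'.s_cell])
    (by rw [T.t_cell, T'.t_cell]) (c.η.isEquivalence.wl_cancel
    (by simp [c.t_η, T.s_cell]) (by simp [c.t_η, T'.s_cell]) ?_ ?_ e))
  · simp [T.s_cell, T'.s_cell]
  · simp [T.t_cell, T'.t_cell]

/-- Here the unknown enters as `gS.η`; it is found by cancelling `η` and then using that composing
with `g` is locally full. -/
theorem exists_sCell (T : c.TCell) : ∃ S : c.SCell, (data S T).TetrahedronEta := by
  have h₁ : (B.Hom c.src c.src).t1 ((B.Hom c.src c.src).s2 (B.inter c.η.l c.η.l)) =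
      (B.Hom c.src c.src).s1 ((B.pre c.f).f1 ((B.post c.g).f1 c.ε.l)) := by
    simp [t1_inter, c.t_η, c.s_ε, post_f0, cmp_assoc]
  have h₂ : (B.Hom c.src c.src).t1 c.η.l =
      (B.Hom c.src c.src).s1 ((B.Hom c.src c.src).s2 ((B.pre c.f).f2 T.cell)) := by
    simp [c.t_η, T.s_cell]
  have h₃ : (B.Hom c.src c.src).t2 (wl c.η.l _ h₂) =
      (B.Hom c.src c.src).s2 (wr (B.inter c.η.l c.η.l) _ h₁) := by
    simp [s2_inter, T.t_cell, c.s_η, c.t_η, post_one_f1, pre_pre_f1]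
  have hM := (((B.pre c.f).isIso2 T.iso).wl c.η.l h₂).vcomp ((inter_iso c.η.l c.η.l).wr _ h₁) h₃
  obtain ⟨d, sd, td, ed⟩ := c.η.isEquivalence.exists_wl_eq (c := inv _ hM)
    (f := (B.post c.g).f1 ((B.Hom c.src c.tgt).comp1 ((B.post c.f).f1 c.η.l)
      ((B.pre c.f).f1 c.ε.l) (by simp [c.t_η, c.s_ε, post_f0, cmp_assoc])))
    (g := (B.post c.g).f1 ((B.Hom c.src c.tgt).id1 c.f))
    (by simp [c.t_η, c.s_η, post_f0, one_cmp]) (by simp [c.t_η, post_f0])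
    (by simp [t2_inter, c.t_η, c.s_η, pre_one_f1, post_post_f1, post_pre_f1])
    (by simp [T.s_cell, post_f0])
  obtain ⟨S, sS, tS, rfl⟩ := c.isBiequiv_g.post.full (by simp [c.s_η, post_f0, one_cmp])
    (by simp [c.t_ε, cmp_one]) sd td
  have hd := c.η.isEquivalence.isIso2_of_wl _ (by rw [ed]; exact isIso2_inv hM)
  refine ⟨⟨S, sS, tS, c.isBiequiv_g.post.isIso2 hd⟩, ?_⟩
  refine (vcomp_congr rfl ed _).trans ((vcomp_inv hM _).trans ?_)
  simp [T.s_cell]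
  rfl

theorem sCell_unique (T : c.TCell) {S S' : c.SCell} (h : (data S T).TetrahedronEta)
    (h' : (data S' T).TetrahedronEta) : S = S' := by
  have hg : (B.Hom c.src c.src).IsIso2 (data S T).gεfηη := (data S T).gεfηη_iso
  have ht : (B.Hom c.src c.src).IsIso2 (data S T).Tfη := (data S T).Tfη_iso
  have e := (ht.vcomp hg (data S T).t2_Tfη).cancel_left
    ((TwoCat.t2_vcomp _ _ _ _).trans (data S T).t2_gεfηη)
    ((TwoCat.t2_vcomp _ _ _ _).trans (data S' T).t2_gεfηη) (h.trans h'.symm)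
  refine SCell.ext (c.isBiequiv_g.post.faithful (by rw [S.s_cell, S'.s_cell])
    (by rw [S.t_cell, S'.t_cell]) (c.η.isEquivalence.wl_cancel
    (by simp [c.t_η, S.s_cell, c.s_η, post_f0, one_cmp])
    (by simp [c.t_η, S'.s_cell, c.s_η, post_f0, one_cmp]) ?_ ?_ e))
  · simp [S.s_cell, S'.s_cell]
  · simp [S.t_cell, S'.t_cell]

end BiequivCore

namespace AdjBiequiv

variable {B : GrayCat.{u}}

/-- The underlying 1-cells and 2-cells of an adjoint biequivalence. -/
@[simps]
def core (e : B.AdjBiequiv) : B.BiequivCore where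
  src := e.src
  tgt := e.tgt
  f := e.f
  g := e.g
  η := e.η
  ε := e.ε
  s_η := e.s_η
  t_η := e.t_η
  s_ε := e.s_ε
  t_ε := e.t_ε

/-- The 3-cell `S` of an adjoint biequivalence. -/
@[simps]
def sCell (e : B.AdjBiequiv) : e.core.SCell := ⟨e.S, e.s_S, e.t_S, e.S_iso⟩

/-- The 3-cell `T` of an adjoint biequivalence. -/
@[simps]
def tCell (e : B.AdjBiequiv) : e.core.TCell := ⟨e.T, e.s_T, e.t_T, e.T_iso⟩

/-- The adjoint biequivalence given by data satisfying one tetrahedron equation. -/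
def ofData (e : B.AdjBiequivData) (h : e.TetrahedronEta) : B.AdjBiequiv :=
  ⟨e, h, e.tetrahedronEps_of_eta h⟩

/-- An adjoint biequivalence is determined by its 1-cells, its 2-cells and the 3-cell `S`. -/
noncomputable def equivSCell : B.AdjBiequiv ≃ Σ c : B.BiequivCore, c.SCell where
  toFun e := ⟨e.core, e.sCell⟩
  invFun p := ofData (BiequivCore.data p.2 (BiequivCore.exists_tCell p.2).choose)
    (BiequivCore.exists_tCell p.2).choose_spec
  left_inv e := by
    have : (BiequivCore.exists_tCell e.sCell).choose = e.tCell :=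
      BiequivCore.tCell_unique _ (BiequivCore.exists_tCell e.sCell).choose_spec e.tetrahedron_η
    simp only [this]
    rfl
  right_inv _ := rfl

/-- An adjoint biequivalence is determined by its 1-cells, its 2-cells and the 3-cell `T`. -/
noncomputable def equivTCell : B.AdjBiequiv ≃ Σ c : B.BiequivCore, c.TCell where
  toFun e := ⟨e.core, e.tCell⟩
  invFun p := ofData (BiequivCore.data (BiequivCore.exists_sCell p.2).choose p.2)
    (BiequivCore.exists_sCell p.2).choose_spec
  left_inv e := by
    have : (BiequivCore.exists_sCell e.tCell).choose = e.sCell :=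
      BiequivCore.sCell_unique _ (BiequivCore.exists_sCell e.tCell).choose_spec e.tetrahedron_η
    simp only [this]
    rfl
  right_inv _ := rfl

end AdjBiequiv

end GrayCat

namespace TwoFunctor

variable {X Y : TwoCat.{u}} (P : TwoFunctor X Y)

@[simp]
theorem map_wl (f : X.C1) (a : X.C2) (h) :
    P.f2 (X.wl f a h) = Y.wl (P.f1 f) (P.f2 a) (by simp [h]) := by
  simp [TwoCat.wl]

@[simp]
theorem map_wr (a : X.C2) (f : X.C1) (h) :
    P.f2 (X.wr a f h) = Y.wr (P.f2 a) (P.f1 f) (by simp [h]) := by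
  simp [TwoCat.wr]

@[simp]
theorem map_inv (a : X.C2) (ha) : P.f2 (X.inv a ha) = Y.inv (P.f2 a) (P.isIso2 ha) := by
  apply TwoCat.eq_inv_of_vcomp (h := by simp)
  rw [← P.map_vcomp _ _ (by simp)]
  simp

end TwoFunctor

/-! ### Completing biequivalences to adjoint biequivalences. -/

namespace GrayCat

open TwoCat

variable {A B : GrayCat.{u}}

/-- Choose a one-sided inverse of the equivalence `fη` up to isomorphism. As composing with `f` is
locally essentially surjective, it is isomorphic to `εf` for some `ε`, and `ε` is an equivalence
because `εf` is. The remaining isomorphism is the 3-cell `S`. -/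
theorem IsBiequiv.exists_counit {X Y : A.Obj} {f : (A.Hom X Y).C0} (hf : A.IsBiequiv f)
    {g : (A.Hom Y X).C0} {η : (A.Hom X X).C1} (hη : (A.Hom X X).IsEquivalence η)
    (s_η : (A.Hom X X).s1 η = A.one X) (t_η : (A.Hom X X).t1 η = A.cmp f g) :
    ∃ (ε : (A.Hom Y Y).C1) (s_ε : (A.Hom Y Y).s1 ε = A.cmp g f), (A.Hom Y Y).t1 ε = A.one Y ∧
      (A.Hom Y Y).IsEquivalence ε ∧ (A.Hom X Y).Iso1
        ((A.Hom X Y).comp1 ((A.post f).f1 η) ((A.pre f).f1 ε)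
          (by simp [t_η, s_ε, post_f0, cmp_assoc])) ((A.Hom X Y).id1 f) := by
  obtain ⟨k, hk, i⟩ := ((A.post f).isEquivalence hη).exists_comp1_iso ((A.Hom X Y).id1 f)
    (by simp [s_η, post_f0, one_cmp])
  obtain ⟨ε, s_ε, t_ε, j⟩ := hf.pre.exists_iso1 (A.cmp g f) (A.one Y) k
    (by simp [← hk, t_η, post_f0, cmp_assoc]) (by simpa [cmp_one] using i.t1_eq)
  have hε := (j.comp_left _ (by simp [t_η, s_ε, post_f0, cmp_assoc]) hk).trans i
  refine ⟨ε, s_ε, t_ε, hf.pre.isEquivalence ?_, hε⟩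
  exact ((A.post f).isEquivalence hη).of_comp_left _ ((isEquivalence_id1 f).of_iso1 hε.symm)

theorem IsBiequiv.exists_adjBiequiv {X Y : A.Obj} {f : (A.Hom X Y).C0} (hf : A.IsBiequiv f) :
    ∃ (e : A.AdjBiequiv) (_ : e.src = X) (_ : e.tgt = Y), HEq e.f f := by
  obtain ⟨g, ⟨η₀, hη, s_η, t_η⟩, -⟩ := id hf
  obtain ⟨η, rfl⟩ := hη.exists_adjEquiv'
  obtain ⟨ε₀, s_ε, t_ε, hε, S, hS, s_S, t_S⟩ := hf.exists_counit hη s_η t_η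
  obtain ⟨ε, rfl⟩ := hε.exists_adjEquiv'
  exact ⟨AdjBiequiv.equivSCell.symm ⟨⟨X, Y, f, g, η, ε, s_η, t_η, s_ε, t_ε⟩, ⟨S, s_S, t_S, hS⟩⟩,
    rfl, rfl, HEq.rfl⟩

/-- The isomorphism in `π_* A` given by a biequivalence. -/
def piStarIso {X Y : A.Obj} (f : (A.Hom X Y).C0) (g : (A.Hom Y X).C0)
    (h : (A.Hom X X).Equivalent (A.one X) (A.cmp f g))
    (h' : (A.Hom Y Y).Equivalent (A.cmp g f) (A.one Y)) :
    @Iso A.PiStar _ X Y where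
  hom := (Quot.mk _ f : (A.Hom X Y).Pi)
  inv := (Quot.mk _ g : (A.Hom Y X).Pi)
  hom_inv_id := (quot_mk_eq_iff.2 h).symm
  inv_hom_id := quot_mk_eq_iff.2 h'

/-- Since equivalence of 1-cells is an equivalence relation, equations between classes in `π_* A`
come from actual equivalences. -/
theorem isBiequiv_of_iso {X Y : A.PiStar} (i : X ≅ Y) {f : (A.Hom X Y).C0}
    (hf : i.hom = (Quot.mk _ f : (A.Hom X Y).Pi)) : A.IsBiequiv f := by
  obtain ⟨g, hg⟩ := Quot.exists_rep (show (A.Hom Y X).Pi from i.inv)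
  have h := i.hom_inv_id
  have h' := i.inv_hom_id
  rw [hf, show i.inv = (Quot.mk _ g : (A.Hom Y X).Pi) from hg.symm] at h h'
  exact ⟨g, quot_mk_eq_iff.1 h.symm, quot_mk_eq_iff.1 h'⟩

end GrayCat

/-! ### Lifting adjoint biequivalences along local fibrations. -/

namespace GrayFunctor

open GrayCat TwoCat

variable {A B : GrayCat.{u}}

/-- The image of the 1-cells and 2-cells of an adjoint biequivalence. -/
def mapCore (F : GrayFunctor A B) (c : A.BiequivCore) : B.BiequivCore where
  src := F.obj c.src
  tgt := F.obj c.tgt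
  f := (F.hom _ _).f0 c.f
  g := (F.hom _ _).f0 c.g
  η := (F.hom _ _).mapAdjEquiv c.η
  ε := (F.hom _ _).mapAdjEquiv c.ε
  s_η := by simp [c.s_η]
  t_η := by simp [c.t_η]
  s_ε := by simp [c.s_ε]
  t_ε := by simp [c.t_ε]

/-- Adjoint biequivalences are equal if they have the same underlying cells apart from `T`. -/
theorem _root_.GrayCat.AdjBiequiv.ext_of_sCell {e e' : A.AdjBiequiv} (h : e.core = e'.core)
    (h' : HEq e.S e'.S) : e = e' := by
  apply AdjBiequiv.equivSCell.injective
  change (⟨e.core, e.sCell⟩ : Σ c : A.BiequivCore, c.SCell) = ⟨e'.core, e'.sCell⟩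
  have key : ∀ {c c' : A.BiequivCore} (s : c.SCell) (s' : c'.SCell), c = c' → HEq s.cell s'.cell →
      (⟨c, s⟩ : Σ c : A.BiequivCore, c.SCell) = ⟨c', s'⟩ := by
    rintro c _ s s' rfl h
    rw [BiequivCore.SCell.ext (eq_of_heq h)]
  exact key _ _ h h'

/-- Once `f` is lifted to a biequivalence, local lifting suffices for everything else: each of `g`,
`η` and `ε` is first solved for in `A` without regard to its image, then corrected along a lifted
comparison cell. -/
theorem IsLocallyFibration.lift_core {F : A ⟶ B} (hF : IsLocallyFibration F) {X Y : A.Obj}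
    {f : (A.Hom X Y).C0} (hf : A.IsBiequiv f) (g : (B.Hom (F.obj Y) (F.obj X)).C0)
    (η : (B.Hom (F.obj X) (F.obj X)).AdjEquiv) (ε : (B.Hom (F.obj Y) (F.obj Y)).AdjEquiv)
    (s_η : (B.Hom (F.obj X) (F.obj X)).s1 η.l = B.one (F.obj X))
    (t_η : (B.Hom (F.obj X) (F.obj X)).t1 η.l = B.cmp ((F.hom _ _).f0 f) g)
    (s_ε : (B.Hom (F.obj Y) (F.obj Y)).s1 ε.l = B.cmp g ((F.hom _ _).f0 f))
    (t_ε : (B.Hom (F.obj Y) (F.obj Y)).t1 ε.l = B.one (F.obj Y))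
    (S : (⟨_, _, (F.hom _ _).f0 f, g, η, ε, s_η, t_η, s_ε, t_ε⟩ : B.BiequivCore).SCell) :
    ∃ (c : A.BiequivCore) (S' : c.SCell), c.tgt = Y ∧
      mapCore F c = ⟨_, _, (F.hom _ _).f0 f, g, η, ε, s_η, t_η, s_ε, t_ε⟩ ∧
      HEq ((F.hom _ _).f2 S'.cell) S.cell := by
  obtain ⟨S, s_S, t_S, hS⟩ := S
  dsimp only at S s_S t_S hS
  have hf' : B.IsBiequiv ((F.hom X Y).f0 f) :=
    ⟨g, ⟨η.l, η.isEquivalence, s_η, t_η⟩, ⟨ε.l, ε.isEquivalence, s_ε, t_ε⟩⟩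
  obtain ⟨g₀, hg₀⟩ := hf.pre.exists_equivalent (A.one X)
  obtain ⟨η₀, hη₀, s_η₀, t_η₀⟩ := equivalent_equivalence.symm hg₀
  obtain ⟨k, hk, i⟩ := η.isEquivalence.exists_comp1_iso ((F.hom X X).f1 η₀) (by simp [s_η₀, s_η])
  -- The 1-cells `g` and `F g₀` are both inverse to `F f`, and `θ` is the comparison compatible with
  -- `η` and `F η₀` up to isomorphism. The source of its lift is the required lift of `g`.
  obtain ⟨θ, s_θ, t_θ, j⟩ := hf'.pre.exists_iso1 g ((F.hom Y X).f0 g₀) k (by simp [← hk, t_η])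
    (by have := i.t1_eq; simpa [t_η₀] using this)
  have i' := (j.comp_left η.l (by simp [t_η, s_θ]) hk).trans i
  have hθ : (B.Hom _ _).IsEquivalence θ := hf'.pre.isEquivalence (η.isEquivalence.of_comp_left _
    (((F.hom X X).isEquivalence hη₀).of_iso1 i'.symm))
  obtain ⟨θ, hθ', t_θ', rfl⟩ := (hF Y X).1 g₀ θ hθ t_θ
  rw [(F.hom Y X).s1_f1] at s_θ
  subst s_θ
  have hpθ := (A.pre f).isEquivalence hθ'
  -- Transporting `η₀` back along the lift of `θ` gives a unit for the lifted `g`. Its image is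
  -- isomorphic to `η`, and lifting this isomorphism makes it equal.
  obtain ⟨η₁, t_η₁, j₁⟩ := hpθ.exists_comp1_iso' η₀ (by simp [t_θ', t_η₀])
  have hη₁ : (A.Hom X X).IsEquivalence η₁ := hpθ.of_comp_right _ (hη₀.of_iso1 j₁.symm)
  have jη : (B.Hom _ _).Iso1 η.l ((F.hom X X).f1 η₁) := by
    refine ((B.pre ((F.hom X Y).f0 f)).isEquivalence hθ).iso1_of_comp_right (by simp [t_η])
      (by simp [t_η₁]) (i'.trans ?_)
    have := (j₁.map (F.hom X X)).symm
    simpa only [TwoFunctor.map_comp1, map_pre_f1] using this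
  obtain ⟨b, hb, s_b, t_b⟩ := jη
  obtain ⟨b, hb', t_b', rfl⟩ := (hF X X).2 η₁ b hb t_b
  have jη' : (A.Hom X X).Iso1 η₁ ((A.Hom X X).s2 b) := Iso1.symm ⟨b, hb', rfl, t_b'⟩
  obtain ⟨η, hηl, rfl⟩ := (hF X X).exists_adjEquiv (hη₁.of_iso1 jη') η (by simpa using s_b)
  have s_η' : (A.Hom X X).s1 η.l = A.one X := by
    rw [hηl, ← jη'.s1_eq]
    have := j₁.s1_eq
    simpa [s_η₀] using this
  have t_η' : (A.Hom X X).t1 η.l = A.cmp f ((A.Hom Y X).s1 θ) := by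
    rw [hηl, ← jη'.t1_eq, t_η₁]
    simp
  obtain ⟨ε₀, s_ε₀, t_ε₀, hε₀, S₀, hS₀, s_S₀, t_S₀⟩ := hf.exists_counit η.isEquivalence s_η' t_η'
  have hη := ((B.post ((F.hom X Y).f0 f)).isEquivalence
    ((F.hom X X).isEquivalence η.isEquivalence))
  -- The cells `S` and `F S₀` have a common target, so `S` followed by the inverse of `F S₀` is an
  -- isomorphism between their sources. Cancelling `fη` and then `f` gives `φ : ε ≅ F ε₀`, for which
  -- `S` is the whiskered `φ` followed by `F S₀`. Lifting `φ` thus lifts both `ε` and `S`.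
  obtain ⟨d, s_d, t_d, e_d⟩ := hη.exists_wl_eq
    (c := (B.Hom _ _).vcomp S ((B.Hom _ _).inv _ ((F.hom X Y).isIso2 hS₀)) (by simp [t_S, t_S₀]))
    (f := (B.pre ((F.hom X Y).f0 f)).f1 ε.l)
    (g := (B.pre ((F.hom X Y).f0 f)).f1 ((F.hom Y Y).f1 ε₀))
    (by simp [s_ε, t_η', post_f0, cmp_assoc]) (by simp [s_ε₀, t_η', post_f0, cmp_assoc])
    (by simp [s_S]) (by simp [s_S₀])
  obtain ⟨φ, s_φ, t_φ, rfl⟩ := hf'.pre.full (by simp [s_ε, s_ε₀]) (by simp [t_ε, t_ε₀]) s_d t_d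
  have hφ : (B.Hom _ _).IsIso2 φ := hf'.pre.isIso2 (hη.isIso2_of_wl _
    (by rw [e_d]; exact hS.vcomp (isIso2_inv _) _))
  obtain ⟨φ, hφ', t_φ', rfl⟩ := (hF Y Y).2 ε₀ φ hφ t_φ
  have jε : (A.Hom Y Y).Iso1 ε₀ ((A.Hom Y Y).s2 φ) := Iso1.symm ⟨φ, hφ', rfl, t_φ'⟩
  obtain ⟨ε, hεl, rfl⟩ := (hF Y Y).exists_adjEquiv (hε₀.of_iso1 jε) ε (by simpa using s_φ)
  have s_ε' : (A.Hom Y Y).s1 ε.l = A.cmp ((A.Hom Y X).s1 θ) f := by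
    rw [hεl, ← jε.s1_eq, s_ε₀]
  have t_ε' : (A.Hom Y Y).t1 ε.l = A.one Y := by
    rw [hεl, ← jε.t1_eq, t_ε₀]
  have hw : (A.Hom X Y).t1 ((A.post f).f1 η.l) =
      (A.Hom X Y).s1 ((A.Hom X Y).s2 ((A.pre f).f2 φ)) := by
    simp [← hεl, s_ε', t_η', post_f0, cmp_assoc]
  have hv : (A.Hom X Y).t2 ((A.Hom X Y).wl _ ((A.pre f).f2 φ) hw) = (A.Hom X Y).s2 S₀ := by
    simp [t_φ', s_S₀]
  refine ⟨⟨X, Y, f, (A.Hom Y X).s1 θ, η, ε, s_η', t_η', s_ε', t_ε'⟩,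
    ⟨(A.Hom X Y).vcomp _ S₀ hv, by simp [hεl], by simp [t_S₀],
      (((A.pre f).isIso2 hφ').wl _ hw).vcomp hS₀ hv⟩, rfl, rfl, heq_of_eq ?_⟩
  have : (F.hom X Y).f2 ((A.Hom X Y).wl _ ((A.pre f).f2 φ) hw) =
      (B.Hom _ _).vcomp S ((B.Hom _ _).inv _ ((F.hom X Y).isIso2 hS₀)) (by simp [t_S, t_S₀]) := by
    rw [TwoFunctor.map_wl]
    simp only [map_post_f1, map_pre_f2]
    exact e_d
  rw [TwoFunctor.map_vcomp]
  simp only [this, vcomp_vcomp, inv_vcomp, TwoFunctor.t2_f2, t_S₀, TwoFunctor.map_id1]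
  apply (B.Hom _ _).vcomp_id2

theorem isFibration_iff {A B : GrayCat.{u}} (F : A ⟶ B) :
    IsFibration F ↔ LiftsAdjBiequiv F ∧ IsLocallyFibration F := by
  constructor
  · rintro ⟨hF, hF'⟩
    refine ⟨fun Y e he => ?_, hF⟩
    have key : ∀ (c : B.BiequivCore) (S : c.SCell), c.tgt = F.obj Y →
        ∃ (c' : A.BiequivCore) (S' : c'.SCell), c'.tgt = Y ∧ mapCore F c' = c ∧
          HEq ((F.hom _ _).f2 S'.cell) S.cell := by
      rintro ⟨X, Y', f, g, η, ε, s_η, t_η, s_ε, t_ε⟩ S (rfl : Y' = F.obj Y)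
      obtain ⟨X, rfl, i, hi⟩ := hF' Y X (piStarIso f g ⟨_, η.isEquivalence, s_η, t_η⟩
        ⟨_, ε.isEquivalence, s_ε, t_ε⟩)
      obtain ⟨f₀, hf₀⟩ := Quot.exists_rep (show (A.Hom X Y).Pi from i.hom)
      rw [eqToHom_refl, Category.id_comp, show i.hom = (Quot.mk _ f₀ : (A.Hom X Y).Pi) from
        hf₀.symm] at hi
      -- The lifted isomorphism only gives `F f₀` equivalent to `f`. Lifting an equivalence `f → F
      -- f₀` to one with codomain `f₀` replaces `f₀` by a 1-cell lying exactly over `f`, in the same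
      -- class.
      obtain ⟨a, ha, s_a, t_a⟩ := equivalent_equivalence.symm (quot_mk_eq_iff.1 hi)
      obtain ⟨a, ha', t_a', rfl⟩ := (hF X Y).1 f₀ a ha t_a
      have hi' : i.hom = (Quot.mk _ ((A.Hom X Y).s1 a) : (A.Hom X Y).Pi) :=
        hf₀.symm.trans (quot_mk_eq_iff.2
          (equivalent_equivalence.symm ⟨a, ha', rfl, t_a'⟩))
      obtain rfl : (F.hom X Y).f0 ((A.Hom X Y).s1 a) = f := by simpa using s_a
      exact hF.lift_core (isBiequiv_of_iso i hi') g η ε s_η t_η s_ε t_ε S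
    obtain ⟨c, S, hc, hc', hS⟩ := key e.core e.sCell he
    exact ⟨AdjBiequiv.equivSCell.symm ⟨c, S⟩, hc, AdjBiequiv.ext_of_sCell hc' hS⟩
  · rintro ⟨h, hF⟩
    refine ⟨hF, fun Y X i => ?_⟩
    obtain ⟨f, hf⟩ := Quot.exists_rep (show (B.Hom X (F.obj Y)).Pi from i.hom)
    obtain ⟨e, hX, hY, hef⟩ := (isBiequiv_of_iso i hf.symm).exists_adjBiequiv
    obtain ⟨e, rfl, rfl⟩ := h Y e hY
    subst hX
    obtain rfl := eq_of_heq hef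
    exact ⟨e.src, rfl, piStarIso e.f e.g ⟨_, e.η.isEquivalence, e.s_η, e.t_η⟩
      ⟨_, e.ε.isEquivalence, e.s_ε, e.t_ε⟩, hf.trans (Category.id_comp i.hom).symm⟩

end GrayFunctor

/-! ### Gray-categories as single-sorted partial algebras. -/

namespace GrayCat

/-- A cell of a Gray-category, of any dimension. -/
inductive Cell (A : GrayCat.{u}) : Type u
  | obj (X : A.Obj)
  | c0 {X Y : A.Obj} (f : (A.Hom X Y).C0)
  | c1 {X Y : A.Obj} (a : (A.Hom X Y).C1)
  | c2 {X Y : A.Obj} (a : (A.Hom X Y).C2)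

/-- The operations of a Gray-category, together with the formation of inverses of 3-cells. -/
inductive Op : Type u
  | one | s1 | t1 | s2 | t2 | id1 | id2 | comp1 | vcomp | hcomp | inv | post | pre | inter

/-- The graphs of the operations of a Gray-category, all regarded as binary. -/
inductive Rel (A : GrayCat.{u}) : Op.{u} → A.Cell → A.Cell → A.Cell → Prop
  | one (X b) : Rel A .one (.obj X) b (.c0 (A.one X))
  | s1 {X Y} (a : (A.Hom X Y).C1) (b) : Rel A .s1 (.c1 a) b (.c0 ((A.Hom X Y).s1 a))
  | t1 {X Y} (a : (A.Hom X Y).C1) (b) : Rel A .t1 (.c1 a) b (.c0 ((A.Hom X Y).t1 a))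
  | s2 {X Y} (a : (A.Hom X Y).C2) (b) : Rel A .s2 (.c2 a) b (.c1 ((A.Hom X Y).s2 a))
  | t2 {X Y} (a : (A.Hom X Y).C2) (b) : Rel A .t2 (.c2 a) b (.c1 ((A.Hom X Y).t2 a))
  | id1 {X Y} (a : (A.Hom X Y).C0) (b) : Rel A .id1 (.c0 a) b (.c1 ((A.Hom X Y).id1 a))
  | id2 {X Y} (a : (A.Hom X Y).C1) (b) : Rel A .id2 (.c1 a) b (.c2 ((A.Hom X Y).id2 a))
  | comp1 {X Y} (a b : (A.Hom X Y).C1) (h) :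
      Rel A .comp1 (.c1 a) (.c1 b) (.c1 ((A.Hom X Y).comp1 a b h))
  | vcomp {X Y} (a b : (A.Hom X Y).C2) (h) :
      Rel A .vcomp (.c2 a) (.c2 b) (.c2 ((A.Hom X Y).vcomp a b h))
  | hcomp {X Y} (a b : (A.Hom X Y).C2) (h) :
      Rel A .hcomp (.c2 a) (.c2 b) (.c2 ((A.Hom X Y).hcomp a b h))
  | inv {X Y} (a : (A.Hom X Y).C2) (h) (b) : Rel A .inv (.c2 a) b (.c2 ((A.Hom X Y).inv a h))
  | post1 {X Y Z} (g : (A.Hom Y Z).C0) (a : (A.Hom X Y).C1) :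
      Rel A .post (.c0 g) (.c1 a) (.c1 ((A.post g).f1 a))
  | post2 {X Y Z} (g : (A.Hom Y Z).C0) (a : (A.Hom X Y).C2) :
      Rel A .post (.c0 g) (.c2 a) (.c2 ((A.post g).f2 a))
  | pre0 {X Y Z} (f : (A.Hom X Y).C0) (a : (A.Hom Y Z).C0) :
      Rel A .pre (.c0 f) (.c0 a) (.c0 ((A.pre f).f0 a))
  | pre1 {X Y Z} (f : (A.Hom X Y).C0) (a : (A.Hom Y Z).C1) :
      Rel A .pre (.c0 f) (.c1 a) (.c1 ((A.pre f).f1 a))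
  | pre2 {X Y Z} (f : (A.Hom X Y).C0) (a : (A.Hom Y Z).C2) :
      Rel A .pre (.c0 f) (.c2 a) (.c2 ((A.pre f).f2 a))
  | inter {X Y Z} (α : (A.Hom X Y).C1) (β : (A.Hom Y Z).C1) :
      Rel A .inter (.c1 α) (.c1 β) (.c2 (A.inter α β))

theorem Rel.functional {A : GrayCat.{u}} {k : Op} {a b z z' : A.Cell} (h : A.Rel k a b z)
    (h' : A.Rel k a b z') : z = z' := by
  cases h <;> cases h' <;> rfl

end GrayCat

namespace GrayFunctor

variable {A B C : GrayCat.{u}}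

/-- The action of a Gray-functor on cells. -/
@[simp]
def cell (F : GrayFunctor A B) : A.Cell → B.Cell
  | .obj X => .obj (F.obj X)
  | .c0 f => .c0 ((F.hom _ _).f0 f)
  | .c1 a => .c1 ((F.hom _ _).f1 a)
  | .c2 a => .c2 ((F.hom _ _).f2 a)

theorem cell_comp (F : A ⟶ B) (G : B ⟶ C) (a : A.Cell) : cell (F ≫ G) a = cell G (cell F a) := by
  cases a <;> rfl

/-- The operation `inv` is included because inverses of 3-cells are unique, hence preserved by any
Gray-functor. -/
theorem rel_cell (F : GrayFunctor A B) {k : GrayCat.Op} {a b z : A.Cell} (h : A.Rel k a b z) :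
    B.Rel k (F.cell a) (F.cell b) (F.cell z) := by
  cases h <;> simp only [cell, map_one, TwoFunctor.map_id1, TwoFunctor.map_id2,
    TwoFunctor.map_comp1, TwoFunctor.map_vcomp, TwoFunctor.map_hcomp, TwoFunctor.map_inv,
    ← TwoFunctor.s1_f1, ← TwoFunctor.t1_f1, ← TwoFunctor.s2_f2, ← TwoFunctor.t2_f2,
    map_post_f1, map_post_f2, map_pre_f0, map_pre_f1, map_pre_f2, map_inter] <;> constructor

theorem ext_of_cell {F G : A ⟶ B} (h : ∀ a, cell F a = cell G a) : F = G := by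
  obtain ⟨o, f, _, _, _, _⟩ := F
  obtain ⟨o', g, _, _, _, _⟩ := G
  obtain rfl : o = o' := funext fun X => by simpa using h (.obj X)
  obtain rfl : f = g := by
    funext X Y
    ext x
    · simpa using h (.c0 x)
    · simpa using h (.c1 x)
    · simpa using h (.c2 x)
  rfl

end GrayFunctor

/-! ### Smallness of generated subsets. -/

section Closure

variable {Z : Type*} {K : Type u} {Ar : K → Type u}

/-- The closure of the empty subset of `Z` under partial operations given by their graphs. -/
inductive Closure (R : ∀ k, (Ar k → Z) → Z → Prop) : Z → Prop
  | mk (k) (a : Ar k → Z) (z) (ha : ∀ i, Closure R (a i)) (h : R k a z) : Closure R z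

/-- The element of `Z` denoted by a term. -/
def Closure.Eval (R : ∀ k, (Ar k → Z) → Z → Prop) : WType Ar → Z → Prop
  | ⟨k, t⟩, z => ∃ a : Ar k → Z, (∀ i, Closure.Eval R (t i) (a i)) ∧ R k a z

/-- Every element of the closure is denoted by a well-founded term, and, the relations being
functional, a term denotes at most one element. Choosing a term for each element embeds the closure
in the small type of terms, whatever the size of `Z`. -/
theorem Closure.small (R : ∀ k, (Ar k → Z) → Z → Prop)
    (hR : ∀ k a z z', R k a z → R k a z' → z = z') : Small.{u} {z // Closure R z} := by
  have h₁ : ∀ t z z', Closure.Eval R t z → Closure.Eval R t z' → z = z' := by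
    intro t
    induction t with
    | mk k t ih =>
      rintro z z' ⟨a, ha, h⟩ ⟨a', ha', h'⟩
      obtain rfl : a = a' := funext fun i => ih i _ _ (ha i) (ha' i)
      exact hR k a z z' h h'
  have h₂ : ∀ z, Closure R z → ∃ t, Closure.Eval R t z := by
    intro z h
    induction h with
    | mk k a z _ h ih =>
      choose t ht using ih
      exact ⟨⟨k, t⟩, a, ht, h⟩
  choose t ht using fun z : {z // Closure R z} => h₂ z.1 z.2
  exact small_of_injective (f := t) fun z z' e => Subtype.ext (h₁ _ _ _ (ht z) (e ▸ ht z'))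

end Closure

/-! ### Small sub-Gray-categories of large products. -/

noncomputable section

/-- The type of sections of a family of types satisfying a predicate, shrunk to a small universe. -/
def SmallPi {ι : Type*} {T : ι → Type u} (p : (∀ m, T m) → Prop) [Small.{u} {f // p f}] : Type u :=
  Shrink.{u} {f // p f}

namespace SmallPi

variable {ι : Type*} {T : ι → Type u} {p : (∀ m, T m) → Prop} [Small.{u} {f // p f}]

/-- The components of an element. -/
def val (x : SmallPi p) : ∀ m, T m := ((equivShrink _).symm x).1

theorem prop (x : SmallPi p) : p x.val := ((equivShrink _).symm x).2

/-- The element with given components. -/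
def mk (f : ∀ m, T m) (h : p f) : SmallPi p := equivShrink _ ⟨f, h⟩

@[simp]
theorem val_mk (f : ∀ m, T m) (h : p f) (m : ι) : (mk f h).val m = f m := by
  simp [val, mk]

theorem ext {x y : SmallPi p} (h : ∀ m, x.val m = y.val m) : x = y :=
  (equivShrink _).symm.injective (Subtype.ext (funext h))

end SmallPi

namespace GrayCat

/-- A small collection of cells in a product of Gray-categories, closed under the operations. -/
structure SubProduct {ι : Type*} (M : ι → GrayCat.{u}) where
  /-- membership -/
  Mem : (∀ m, (M m).Cell) → Prop
  closed : ∀ k a b z, Mem a → Mem b → (∀ m, (M m).Rel k (a m) (b m) (z m)) → Mem z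
  small : Small.{u} {z // Mem z}

namespace SubProduct

variable {ι : Type*} {M : ι → GrayCat.{u}} (S : SubProduct M)

theorem small_of_cell {T : ι → Type u} (c : ∀ m, T m → (M m).Cell)
    (hc : ∀ m, Function.Injective (c m)) :
    Small.{u} {f : ∀ m, T m // S.Mem fun m => c m (f m)} :=
  have := S.small
  small_of_injective (f := fun f => (⟨fun m => c m (f.1 m), f.2⟩ : {z // S.Mem z})) fun _ _ h =>
    Subtype.ext (funext fun m => hc m (congrFun (congrArg Subtype.val h) m))

instance : Small.{u} {X : ∀ m, (M m).Obj // S.Mem fun m => .obj (X m)} :=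
  S.small_of_cell (fun _ => Cell.obj) fun _ _ _ h => by cases h; rfl

instance (X Y : ∀ m, (M m).Obj) :
    Small.{u} {f : ∀ m, ((M m).Hom (X m) (Y m)).C0 // S.Mem fun m => .c0 (f m)} :=
  S.small_of_cell (fun _ => Cell.c0) fun _ _ _ h => by cases h; rfl

instance (X Y : ∀ m, (M m).Obj) :
    Small.{u} {f : ∀ m, ((M m).Hom (X m) (Y m)).C1 // S.Mem fun m => .c1 (f m)} :=
  S.small_of_cell (fun _ => Cell.c1) fun _ _ _ h => by cases h; rfl

instance (X Y : ∀ m, (M m).Obj) :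
    Small.{u} {f : ∀ m, ((M m).Hom (X m) (Y m)).C2 // S.Mem fun m => .c2 (f m)} :=
  S.small_of_cell (fun _ => Cell.c2) fun _ _ _ h => by cases h; rfl

/-- The 2-category of cells between two given objects. -/
def hom (X Y : ∀ m, (M m).Obj) : TwoCat.{u} where
  C0 := SmallPi fun f : ∀ m, ((M m).Hom (X m) (Y m)).C0 => S.Mem fun m => .c0 (f m)
  C1 := SmallPi fun f : ∀ m, ((M m).Hom (X m) (Y m)).C1 => S.Mem fun m => .c1 (f m)
  C2 := SmallPi fun f : ∀ m, ((M m).Hom (X m) (Y m)).C2 => S.Mem fun m => .c2 (f m)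
  s1 f := .mk (fun m => ((M m).Hom _ _).s1 (f.val m))
    (S.closed .s1 _ _ _ f.prop f.prop fun _ => .s1 _ _)
  t1 f := .mk (fun m => ((M m).Hom _ _).t1 (f.val m))
    (S.closed .t1 _ _ _ f.prop f.prop fun _ => .t1 _ _)
  s2 f := .mk (fun m => ((M m).Hom _ _).s2 (f.val m))
    (S.closed .s2 _ _ _ f.prop f.prop fun _ => .s2 _ _)
  t2 f := .mk (fun m => ((M m).Hom _ _).t2 (f.val m))
    (S.closed .t2 _ _ _ f.prop f.prop fun _ => .t2 _ _)
  s1_s2 f := SmallPi.ext fun m => by simp only [SmallPi.val_mk]; apply TwoCat.s1_s2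
  t1_s2 f := SmallPi.ext fun m => by simp only [SmallPi.val_mk]; apply TwoCat.t1_s2
  id1 f := .mk (fun m => ((M m).Hom _ _).id1 (f.val m))
    (S.closed .id1 _ _ _ f.prop f.prop fun _ => .id1 _ _)
  s1_id1 f := SmallPi.ext fun m => by simp
  t1_id1 f := SmallPi.ext fun m => by simp
  id2 f := .mk (fun m => ((M m).Hom _ _).id2 (f.val m))
    (S.closed .id2 _ _ _ f.prop f.prop fun _ => .id2 _ _)
  s2_id2 f := SmallPi.ext fun m => by simp
  t2_id2 f := SmallPi.ext fun m => by simp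
  comp1 f g h := .mk (fun m => ((M m).Hom _ _).comp1 (f.val m) (g.val m)
      (by simpa using congrArg (fun x => x.val m) h))
    (S.closed .comp1 _ _ _ f.prop g.prop fun _ => .comp1 _ _ _)
  s1_comp1 f g h := SmallPi.ext fun m => by simp
  t1_comp1 f g h := SmallPi.ext fun m => by simp
  vcomp f g h := .mk (fun m => ((M m).Hom _ _).vcomp (f.val m) (g.val m)
      (by simpa using congrArg (fun x => x.val m) h))
    (S.closed .vcomp _ _ _ f.prop g.prop fun _ => .vcomp _ _ _)
  s2_vcomp f g h := SmallPi.ext fun m => by simp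
  t2_vcomp f g h := SmallPi.ext fun m => by simp
  hcomp f g h := .mk (fun m => ((M m).Hom _ _).hcomp (f.val m) (g.val m)
      (by simpa using congrArg (fun x => x.val m) h))
    (S.closed .hcomp _ _ _ f.prop g.prop fun _ => .hcomp _ _ _)
  s2_hcomp f g h := SmallPi.ext fun m => by simp
  t2_hcomp f g h := SmallPi.ext fun m => by simp
  id1_comp1 x f h := SmallPi.ext fun m => by simp
  comp1_id1 f x h := SmallPi.ext fun m => by simp
  comp1_assoc f g k h₁ h₂ h₃ h₄ := SmallPi.ext fun m => by
    simp only [SmallPi.val_mk]; apply TwoCat.comp1_assoc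
  id2_vcomp f a h := SmallPi.ext fun m => by simp
  vcomp_id2 a f h := SmallPi.ext fun m => by simp
  vcomp_assoc a b c h₁ h₂ h₃ h₄ := SmallPi.ext fun m => by
    simp only [SmallPi.val_mk]; apply TwoCat.vcomp_assoc
  id1_hcomp x a h := SmallPi.ext fun m => by simp
  hcomp_id1 a x h := SmallPi.ext fun m => by simp
  hcomp_assoc a b c h₁ h₂ h₃ h₄ := SmallPi.ext fun m => by
    simp only [SmallPi.val_mk]; apply TwoCat.hcomp_assoc
  id2_hcomp_id2 f g h h' := SmallPi.ext fun m => by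
    simp only [SmallPi.val_mk]; apply TwoCat.id2_hcomp_id2
  vcomp_hcomp_vcomp a b c d h₁ h₂ h₃ h₄ h₅ h₆ := SmallPi.ext fun m => by
    simp only [SmallPi.val_mk]; apply TwoCat.vcomp_hcomp_vcomp

/-- The projection 2-functors. -/
def proj (X Y : ∀ m, (M m).Obj) (m : ι) : TwoFunctor (S.hom X Y) ((M m).Hom (X m) (Y m)) where
  f0 f := SmallPi.val f m
  f1 f := SmallPi.val f m
  f2 f := SmallPi.val f m
  s1_f1 f := (SmallPi.val_mk (fun m => ((M m).Hom _ _).s1 (SmallPi.val f m)) _ m).symm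
  t1_f1 f := (SmallPi.val_mk (fun m => ((M m).Hom _ _).t1 (SmallPi.val f m)) _ m).symm
  s2_f2 f := (SmallPi.val_mk (fun m => ((M m).Hom _ _).s2 (SmallPi.val f m)) _ m).symm
  t2_f2 f := (SmallPi.val_mk (fun m => ((M m).Hom _ _).t2 (SmallPi.val f m)) _ m).symm
  map_id1 _ := SmallPi.val_mk _ _ _
  map_id2 _ := SmallPi.val_mk _ _ _
  map_comp1 _ _ _ := SmallPi.val_mk _ _ _
  map_vcomp _ _ _ := SmallPi.val_mk _ _ _
  map_hcomp _ _ _ := SmallPi.val_mk _ _ _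

section

variable {S} {X Y Z : ∀ m, (M m).Obj}

/-- The 1-cell of the Gray-category with given components. -/
def mk0 (f : ∀ m, ((M m).Hom (X m) (Y m)).C0) (hf : S.Mem fun m => .c0 (f m)) :
    (S.hom X Y).C0 := SmallPi.mk f hf

/-- The 2-cell of the Gray-category with given components. -/
def mk1 (f : ∀ m, ((M m).Hom (X m) (Y m)).C1) (hf : S.Mem fun m => .c1 (f m)) :
    (S.hom X Y).C1 := SmallPi.mk f hf

/-- The 3-cell of the Gray-category with given components. -/
def mk2 (f : ∀ m, ((M m).Hom (X m) (Y m)).C2) (hf : S.Mem fun m => .c2 (f m)) :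
    (S.hom X Y).C2 := SmallPi.mk f hf

@[simp]
theorem proj_mk0 (f : ∀ m, ((M m).Hom (X m) (Y m)).C0) (hf) (m : ι) :
    (S.proj X Y m).f0 (mk0 f hf) = f m := SmallPi.val_mk _ _ _

@[simp]
theorem proj_mk1 (f : ∀ m, ((M m).Hom (X m) (Y m)).C1) (hf) (m : ι) :
    (S.proj X Y m).f1 (mk1 f hf) = f m := SmallPi.val_mk _ _ _

@[simp]
theorem proj_mk2 (f : ∀ m, ((M m).Hom (X m) (Y m)).C2) (hf) (m : ι) :
    (S.proj X Y m).f2 (mk2 f hf) = f m := SmallPi.val_mk _ _ _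

theorem mem0 (f : (S.hom X Y).C0) : S.Mem fun m => .c0 ((S.proj X Y m).f0 f) := SmallPi.prop f

theorem mem1 (f : (S.hom X Y).C1) : S.Mem fun m => .c1 ((S.proj X Y m).f1 f) := SmallPi.prop f

theorem mem2 (f : (S.hom X Y).C2) : S.Mem fun m => .c2 ((S.proj X Y m).f2 f) := SmallPi.prop f

theorem ext0 {f g : (S.hom X Y).C0} (h : ∀ m, (S.proj X Y m).f0 f = (S.proj X Y m).f0 g) : f = g :=
  SmallPi.ext h

theorem ext1 {f g : (S.hom X Y).C1} (h : ∀ m, (S.proj X Y m).f1 f = (S.proj X Y m).f1 g) : f = g :=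
  SmallPi.ext h

theorem ext2 {f g : (S.hom X Y).C2} (h : ∀ m, (S.proj X Y m).f2 f = (S.proj X Y m).f2 g) : f = g :=
  SmallPi.ext h

/-- This is why closure under `inv` is demanded: the family of componentwise inverses has to belong
to `S`. -/
theorem isIso2_of_proj {a : (S.hom X Y).C2}
    (h : ∀ m, ((M m).Hom _ _).IsIso2 ((S.proj X Y m).f2 a)) : (S.hom X Y).IsIso2 a :=
  ⟨mk2 (fun m => ((M m).Hom _ _).inv _ (h m))
      (S.closed .inv _ _ _ (mem2 a) (mem2 a) fun _ => .inv _ _ _),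
    ext1 fun m => by simp [← TwoFunctor.t2_f2, ← TwoFunctor.s2_f2],
    ext1 fun m => by simp [← TwoFunctor.t2_f2, ← TwoFunctor.s2_f2],
    ext2 fun m => by simp, ext2 fun m => by simp [← TwoFunctor.s2_f2]⟩

/-- `Rel` has no clause for `post` on 1-cells, since the composite `gf` is already covered by `pre`.
-/
theorem mem_post0 (g : (S.hom Y Z).C0) (f : (S.hom X Y).C0) :
    S.Mem fun m => .c0 (((S.proj X Y m).comp ((M m).post ((S.proj Y Z m).f0 g))).f0 f) := by
  simp only [TwoFunctor.comp_f0, post_f0]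
  exact S.closed .pre _ _ _ (mem0 f) (mem0 g) fun _ => .pre0 _ _

end

/-- A family of 2-functors whose values lie in `S`. -/
@[simps]
def lift {A : TwoCat.{u}} {X Y : ∀ m, (M m).Obj} (P : ∀ m, TwoFunctor A ((M m).Hom (X m) (Y m)))
    (h0 : ∀ a, S.Mem fun m => .c0 ((P m).f0 a)) (h1 : ∀ a, S.Mem fun m => .c1 ((P m).f1 a))
    (h2 : ∀ a, S.Mem fun m => .c2 ((P m).f2 a)) : TwoFunctor A (S.hom X Y) where
  f0 a := mk0 _ (h0 a)
  f1 a := mk1 _ (h1 a)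
  f2 a := mk2 _ (h2 a)
  s1_f1 a := ext0 fun m => by simp [← TwoFunctor.s1_f1]
  t1_f1 a := ext0 fun m => by simp [← TwoFunctor.t1_f1]
  s2_f2 a := ext1 fun m => by simp [← TwoFunctor.s2_f2]
  t2_f2 a := ext1 fun m => by simp [← TwoFunctor.t2_f2]
  map_id1 a := ext1 fun m => by simp
  map_id2 a := ext2 fun m => by simp
  map_comp1 a b h := ext1 fun m => by simp
  map_vcomp a b h := ext2 fun m => by simp
  map_hcomp a b h := ext2 fun m => by simp

/-- Composition of cells between given objects. -/
@[simps fst snd inter]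
def cubical (X Y Z : ∀ m, (M m).Obj) : CubicalFunctor (S.hom X Y) (S.hom Y Z) (S.hom X Z) where
  fst g := S.lift (fun m => (S.proj X Y m).comp ((M m).post ((S.proj Y Z m).f0 g)))
    (mem_post0 g)
    (fun f => S.closed .post _ _ _ (mem0 g) (mem1 f) fun _ => .post1 _ _)
    (fun f => S.closed .post _ _ _ (mem0 g) (mem2 f) fun _ => .post2 _ _)
  snd g := S.lift (fun m => (S.proj Y Z m).comp ((M m).pre ((S.proj X Y m).f0 g)))
    (fun f => S.closed .pre _ _ _ (mem0 g) (mem0 f) fun _ => .pre0 _ _)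
    (fun f => S.closed .pre _ _ _ (mem0 g) (mem1 f) fun _ => .pre1 _ _)
    (fun f => S.closed .pre _ _ _ (mem0 g) (mem2 f) fun _ => .pre2 _ _)
  fst_f0 f g := ext0 fun m => by simp [CubicalFunctor.fst_f0]
  inter a b := mk2 (fun m => (M m).inter ((S.proj X Y m).f1 a) ((S.proj Y Z m).f1 b))
    (S.closed .inter _ _ _ (mem1 a) (mem1 b) fun _ => .inter _ _)
  s2_inter a b := ext1 fun m => by
    simp [← TwoFunctor.s2_f2, ← TwoFunctor.s1_f1, ← TwoFunctor.t1_f1, CubicalFunctor.s2_inter]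
  t2_inter a b := ext1 fun m => by
    simp [← TwoFunctor.t2_f2, ← TwoFunctor.s1_f1, ← TwoFunctor.t1_f1, CubicalFunctor.t2_inter]
  inter_iso a b := isIso2_of_proj fun m => by simp [CubicalFunctor.inter_iso]
  id1_inter x b := ext2 fun m => by simp [CubicalFunctor.id1_inter]
  inter_id1 a y := ext2 fun m => by simp [CubicalFunctor.inter_id1]
  comp1_inter a a' b h h₁ h₂ h₃ := ext2 fun m => by
    simp only [TwoFunctor.map_vcomp, TwoFunctor.map_hcomp, TwoFunctor.map_id2, proj_mk2, proj_mk1,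
      TwoFunctor.map_comp1, lift_f1, TwoFunctor.comp_f1,
      ← TwoFunctor.s1_f1, ← TwoFunctor.t1_f1]
    apply CubicalFunctor.comp1_inter
  inter_comp1 a b b' h h₁ h₂ h₃ := ext2 fun m => by
    simp only [TwoFunctor.map_vcomp, TwoFunctor.map_hcomp, TwoFunctor.map_id2, proj_mk2, proj_mk1,
      TwoFunctor.map_comp1, lift_f1, TwoFunctor.comp_f1,
      ← TwoFunctor.s1_f1, ← TwoFunctor.t1_f1]
    apply CubicalFunctor.inter_comp1
  fst_inter p b h₁ h₂ h₃ h₄ := ext2 fun m => by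
    simp only [TwoFunctor.map_vcomp, TwoFunctor.map_hcomp, TwoFunctor.map_id2, proj_mk2, proj_mk1,
      lift_f1, lift_f2, TwoFunctor.comp_f1,
      TwoFunctor.comp_f2, ← TwoFunctor.s1_f1, ← TwoFunctor.t1_f1, ← TwoFunctor.s2_f2,
      ← TwoFunctor.t2_f2]
    apply CubicalFunctor.fst_inter
  snd_inter a q h₁ h₂ h₃ h₄ := ext2 fun m => by
    simp only [TwoFunctor.map_vcomp, TwoFunctor.map_hcomp, TwoFunctor.map_id2, proj_mk2, proj_mk1,
      lift_f1, lift_f2, TwoFunctor.comp_f1,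
      TwoFunctor.comp_f2, ← TwoFunctor.s1_f1, ← TwoFunctor.t1_f1, ← TwoFunctor.s2_f2,
      ← TwoFunctor.t2_f2]
    apply CubicalFunctor.snd_inter

/-- The Gray-category formed by the given cells. -/
def toGrayCat : GrayCat.{u} where
  Obj := SmallPi fun X : ∀ m, (M m).Obj => S.Mem fun m => .obj (X m)
  Hom X Y := S.hom X.val Y.val
  one X := mk0 (fun m => (M m).one (X.val m)) (S.closed .one _ _ _ X.prop X.prop fun _ => .one _ _)
  comp X Y Z := S.cubical X.val Y.val Z.val
  snd_one X Y := TwoFunctor.ext (funext fun _ => ext0 fun m => by simp [one_cmp])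
    (funext fun _ => ext1 fun m => by simp [pre_one_f1])
    (funext fun _ => ext2 fun m => by simp [pre_one_f2])
  fst_one X Y := TwoFunctor.ext (funext fun _ => ext0 fun m => by simp [post_f0, cmp_one])
    (funext fun _ => ext1 fun m => by simp [post_one_f1])
    (funext fun _ => ext2 fun m => by simp [post_one_f2])
  fst_fst g h := TwoFunctor.ext (funext fun _ => ext0 fun m => by simp [post_f0, cmp_assoc])
    (funext fun _ => ext1 fun m => by simp [post_post_f1, post_f0])
    (funext fun _ => ext2 fun m => by simp [post_post_f2, post_f0])
  snd_fst f h := TwoFunctor.ext (funext fun _ => ext0 fun m => by simp [post_f0, cmp_assoc])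
    (funext fun _ => ext1 fun m => by simp [post_pre_f1])
    (funext fun _ => ext2 fun m => by simp [post_pre_f2])
  snd_snd f g := TwoFunctor.ext (funext fun _ => ext0 fun m => by simp [cmp_assoc])
    (funext fun _ => ext1 fun m => by simp [pre_pre_f1])
    (funext fun _ => ext2 fun m => by simp [pre_pre_f2])
  fst_inter α β h := ext2 fun m => by simp [GrayCat.fst_inter]
  inter_assoc α g γ := ext2 fun m => by simp [GrayCat.inter_assoc]
  snd_inter f β γ := ext2 fun m => by simp [GrayCat.snd_inter]

end SubProduct

end GrayCat

end

/-! ### Projections, maps into sub-Gray-categories, and generation. -/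

noncomputable section

namespace GrayCat

namespace SubProduct

variable {ι : Type*} {M : ι → GrayCat.{u}} (S : SubProduct M)

/-- The projections. -/
def π (m : ι) : S.toGrayCat ⟶ M m where
  obj X := SmallPi.val X m
  hom _ _ := S.proj _ _ m
  map_one _ := proj_mk0 _ _ m
  map_post _ := TwoFunctor.ext (funext fun _ => proj_mk0 _ _ m) (funext fun _ => proj_mk1 _ _ m)
    (funext fun _ => proj_mk2 _ _ m)
  map_pre _ := TwoFunctor.ext (funext fun _ => proj_mk0 _ _ m) (funext fun _ => proj_mk1 _ _ m)
    (funext fun _ => proj_mk2 _ _ m)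
  map_inter _ _ := proj_mk2 _ _ m

variable {S}

theorem mem_cell (c : S.toGrayCat.Cell) : S.Mem fun m => (S.π m).cell c := by
  cases c with
  | obj X => exact SmallPi.prop X
  | c0 f => exact mem0 f
  | c1 f => exact mem1 f
  | c2 f => exact mem2 f

theorem exists_obj (X : ∀ m, (M m).Obj) (h : S.Mem fun m => .obj (X m)) :
    ∃ x : S.toGrayCat.Obj, (fun m => (S.π m).obj x) = X :=
  ⟨SmallPi.mk X h, funext fun m => SmallPi.val_mk _ _ m⟩

variable {x y : S.toGrayCat.Obj}

theorem exists_c0 (f : ∀ m, ((M m).Hom ((S.π m).obj x) ((S.π m).obj y)).C0)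
    (h : S.Mem fun m => .c0 (f m)) :
    ∃ f' : (S.toGrayCat.Hom x y).C0, (fun m => ((S.π m).hom x y).f0 f') = f :=
  ⟨mk0 f h, funext fun m => proj_mk0 _ _ m⟩

theorem exists_c1 (f : ∀ m, ((M m).Hom ((S.π m).obj x) ((S.π m).obj y)).C1)
    (h : S.Mem fun m => .c1 (f m)) :
    ∃ f' : (S.toGrayCat.Hom x y).C1, (fun m => ((S.π m).hom x y).f1 f') = f :=
  ⟨mk1 f h, funext fun m => proj_mk1 _ _ m⟩

theorem exists_c2 (f : ∀ m, ((M m).Hom ((S.π m).obj x) ((S.π m).obj y)).C2)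
    (h : S.Mem fun m => .c2 (f m)) :
    ∃ f' : (S.toGrayCat.Hom x y).C2, (fun m => ((S.π m).hom x y).f2 f') = f :=
  ⟨mk2 f h, funext fun m => proj_mk2 _ _ m⟩

theorem obj_ext (h : ∀ m, (S.π m).obj x = (S.π m).obj y) : x = y := SmallPi.ext h

theorem c0_ext {f g : (S.toGrayCat.Hom x y).C0}
    (h : ∀ m, ((S.π m).hom x y).f0 f = ((S.π m).hom x y).f0 g) : f = g := SmallPi.ext h

theorem c1_ext {f g : (S.toGrayCat.Hom x y).C1}
    (h : ∀ m, ((S.π m).hom x y).f1 f = ((S.π m).hom x y).f1 g) : f = g := SmallPi.ext h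

theorem c2_ext {f g : (S.toGrayCat.Hom x y).C2}
    (h : ∀ m, ((S.π m).hom x y).f2 f = ((S.π m).hom x y).f2 g) : f = g := SmallPi.ext h

theorem exists_twoFunctor {A : TwoCat.{u}}
    (P : ∀ m, TwoFunctor A ((M m).Hom ((S.π m).obj x) ((S.π m).obj y)))
    (h0 : ∀ a, S.Mem fun m => .c0 ((P m).f0 a)) (h1 : ∀ a, S.Mem fun m => .c1 ((P m).f1 a))
    (h2 : ∀ a, S.Mem fun m => .c2 ((P m).f2 a)) :
    ∃ Q : TwoFunctor A (S.toGrayCat.Hom x y), ∀ m, Q.comp ((S.π m).hom x y) = P m :=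
  ⟨S.lift P h0 h1 h2, fun m => TwoFunctor.ext (funext fun _ => proj_mk0 _ _ m)
    (funext fun _ => proj_mk1 _ _ m) (funext fun _ => proj_mk2 _ _ m)⟩

theorem twoFunctor_ext {A : TwoCat.{u}} {P Q : TwoFunctor A (S.toGrayCat.Hom x y)}
    (h : ∀ m, P.comp ((S.π m).hom x y) = Q.comp ((S.π m).hom x y)) : P = Q :=
  TwoFunctor.ext
    (funext fun a => c0_ext fun m => congrArg (fun P => P.f0 a) (h m))
    (funext fun a => c1_ext fun m => congrArg (fun P => P.f1 a) (h m))
    (funext fun a => c2_ext fun m => congrArg (fun P => P.f2 a) (h m))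

theorem isIso2_of_π {a : (S.toGrayCat.Hom x y).C2}
    (h : ∀ m, ((M m).Hom _ _).IsIso2 (((S.π m).hom x y).f2 a)) : (S.toGrayCat.Hom x y).IsIso2 a :=
  isIso2_of_proj h

theorem hom_ext {L : GrayCat.{u}} {F G : L ⟶ S.toGrayCat} (h : ∀ m, F ≫ S.π m = G ≫ S.π m) :
    F = G := by
  have h0 : F.obj = G.obj := funext fun X => obj_ext fun m =>
    congrFun (congrArg GrayFunctor.obj (h m)) X
  obtain ⟨o, f, _, _, _, _⟩ := F
  obtain ⟨o', g, _, _, _, _⟩ := G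
  obtain rfl : o = o' := h0
  obtain rfl : f = g := funext fun X => funext fun Y => twoFunctor_ext fun m =>
    congrFun (congrFun (eq_of_heq (GrayFunctor.ext_iff.1 (h m)).2) X) Y
  rfl

theorem exists_lift {L : GrayCat.{u}} (F : ∀ m, L ⟶ M m)
    (h : ∀ c, S.Mem fun m => (F m).cell c) : ∃ G : L ⟶ S.toGrayCat, ∀ m, G ≫ S.π m = F m := by
  choose obj hobj using fun X : L.Obj => exists_obj (fun m => (F m).obj X) (h (.obj X))
  -- The chosen objects have the right components only up to a propositional equality on which the
  -- types of all other data depend. Unbundling the functors allows this equality to be eliminated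
  -- by substitution. The same device recurs in later lifting lemmas.
  have key : ∀ (o : ∀ m, L.Obj → (M m).Obj)
      (hom : ∀ m X Y, TwoFunctor (L.Hom X Y) ((M m).Hom (o m X) (o m Y)))
      (h₁ : ∀ m X, (hom m X X).f0 (L.one X) = (M m).one (o m X))
      (h₂ : ∀ m {X Y Z} (g : (L.Hom Y Z).C0), (L.post (X := X) g).comp (hom m X Z) =
        (hom m X Y).comp ((M m).post ((hom m Y Z).f0 g)))
      (h₃ : ∀ m {X Y Z} (f : (L.Hom X Y).C0), (L.pre (Z := Z) f).comp (hom m X Z) =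
        (hom m Y Z).comp ((M m).pre ((hom m X Y).f0 f)))
      (h₄ : ∀ m {X Y Z} (α : (L.Hom X Y).C1) (β : (L.Hom Y Z).C1),
        (hom m X Z).f2 (L.inter α β) = (M m).inter ((hom m X Y).f1 α) ((hom m Y Z).f1 β))
      (_ : (∀ X, (fun m => (S.π m).obj (obj X)) = fun m => o m X))
      (_ : ∀ X Y (f : (L.Hom X Y).C0), S.Mem fun m => .c0 ((hom m X Y).f0 f))
      (_ : ∀ X Y (f : (L.Hom X Y).C1), S.Mem fun m => .c1 ((hom m X Y).f1 f))
      (_ : ∀ X Y (f : (L.Hom X Y).C2), S.Mem fun m => .c2 ((hom m X Y).f2 f)),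
      ∃ G : L ⟶ S.toGrayCat, ∀ m, G ≫ S.π m = ⟨o m, hom m, h₁ m, h₂ m, h₃ m, h₄ m⟩ := by
    intro o hom h₁ h₂ h₃ h₄ ho m0 m1 m2
    obtain rfl : (fun m X => (S.π m).obj (obj X)) = o :=
      funext fun m => funext fun X => congrFun (ho X) m
    choose k hk using fun X Y => exists_twoFunctor (fun m => hom m X Y) (m0 X Y) (m1 X Y) (m2 X Y)
    obtain rfl : (fun m X Y => (k X Y).comp ((S.π m).hom _ _)) = hom :=
      funext fun m => funext fun X => funext fun Y => hk X Y m
    exact ⟨⟨obj, k, fun X => c0_ext fun m => (h₁ m X).trans ((S.π m).map_one _).symm,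
      fun {X Y Z} g => twoFunctor_ext fun m =>
        (h₂ m g).trans (congrArg (k X Y).comp ((S.π m).map_post _).symm),
      fun {X Y Z} g => twoFunctor_ext fun m =>
        (h₃ m g).trans (congrArg (k Y Z).comp ((S.π m).map_pre _).symm),
      fun α β => c2_ext fun m => (h₄ m α β).trans ((S.π m).map_inter _ _).symm⟩, fun m => rfl⟩
  exact key (fun m => (F m).obj) (fun m => (F m).hom) (fun m => (F m).map_one)
    (fun m => (F m).map_post) (fun m => (F m).map_pre) (fun m => (F m).map_inter) hobj
    (fun X Y f => h (.c0 f)) (fun X Y f => h (.c1 f)) (fun X Y f => h (.c2 f))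

section Generated

variable (M) {K : Type u} {Ar : K → Type u} (E : ∀ m k, (Ar k → (M m).Cell) → (M m).Cell → Prop)

/-- The graphs of the componentwise operations of a product of Gray-categories, and of further
partial operations. -/
def ops : ∀ k : Op.{u} ⊕ K,
    (Sum.elim (fun _ => ULift Bool) Ar k → ∀ m, (M m).Cell) → (∀ m, (M m).Cell) → Prop
  | .inl k, a, z => ∀ m, (M m).Rel k (a ⟨true⟩ m) (a ⟨false⟩ m) (z m)
  | .inr k, a, z => ∀ m, E m k (fun i => a i m) (z m)

/-- The cells of a product generated under the operations and some further partial operations. -/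
def generated (hE : ∀ m k a z z', E m k a z → E m k a z' → z = z') : SubProduct M where
  Mem := Closure (ops M E)
  closed k a b z ha hb h := by
    refine Closure.mk (R := ops M E) (.inl k)
      (fun i : ULift Bool => bif i.down then a else b) z ?_ h
    rintro ⟨_ | _⟩
    exacts [hb, ha]
  small := by
    refine Closure.small _ ?_
    rintro (k | k) a z z' h h'
    · exact funext fun m => (h m).functional (h' m)
    · exact funext fun m => hE _ _ _ _ _ (h m) (h' m)

variable {M E} {hE : ∀ m k a z z', E m k a z → E m k a z' → z = z'}

theorem generated_mem (k : K) (a : Ar k → ∀ m, (M m).Cell) (z : ∀ m, (M m).Cell)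
    (ha : ∀ i, (generated M E hE).Mem (a i)) (h : ∀ m, E m k (fun i => a i m) (z m)) :
    (generated M E hE).Mem z :=
  Closure.mk (R := ops M E) (.inr k) a z ha h

/-- By induction on generation, a Gray-functor between two of the factors that respects the extra
operations carries one component of each generated tuple to the other. All uniqueness statements
about generated sub-Gray-categories come from this. -/
theorem generated_π_comp {m m' : ι} (F : M m ⟶ M m')
    (hF : ∀ k a z, E m k a z → E m' k (fun i => GrayFunctor.cell F (a i)) (GrayFunctor.cell F z)) :
    (generated M E hE).π m ≫ F = (generated M E hE).π m' := by
  have key : ∀ z, (generated M E hE).Mem z → GrayFunctor.cell F (z m) = z m' := by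
    intro z hz
    induction hz with
    | mk k a z _ h ih =>
      cases k with
      | inl k =>
        have := GrayFunctor.rel_cell F (h m)
        rw [show GrayFunctor.cell F (a ⟨true⟩ m) = a ⟨true⟩ m' from ih _,
          show GrayFunctor.cell F (a ⟨false⟩ m) = a ⟨false⟩ m' from ih _] at this
        exact this.functional (h m')
      | inr k =>
        have e : (fun i : Ar k => GrayFunctor.cell F (a i m)) = fun i => a i m' := funext ih
        exact hE _ _ _ _ _ (e ▸ hF k _ _ (h m)) (h m')
  refine GrayFunctor.ext_of_cell fun c => ?_
  rw [GrayFunctor.cell_comp]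
  exact key _ (mem_cell c)

end Generated

end SubProduct

end GrayCat

end

noncomputable section

namespace GrayCat

/-! ### Corepresentability -/

/-- Take the product over all pairs of a Gray-category and a structure in it, and the
sub-Gray-category generated by the tautological tuple of structure cells. Here `κ` lists the cells
that generate a structure, and `lift` says that a family of structures with these cells in a
sub-Gray-category comes from a structure there. -/
theorem exists_corepresentableBy (Φ : GrayCat.{u} ⥤ Type u) {Q : Type u}
    (κ : ∀ A, Φ.obj A → Q → A.Cell)
    (hκ : ∀ {A B : GrayCat.{u}} (F : A ⟶ B) (x : Φ.obj A) (q : Q),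
      κ B (Φ.map F x) q = GrayFunctor.cell F (κ A x q))
    (lift : ∀ {ι : Type (u + 1)} {M : ι → GrayCat.{u}} (S : SubProduct M) (φ : ∀ m, Φ.obj (M m)),
      (∀ q, S.Mem fun m => κ _ (φ m) q) → ∃ s : Φ.obj S.toGrayCat, ∀ m, Φ.map (S.π m) s = φ m) :
    ∃ U : GrayCat.{u}, Nonempty (Φ.CorepresentableBy U) := by
  let M : (Σ A, Φ.obj A) → GrayCat.{u} := Sigma.fst
  let E : ∀ m (_ : Q), (PEmpty.{u + 1} → (M m).Cell) → (M m).Cell → Prop :=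
    fun m q _ z => z = κ _ m.2 q
  let S := SubProduct.generated M E fun m q _ z z' h h' => h.trans h'.symm
  obtain ⟨s, hs⟩ := lift S (fun m => m.2) fun q =>
    SubProduct.generated_mem (E := E) q PEmpty.elim _ (fun i => i.elim) fun m => rfl
  have nat : ∀ {A B : GrayCat.{u}} (a : Φ.obj A) (F : A ⟶ B),
      S.π ⟨A, a⟩ ≫ F = S.π ⟨B, Φ.map F a⟩ := by
    intro A B a F
    refine SubProduct.generated_π_comp (E := E) (m := ⟨A, a⟩) (m' := ⟨B, Φ.map F a⟩) F ?_
    rintro q _ _ rfl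
    exact (hκ F a q).symm
  -- The generated Gray-category with its structure `s` is itself one of the indices. By naturality
  -- its own projection agrees with the identity after every projection, and hence any `F` out of it
  -- is the projection indexed by the image of `s`.
  have h₁ : S.π ⟨S.toGrayCat, s⟩ = 𝟙 _ := SubProduct.hom_ext fun m => by
    rw [nat, Category.id_comp, hs]
  refine ⟨S.toGrayCat, ⟨⟨⟨fun F => Φ.map F s, fun a => S.π ⟨_, a⟩, fun F => ?_, fun a => ?_⟩, ?_⟩⟩⟩
  · exact (nat s F).symm.trans (by rw [h₁, Category.id_comp])
  · exact hs ⟨_, a⟩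
  · intro A B F G
    simp

/-! ### Pullbacks -/

/-- The cells of the pullback of two Gray-functors. -/
def pullbackCells {A B C : GrayCat.{u}} (F : A ⟶ C) (G : B ⟶ C) :
    SubProduct (fun b : Bool => bif b then A else B) where
  Mem z := GrayFunctor.cell F (z true) = GrayFunctor.cell G (z false)
  closed k a b z ha hb h := by
    have h₁ := GrayFunctor.rel_cell F (h true)
    have h₂ := GrayFunctor.rel_cell G (h false)
    rw [ha, hb] at h₁
    exact h₁.functional h₂
  small := inferInstance

instance : Limits.HasPullbacks GrayCat.{u} := by
  refine @Limits.hasPullbacks_of_hasLimit_cospan _ _ fun {A B C F G} => ?_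
  let S := pullbackCells F G
  have w : S.π true ≫ F = S.π false ≫ G := GrayFunctor.ext_of_cell fun c => by
    rw [GrayFunctor.cell_comp, GrayFunctor.cell_comp]
    exact SubProduct.mem_cell c
  have key : ∀ s : Limits.PullbackCone F G, ∃ l : s.pt ⟶ S.toGrayCat,
      ∀ b : Bool, l ≫ S.π b = match b with | true => s.fst | false => s.snd := fun s =>
    SubProduct.exists_lift (M := fun b : Bool => bif b then A else B)
      (fun b : Bool => match b with | true => s.fst | false => s.snd) fun c => by
        have := congrArg (fun P => GrayFunctor.cell P c) s.condition
        simp only [GrayFunctor.cell_comp] at this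
        exact this
  choose l hl using key
  exact ⟨⟨⟨Limits.PullbackCone.mk (S.π true) (S.π false) w,
    Limits.PullbackCone.IsLimit.mk _ l (fun s => hl s true) (fun s => hl s false)
      fun s m h₁ h₂ => SubProduct.hom_ext fun b => by
        rw [hl]
        cases b
        exacts [h₂, h₁]⟩⟩⟩

/-! ### Factorizations -/

section Factorization

variable {T : Type u} {K L : T → GrayCat.{u}} (j : ∀ t, K t ⟶ L t) {A B : GrayCat.{u}} (F : A ⟶ B)

/-- A factorization of `F`, with chosen liftings of the maps `j t` against its second part. -/
structure LiftFactorization where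
  X : GrayCat.{u}
  i : A ⟶ X
  p : X ⟶ B
  fac : i ≫ p = F
  d : ∀ t (k : K t ⟶ X) (l : L t ⟶ B), k ≫ p = j t ≫ l → (L t ⟶ X)
  d_left : ∀ t k l h, j t ≫ d t k l h = k
  d_right : ∀ t k l h, d t k l h ≫ p = l

/-- Names for the operations generating the initial `LiftFactorization`. -/
inductive LiftOp : Type u
  | base (a : A.Cell)
  | lift (t : T) (l : L t ⟶ B) (c : (L t).Cell)

/-- The arities of the operations. -/
def LiftOp.Arity {K : T → GrayCat.{u}} : LiftOp (L := L) (A := A) (B := B) → Type u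
  | base _ => PEmpty
  | lift t _ _ => (K t).Cell

variable {j F}

/-- The graphs of the operations. -/
def LiftFactorization.Graph (m : LiftFactorization j F) :
    ∀ k : LiftOp (L := L) (A := A) (B := B), (k.Arity (K := K) → m.X.Cell) → m.X.Cell → Prop
  | .base a, _, z => z = GrayFunctor.cell m.i a
  | .lift t l c, b, z => ∃ (k : K t ⟶ m.X) (h : k ≫ m.p = j t ≫ l),
      (∀ x, b x = GrayFunctor.cell k x) ∧ z = GrayFunctor.cell (m.d t k l h) c

theorem LiftFactorization.Graph.functional (m : LiftFactorization j F) (k b) (z z' : m.X.Cell)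
    (h : m.Graph k b z) (h' : m.Graph k b z') : z = z' := by
  cases k with
  | base a => exact h.trans h'.symm
  | lift t l c =>
    obtain ⟨k, h, hb, rfl⟩ := h
    obtain ⟨k', h', hb', rfl⟩ := h'
    obtain rfl : k = k' := GrayFunctor.ext_of_cell fun x => (hb x).symm.trans (hb' x)
    rfl

/-- Morphisms of factorizations with chosen liftings. -/
structure LiftFactorization.IsHom {m m' : LiftFactorization j F} (f : m.X ⟶ m'.X) : Prop where
  i_comp : m.i ≫ f = m'.i
  comp_p : f ≫ m'.p = m.p
  d_comp : ∀ t k l h h', m.d t k l h ≫ f = m'.d t (k ≫ f) l h'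

theorem LiftFactorization.IsHom.graph {m m' : LiftFactorization j F} {f : m.X ⟶ m'.X}
    (hf : IsHom f) (k b z) (h : m.Graph k b z) :
    m'.Graph k (fun x => GrayFunctor.cell f (b x)) (GrayFunctor.cell f z) := by
  cases k with
  | base a =>
    obtain rfl : z = _ := h
    exact (GrayFunctor.cell_comp m.i f a).symm.trans (by rw [hf.i_comp])
  | lift t l c =>
    obtain ⟨k, h, hb, rfl⟩ := h
    have h' : (k ≫ f) ≫ m'.p = j t ≫ l := by rw [Category.assoc, hf.comp_p, h]
    refine ⟨k ≫ f, h', fun x => ?_, ?_⟩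
    · exact (congrArg _ (hb x)).trans (GrayFunctor.cell_comp k f _).symm
    · rw [← GrayFunctor.cell_comp, hf.d_comp _ _ _ _ h']

/-- The initial object is generated inside the product of all factorizations with chosen liftings.
Its operations insert the cells of `A` and, for each bottom map and each cell `c` of `L t`, send the
family of images of the cells of `K t` to the image of `c` under the chosen diagonal; the arities
are small because `K t` is. -/
theorem LiftFactorization.exists_initial (j : ∀ t, K t ⟶ L t) (F : A ⟶ B) :
    ∃ (m : LiftFactorization j F) (r : ∀ m' : LiftFactorization j F, m.X ⟶ m'.X),
      (∀ m', IsHom (r m')) ∧ (∀ (m' : LiftFactorization j F) (f : m.X ⟶ m'.X), IsHom f → f = r m') := by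
  let M : LiftFactorization j F → GrayCat.{u} := LiftFactorization.X
  let E : ∀ m (k : LiftOp (L := L) (A := A) (B := B)), (k.Arity (K := K) → (M m).Cell) →
      (M m).Cell → Prop := fun m => m.Graph
  let S := SubProduct.generated M E Graph.functional
  have nat : ∀ {m m' : LiftFactorization j F} (f : m.X ⟶ m'.X), IsHom f → S.π m ≫ f = S.π m' :=
    fun f hf => SubProduct.generated_π_comp (E := E) f hf.graph
  -- The trivial factorization through `B` is among the indices, and its projection supplies the map
  -- from the generated Gray-category to `B`.
  let m₀ : LiftFactorization j F := ⟨B, F, 𝟙 B, Category.comp_id F, fun _ _ l _ => l,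
    fun _ _ _ h => h.symm.trans (Category.comp_id _), fun _ _ _ _ => Category.comp_id _⟩
  have hp : ∀ m, S.π m ≫ m.p = S.π m₀ := fun m => nat (m' := m₀) m.p
    ⟨m.fac, Category.comp_id _, fun t k l h _ => m.d_right t k l h⟩
  obtain ⟨i, hi⟩ := SubProduct.exists_lift (S := S) (fun m => m.i) fun a =>
    SubProduct.generated_mem (E := E) (.base a) PEmpty.elim _ (fun x => x.elim) fun m => rfl
  have hS : ∀ {t} {k : K t ⟶ S.toGrayCat} {l : L t ⟶ B}, k ≫ S.π m₀ = j t ≫ l →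
      ∀ m : LiftFactorization j F, (k ≫ S.π m) ≫ m.p = j t ≫ l := fun h m => by
    rw [Category.assoc, hp, h]
  have hd : ∀ t (k : K t ⟶ S.toGrayCat) (l : L t ⟶ B) (h : k ≫ S.π m₀ = j t ≫ l),
      ∃ d : L t ⟶ S.toGrayCat, ∀ m, d ≫ S.π m = m.d t (k ≫ S.π m) l (hS h m) := fun t k l h =>
    SubProduct.exists_lift _ fun c =>
      SubProduct.generated_mem (E := E) (.lift t l c)
        (fun x m => GrayFunctor.cell (S.π m) (GrayFunctor.cell k x)) _
        (fun x => SubProduct.mem_cell _)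
        fun m => ⟨_, hS h m, fun x => (GrayFunctor.cell_comp _ _ _).symm, rfl⟩
  choose d hd using hd
  let m : LiftFactorization j F := ⟨S.toGrayCat, i, S.π m₀, hi m₀, d,
    fun t k l h => SubProduct.hom_ext fun m => by rw [Category.assoc, hd, m.d_left],
    fun t k l h => hd t k l h m₀⟩
  have hr : ∀ m', IsHom (m := m) (m' := m') (S.π m') := fun m' =>
    ⟨hi m', hp m', fun t k l h _ => hd t k l h m'⟩
  have h₁ : S.π m = 𝟙 _ := SubProduct.hom_ext fun m' => by
    rw [Category.id_comp]
    exact nat (m := m) (S.π m') (hr m')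
  refine ⟨m, S.π, hr, fun m' f hf => ?_⟩
  have := nat (m := m) f hf
  rwa [h₁, Category.id_comp] at this

theorem LiftFactorization.rlp_p (m : LiftFactorization j F) : (MorphismProperty.ofHoms j).rlp m.p := by
  rintro _ _ _ ⟨t⟩
  exact ⟨fun {k l} sq => ⟨⟨⟨m.d t k l sq.w, m.d_left t k l _, m.d_right t k l _⟩⟩⟩⟩

/-- In the initial factorization the second part has chosen liftings by construction. To lift the
first part against `G`, pull `G` back to the middle object: the pullback is again a factorization
with chosen liftings, and initiality yields a section of its projection. -/
theorem hasFactorization (j : ∀ t, K t ⟶ L t) :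
    MorphismProperty.HasFactorization (MorphismProperty.ofHoms j).rlp.llp
      (MorphismProperty.ofHoms j).rlp := by
  refine ⟨fun {A B} F => ?_⟩
  obtain ⟨m, r, hr, hr'⟩ := LiftFactorization.exists_initial j F
  refine ⟨⟨m.X, m.i, m.p, m.fac, fun C D G hG => ⟨fun {f g} sq => ?_⟩, m.rlp_p⟩⟩
  have h := (MorphismProperty.ofHoms j).rlp.of_isPullback (IsPullback.of_hasPullback G g) hG
  have : ∀ t, HasLiftingProperty (j t) (Limits.pullback.snd G g) := fun t => h _ ⟨t⟩
  have w : ∀ {t} {k : K t ⟶ Limits.pullback G g} {l : L t ⟶ B}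
      (h : k ≫ Limits.pullback.snd G g ≫ m.p = j t ≫ l),
      CommSq k (j t) (Limits.pullback.snd G g)
        (m.d t (k ≫ Limits.pullback.snd G g) l (by rw [Category.assoc, h])) := fun h =>
    ⟨(m.d_left _ _ _ _).symm⟩
  -- Diagonals are found in two stages, by the chosen lifting of `m` and then by some lifting
  -- against the pullback of `G`. This makes the projection to `m.X` preserve the chosen liftings.
  let n : LiftFactorization j F :=
    { X := Limits.pullback G g
      i := Limits.pullback.lift f m.i sq.w
      p := Limits.pullback.snd G g ≫ m.p
      fac := by rw [Limits.pullback.lift_snd_assoc, m.fac]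
      d := fun t k l h => (w h).lift
      d_left := fun t k l h => (w h).fac_left
      d_right := fun t k l h => by rw [(w h).fac_right_assoc, m.d_right] }
  have hn : LiftFactorization.IsHom (m := n) (m' := m) (Limits.pullback.snd G g) :=
    ⟨Limits.pullback.lift_snd _ _ _, rfl, fun t k l h _ => (w h).fac_right⟩
  -- Both sides are endomorphisms of the initial factorization.
  have e : r n ≫ Limits.pullback.snd G g = 𝟙 _ := by
    rw [hr' m (𝟙 _) ⟨Category.comp_id _, Category.id_comp _, fun t k l h h' => by simp⟩]
    refine hr' m _ ⟨?_, ?_, fun t k l h h' => ?_⟩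
    · rw [← Category.assoc, (hr n).i_comp, hn.i_comp]
    · rw [Category.assoc, hn.comp_p, (hr n).comp_p]
    · have h₁ : (k ≫ r n) ≫ n.p = j t ≫ l := by rw [Category.assoc, (hr n).comp_p, h]
      rw [← Category.assoc, (hr n).d_comp _ _ _ _ h₁]
      simp only [← Category.assoc] at h' ⊢
      exact hn.d_comp _ _ _ _ h'
  refine ⟨⟨⟨r n ≫ Limits.pullback.fst G g, ?_, ?_⟩⟩⟩
  · rw [← Category.assoc, (hr n).i_comp]
    exact Limits.pullback.lift_fst _ _ _
  · rw [Category.assoc, Limits.pullback.condition, ← Category.assoc, e, Category.id_comp]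

theorem isWeakFactorizationSystem (J : MorphismProperty GrayCat.{u})
    [MorphismProperty.IsSmall.{u} J] : MorphismProperty.IsWeakFactorizationSystem J.rlp.llp J.rlp := by
  obtain ⟨T, K, L, j, rfl⟩ := (MorphismProperty.isSmall_iff_eq_ofHoms.{u} J).1 inferInstance
  exact ⟨MorphismProperty.rlp_llp_rlp _, rfl, hasFactorization j⟩

end Factorization

end GrayCat

end

noncomputable section

namespace GrayCat

/-! ### Lifting structures to a closed collection of cells -/

/-- Names for the cells of an adjoint equivalence. -/
inductive AdjEquivName : Type u
  | l | r | unit | counit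

/-- The cells of an adjoint equivalence. -/
def adjEquivCell {A : GrayCat.{u}} {X Y : A.Obj} (e : (A.Hom X Y).AdjEquiv) :
    AdjEquivName.{u} → A.Cell
  | .l => .c1 e.l
  | .r => .c1 e.r
  | .unit => .c2 e.unit
  | .counit => .c2 e.counit

namespace SubProduct

variable {ι : Type*} {M : ι → GrayCat.{u}} {S : SubProduct M} {x y : S.toGrayCat.Obj}

theorem exists_adjEquiv (e : ∀ m, ((M m).Hom ((S.π m).obj x) ((S.π m).obj y)).AdjEquiv)
    (h : ∀ q, S.Mem fun m => adjEquivCell (e m) q) :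
    ∃ e' : (S.toGrayCat.Hom x y).AdjEquiv, (fun m => ((S.π m).hom x y).mapAdjEquiv e') = e := by
  obtain ⟨l, hl⟩ := exists_c1 (fun m => (e m).l) (h .l)
  obtain ⟨r, hr⟩ := exists_c1 (fun m => (e m).r) (h .r)
  obtain ⟨p, hp⟩ := exists_c2 (fun m => (e m).unit) (h .unit)
  obtain ⟨q, hq⟩ := exists_c2 (fun m => (e m).counit) (h .counit)
  replace hl := congrFun hl
  replace hr := congrFun hr
  replace hp := congrFun hp
  replace hq := congrFun hq
  have t_l : (S.toGrayCat.Hom x y).t1 l = (S.toGrayCat.Hom x y).s1 r := c0_ext fun m => by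
    simp only [← TwoFunctor.t1_f1, ← TwoFunctor.s1_f1, hl, hr, (e m).t_l]
  have t_r : (S.toGrayCat.Hom x y).t1 r = (S.toGrayCat.Hom x y).s1 l := c0_ext fun m => by
    simp only [← TwoFunctor.t1_f1, ← TwoFunctor.s1_f1, hl, hr, (e m).t_r]
  refine ⟨⟨l, r, t_l, t_r, p, q,
    c1_ext fun m => by
      simp only [← TwoFunctor.s2_f2, TwoFunctor.map_id1, ← TwoFunctor.s1_f1, hl, hp, (e m).s_unit],
    c1_ext fun m => by
      simp only [← TwoFunctor.t2_f2, TwoFunctor.map_comp1, hl, hr, hp, (e m).t_unit],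
    c1_ext fun m => by
      simp only [← TwoFunctor.s2_f2, TwoFunctor.map_comp1, hl, hr, hq, (e m).s_counit],
    c1_ext fun m => by
      simp only [← TwoFunctor.t2_f2, TwoFunctor.map_id1, ← TwoFunctor.s1_f1, hr, hq,
        (e m).t_counit],
    isIso2_of_π fun m => hp m ▸ (e m).unit_iso, isIso2_of_π fun m => hq m ▸ (e m).counit_iso,
    c2_ext fun m => ?_, c2_ext fun m => ?_⟩, funext fun m => TwoCat.AdjEquiv.ext (hl m) (hr m)
      (hp m) (hq m)⟩
  · simp only [TwoFunctor.map_vcomp, TwoFunctor.map_hcomp, TwoFunctor.map_id2, hl, hp, hq,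
      (e m).triangle_l]
  · simp only [TwoFunctor.map_vcomp, TwoFunctor.map_hcomp, TwoFunctor.map_id2, hr, hp, hq,
      (e m).triangle_r]

end SubProduct

/-- Names for the generating cells of an adjoint biequivalence. -/
inductive AdjBiequivName : Type u
  | src | tgt | f | g | η (q : AdjEquivName.{u}) | ε (q : AdjEquivName.{u}) | S

/-- The generating cells of an adjoint biequivalence. -/
def adjBiequivCell {A : GrayCat.{u}} (e : A.AdjBiequiv) : AdjBiequivName.{u} → A.Cell
  | .src => .obj e.src
  | .tgt => .obj e.tgt
  | .f => .c0 e.f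
  | .g => .c0 e.g
  | .η q => adjEquivCell e.η q
  | .ε q => adjEquivCell e.ε q
  | .S => .c2 e.S

/-- `T` is not among the named cells: it is constructed from `S` inside the sub-Gray-category, and
its components are the right ones by uniqueness. -/
theorem SubProduct.exists_adjBiequiv {ι : Type*} {M : ι → GrayCat.{u}} {S : SubProduct M}
    (e : ∀ m, (M m).AdjBiequiv) (h : ∀ q, S.Mem fun m => adjBiequivCell (e m) q) :
    ∃ e' : S.toGrayCat.AdjBiequiv, ∀ m, (S.π m).mapAdjBiequiv e' = e m := by
  obtain ⟨x, hx⟩ := exists_obj (fun m => (e m).src) (h .src)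
  obtain ⟨y, hy⟩ := exists_obj (fun m => (e m).tgt) (h .tgt)
  have key : ∀ (src tgt : ∀ m, (M m).Obj) (f : ∀ m, ((M m).Hom (src m) (tgt m)).C0)
      (g : ∀ m, ((M m).Hom (tgt m) (src m)).C0) (η : ∀ m, ((M m).Hom (src m) (src m)).AdjEquiv)
      (ε : ∀ m, ((M m).Hom (tgt m) (tgt m)).AdjEquiv)
      (s_η : ∀ m, ((M m).Hom (src m) (src m)).s1 (η m).l = (M m).one (src m))
      (t_η : ∀ m, ((M m).Hom (src m) (src m)).t1 (η m).l = (M m).cmp (f m) (g m))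
      (s_ε : ∀ m, ((M m).Hom (tgt m) (tgt m)).s1 (ε m).l = (M m).cmp (g m) (f m))
      (t_ε : ∀ m, ((M m).Hom (tgt m) (tgt m)).t1 (ε m).l = (M m).one (tgt m))
      (R : ∀ m, (⟨src m, tgt m, f m, g m, η m, ε m, s_η m, t_η m, s_ε m, t_ε m⟩ :
        (M m).BiequivCore).SCell)
      (_ : (fun m => (S.π m).obj x) = src) (_ : (fun m => (S.π m).obj y) = tgt)
      (_ : S.Mem fun m => .c0 (f m)) (_ : S.Mem fun m => .c0 (g m))
      (_ : ∀ q, S.Mem fun m => adjEquivCell (η m) q)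
      (_ : ∀ q, S.Mem fun m => adjEquivCell (ε m) q) (_ : S.Mem fun m => .c2 (R m).cell),
      ∃ (c : S.toGrayCat.BiequivCore) (R' : c.SCell), ∀ m, (S.π m).mapCore c =
        ⟨src m, tgt m, f m, g m, η m, ε m, s_η m, t_η m, s_ε m, t_ε m⟩ ∧
        HEq (((S.π m).hom _ _).f2 R'.cell) (R m).cell := by
    rintro _ _ f g η ε s_η t_η s_ε t_ε R rfl rfl hf hg hη hε hR
    obtain ⟨f, rfl⟩ := exists_c0 f hf
    obtain ⟨g, rfl⟩ := exists_c0 g hg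
    obtain ⟨η, rfl⟩ := exists_adjEquiv η hη
    obtain ⟨ε, rfl⟩ := exists_adjEquiv ε hε
    obtain ⟨s, hs⟩ := exists_c2 _ hR
    replace hs := congrFun hs
    refine ⟨⟨x, y, f, g, η, ε,
      c0_ext fun m => (((S.π m).hom _ _).s1_f1 _).symm.trans
        ((s_η m).trans ((S.π m).map_one _).symm),
      c0_ext fun m => (((S.π m).hom _ _).t1_f1 _).symm.trans
        ((t_η m).trans ((S.π m).map_pre_f0 _ _).symm),
      c0_ext fun m => (((S.π m).hom _ _).s1_f1 _).symm.trans
        ((s_ε m).trans ((S.π m).map_pre_f0 _ _).symm),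
      c0_ext fun m => (((S.π m).hom _ _).t1_f1 _).symm.trans
        ((t_ε m).trans ((S.π m).map_one _).symm)⟩,
      ⟨s, c1_ext fun m => ?_, c1_ext fun m => ?_, isIso2_of_π fun m => hs m ▸ (R m).iso⟩,
      fun m => ⟨rfl, heq_of_eq (hs m)⟩⟩
    · rw [← TwoFunctor.s2_f2, hs, (R m).s_cell]
      simp
    · rw [← TwoFunctor.t2_f2, hs, (R m).t_cell]
      simp
  obtain ⟨c, R, hc⟩ := key _ _ _ _ _ _ (fun m => (e m).s_η) (fun m => (e m).t_η)
    (fun m => (e m).s_ε) (fun m => (e m).t_ε) (fun m => (e m).sCell) hx hy (h .f) (h .g)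
    (fun q => h (.η q)) (fun q => h (.ε q)) (h .S)
  exact ⟨AdjBiequiv.equivSCell.symm ⟨c, R⟩, fun m => AdjBiequiv.ext_of_sCell (hc m).1 (hc m).2⟩

theorem adjBiequivCell_map {A B : GrayCat.{u}} (F : A ⟶ B) (e : A.AdjBiequiv)
    (q : AdjBiequivName.{u}) :
    adjBiequivCell (F.mapAdjBiequiv e) q = GrayFunctor.cell F (adjBiequivCell e q) := by
  rcases q with _ | _ | _ | _ | (_ | _) | (_ | _) | _ <;> rfl

theorem exists_adjBiequivFunctor_corepresentableBy :
    ∃ U : GrayCat.{u}, Nonempty (adjBiequivFunctor.{u}.CorepresentableBy U) :=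
  exists_corepresentableBy adjBiequivFunctor.{u} (fun _ e => adjBiequivCell e)
    (fun F e q => adjBiequivCell_map F e q) fun _ e h => SubProduct.exists_adjBiequiv e h

end GrayCat

end

noncomputable section

namespace GrayCat

/-! ### Lifting properties against maps of corepresenting objects -/

/-- By the Yoneda lemma, a square from `p` to `F` is a `Φ`-structure in `B` with a lift of its
`Ψ`-part to `A`, and a diagonal is a compatible lift of the whole structure. -/
theorem hasLiftingProperty_iff {Φ Ψ : GrayCat.{u} ⥤ Type u} {U V : GrayCat.{u}}
    (hU : Φ.CorepresentableBy U) (hV : Ψ.CorepresentableBy V) (α : ∀ A, Φ.obj A → Ψ.obj A)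
    (p : V ⟶ U) (hp : ∀ {A : GrayCat.{u}} (k : U ⟶ A), hV.homEquiv (p ≫ k) = α A (hU.homEquiv k))
    {A B : GrayCat.{u}} (F : A ⟶ B) :
    HasLiftingProperty p F ↔ ∀ (b : Φ.obj B) (a : Ψ.obj A), Ψ.map F a = α B b →
      ∃ a' : Φ.obj A, Φ.map F a' = b ∧ α A a' = a := by
  constructor
  · intro h b a hab
    have sq : CommSq (hV.homEquiv.symm a) p F (hU.homEquiv.symm b) := ⟨hV.homEquiv.injective (by
      rw [hp, hV.homEquiv_comp, Equiv.apply_symm_apply, Equiv.apply_symm_apply, hab])⟩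
    refine ⟨hU.homEquiv sq.lift, ?_, ?_⟩
    · rw [← hU.homEquiv_comp, sq.fac_right, Equiv.apply_symm_apply]
    · rw [← hp, sq.fac_left, Equiv.apply_symm_apply]
  · refine fun h => ⟨fun {f g} sq => ?_⟩
    obtain ⟨a, ha, ha'⟩ := h (hU.homEquiv g) (hV.homEquiv f) (by
      rw [← hV.homEquiv_comp, sq.w, hp])
    refine ⟨⟨⟨hU.homEquiv.symm a, hV.homEquiv.injective ?_, hU.homEquiv.injective ?_⟩⟩⟩
    · rw [hp, Equiv.apply_symm_apply, ha']
    · rw [hU.homEquiv_comp, Equiv.apply_symm_apply, ha]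

theorem exists_hom_of_corepresentableBy {Φ Ψ : GrayCat.{u} ⥤ Type u} {U V : GrayCat.{u}}
    (hU : Φ.CorepresentableBy U) (hV : Ψ.CorepresentableBy V) (α : ∀ A, Φ.obj A → Ψ.obj A)
    (hα : ∀ {A B : GrayCat.{u}} (F : A ⟶ B) a, Ψ.map F (α A a) = α B (Φ.map F a)) :
    ∃ p : V ⟶ U, ∀ {A : GrayCat.{u}} (k : U ⟶ A), hV.homEquiv (p ≫ k) = α A (hU.homEquiv k) :=
  ⟨hV.homEquiv.symm (α U (hU.homEquiv (𝟙 U))), fun k => by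
    rw [hV.homEquiv_comp, Equiv.apply_symm_apply, hα, ← hU.homEquiv_comp, Category.id_comp]⟩

/-! ### The terminal Gray-category -/

/-- The functor sending a Gray-category to its set of objects. -/
def objFunctor : GrayCat.{u} ⥤ Type u where
  obj A := A.Obj
  map F := TypeCat.ofHom F.obj

/-- The Gray-functor from the terminal Gray-category given by an object. -/
def ofObj {A : GrayCat.{u}} (X : A.Obj) : point.{u} ⟶ A where
  obj _ := X
  hom _ _ :=
    { f0 := fun _ => A.one X
      f1 := fun _ => (A.Hom X X).id1 (A.one X)
      f2 := fun _ => (A.Hom X X).id2 ((A.Hom X X).id1 (A.one X))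
      s1_f1 := fun _ => by simp
      t1_f1 := fun _ => by simp
      s2_f2 := fun _ => by simp
      t2_f2 := fun _ => by simp
      map_id1 := fun _ => rfl
      map_id2 := fun _ => rfl
      map_comp1 := fun _ _ _ => by simp
      map_vcomp := fun _ _ _ => by simp
      map_hcomp := fun _ _ _ => by simp }
  map_one _ := rfl
  map_post _ := TwoFunctor.ext (funext fun _ => by simp [post_f0, one_cmp])
    (funext fun _ => by simp [post_one_f1]) (funext fun _ => by simp [post_one_f2])
  map_pre _ := TwoFunctor.ext (funext fun _ => by simp [one_cmp])
    (funext fun _ => by simp [pre_one_f1]) (funext fun _ => by simp [pre_one_f2])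
  map_inter _ _ := by simp [id1_inter, one_cmp]

/-- All cells of the terminal Gray-category above its object are identities, so their images are
forced. -/
theorem ofObj_obj_eq {A : GrayCat.{u}} (F : point.{u} ⟶ A) : ofObj (F.obj ⟨⟩) = F := by
  have h0 : ∀ x, A.one (F.obj ⟨⟩) = (F.hom ⟨⟩ ⟨⟩).f0 x := fun _ => (F.map_one ⟨⟩).symm
  have h1 : ∀ x, (A.Hom _ _).id1 (A.one (F.obj ⟨⟩)) = (F.hom ⟨⟩ ⟨⟩).f1 x := fun x => by
    rw [h0 ⟨⟩]
    exact ((F.hom ⟨⟩ ⟨⟩).map_id1 ⟨⟩).symm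
  have h2 : ∀ x, (A.Hom _ _).id2 ((A.Hom _ _).id1 (A.one (F.obj ⟨⟩))) = (F.hom ⟨⟩ ⟨⟩).f2 x :=
    fun x => by
      rw [h1 ⟨⟩]
      exact ((F.hom ⟨⟩ ⟨⟩).map_id2 ⟨⟩).symm
  exact GrayFunctor.ext rfl (heq_of_eq (funext fun _ => funext fun _ =>
    TwoFunctor.ext (funext h0) (funext h1) (funext h2)))

/-- Gray-functors out of the terminal Gray-category correspond to objects. -/
def pointCorepresentableBy : objFunctor.{u}.CorepresentableBy point.{u} where
  homEquiv := ⟨fun F => F.obj ⟨⟩, ofObj, ofObj_obj_eq, fun _ => rfl⟩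
  homEquiv_comp _ _ := rfl

/-! ### Structures on the hom 2-categories -/

end GrayCat

/-- The category of small 2-categories and 2-functors. -/
instance : Category TwoCat.{u} where
  Hom X Y := TwoFunctor X Y
  id X := TwoFunctor.id X
  comp F G := TwoFunctor.comp F G

namespace TwoCat

/-- The functor sending a 2-category to its set of objects. -/
def c0Functor : TwoCat.{u} ⥤ Type u where
  obj X := X.C0
  map P := TypeCat.ofHom P.f0

/-- The functor sending a 2-category to its set of 1-cells. -/
def c1Functor : TwoCat.{u} ⥤ Type u where
  obj X := X.C1
  map P := TypeCat.ofHom P.f1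

/-- The functor sending a 2-category to its set of adjoint equivalences. -/
def adjEquivFunctor : TwoCat.{u} ⥤ Type u where
  obj X := X.AdjEquiv
  map P := TypeCat.ofHom P.mapAdjEquiv

/-- The functor sending a 2-category to its set of invertible 2-cells. -/
def isoFunctor : TwoCat.{u} ⥤ Type u where
  obj X := {a : X.C2 // X.IsIso2 a}
  map P := TypeCat.ofHom fun a => ⟨P.f2 a.1, P.isIso2 a.2⟩

end TwoCat

namespace TwoFunctor

/-- Structures described by `Φ` can be lifted along `P`, given a lift of the part of the structure
selected by `α`. -/
def Lifts {Φ Ψ : TwoCat.{u} ⥤ Type u} (α : Φ ⟶ Ψ) {X Y : TwoCat.{u}} (P : X ⟶ Y) : Prop :=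
  ∀ (b : Φ.obj Y) (a : Ψ.obj X), Ψ.map P a = α.app Y b →
    ∃ a' : Φ.obj X, Φ.map P a' = b ∧ α.app X a' = a

end TwoFunctor

namespace TwoCat

/-- The codomain of an adjoint equivalence. -/
def adjEquivTgt : adjEquivFunctor.{u} ⟶ c0Functor.{u} where
  app X := TypeCat.ofHom fun e : X.AdjEquiv => X.t1 e.l
  naturality X Y P := by
    ext e
    exact P.t1_f1 _

/-- The codomain of an invertible 2-cell. -/
def isoTgt : isoFunctor.{u} ⟶ c1Functor.{u} where
  app X := TypeCat.ofHom fun a : {a : X.C2 // X.IsIso2 a} => X.t2 a.1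
  naturality X Y P := by
    ext a
    exact P.t2_f2 _

/-- Being an equivalence is a mere existence condition, whereas a generating map must lift specified
structure. Equivalences may be replaced by adjoint equivalences because each extends to one, and
because fibrations lift the whole adjoint equivalence. For invertible 2-cells no extra structure is
needed, inverses being unique. -/
theorem _root_.TwoFunctor.isFibration_iff_lifts {X Y : TwoCat.{u}} (P : X ⟶ Y) :
    TwoFunctor.IsFibration P ↔
      TwoFunctor.Lifts adjEquivTgt P ∧ TwoFunctor.Lifts isoTgt P := by
  constructor
  · refine fun h => ⟨fun e x hx => ?_, fun b f hf => ?_⟩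
    · obtain ⟨l, hl, rfl, hl'⟩ := h.1 x e.l e.isEquivalence hx.symm
      obtain ⟨e', rfl, h'⟩ := h.exists_adjEquiv hl e hl'
      exact ⟨e', h', rfl⟩
    · obtain ⟨a, ha, rfl, hab⟩ := h.2 f b.1 b.2 hf.symm
      exact ⟨⟨a, ha⟩, Subtype.ext hab, rfl⟩
  · refine fun h => ⟨fun x f hf hx => ?_, fun f b hb hf => ?_⟩
    · obtain ⟨e, rfl⟩ := hf.exists_adjEquiv'
      obtain ⟨e', rfl, rfl⟩ := h.1 e x hx.symm
      exact ⟨e'.l, e'.isEquivalence, rfl, rfl⟩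
    · obtain ⟨b', h', rfl⟩ := h.2 ⟨b, hb⟩ f hf.symm
      exact ⟨b'.1, b'.2, rfl, congrArg Subtype.val h'⟩

end TwoCat

namespace GrayCat

/-- The functor sending a Gray-category to the structures described by `Φ` on its homs. -/
def localFunctor (Φ : TwoCat.{u} ⥤ Type u) : GrayCat.{u} ⥤ Type u where
  obj A := Σ X Y : A.Obj, Φ.obj (A.Hom X Y)
  map F := TypeCat.ofHom fun p => ⟨F.obj p.1, F.obj p.2.1, Φ.map (F.hom p.1 p.2.1) p.2.2⟩
  map_id A := ConcreteCategory.hom_ext _ _ fun ⟨X, Y, a⟩ => by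
    exact congrArg (fun b => (⟨X, Y, b⟩ : Σ X Y : A.Obj, Φ.obj (A.Hom X Y)))
      (ConcreteCategory.congr_hom (Φ.map_id (A.Hom X Y)) a)
  map_comp {A B C} F G := ConcreteCategory.hom_ext _ _ fun ⟨X, Y, a⟩ => by
    exact congrArg (fun b => (⟨_, _, b⟩ : Σ X Y : C.Obj, Φ.obj (C.Hom X Y)))
      (ConcreteCategory.congr_hom (Φ.map_comp (F.hom X Y) (G.hom _ _)) a)

theorem exists_localFunctor_corepresentableBy (Φ : TwoCat.{u} ⥤ Type u) {Q : Type u}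
    (κ : ∀ {A : GrayCat.{u}} {X Y : A.Obj}, Φ.obj (A.Hom X Y) → Q → A.Cell)
    (hκ : ∀ {A B : GrayCat.{u}} (F : A ⟶ B) {X Y : A.Obj} (a : Φ.obj (A.Hom X Y)) (q : Q),
      κ (Φ.map (F.hom X Y) a) q = GrayFunctor.cell F (κ a q))
    (lift : ∀ {ι : Type (u + 1)} {M : ι → GrayCat.{u}} {S : SubProduct M} {x y : S.toGrayCat.Obj}
      (a : ∀ m, Φ.obj ((M m).Hom ((S.π m).obj x) ((S.π m).obj y))),
      (∀ q, S.Mem fun m => κ (a m) q) →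
      ∃ a' : Φ.obj (S.toGrayCat.Hom x y), (fun m => Φ.map ((S.π m).hom x y) a') = a) :
    ∃ U : GrayCat.{u}, Nonempty ((localFunctor Φ).CorepresentableBy U) := by
  refine exists_corepresentableBy (localFunctor Φ) (Q := ULift Bool ⊕ Q)
    (fun A p => Sum.elim (fun b => .obj (bif b.down then p.1 else p.2.1)) (κ p.2.2)) ?_ ?_
  · rintro A B F ⟨X, Y, a⟩ (⟨_ | _⟩ | q)
    exacts [rfl, rfl, hκ F a q]
  · intro ι M S φ h
    obtain ⟨x, hx⟩ := SubProduct.exists_obj (fun m => (φ m).1) (h (.inl ⟨true⟩))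
    obtain ⟨y, hy⟩ := SubProduct.exists_obj (fun m => (φ m).2.1) (h (.inl ⟨false⟩))
    have key : ∀ (X Y : ∀ m, (M m).Obj) (a : ∀ m, Φ.obj ((M m).Hom (X m) (Y m)))
        (_ : (fun m => (S.π m).obj x) = X) (_ : (fun m => (S.π m).obj y) = Y)
        (_ : ∀ q, S.Mem fun m => κ (a m) q), ∃ s : (localFunctor Φ).obj S.toGrayCat,
        ∀ m, (localFunctor Φ).map (S.π m) s = ⟨X m, Y m, a m⟩ := by
      rintro _ _ a rfl rfl ha
      obtain ⟨a, rfl⟩ := lift a ha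
      exact ⟨⟨x, y, a⟩, fun m => rfl⟩
    exact key _ _ (fun m => (φ m).2.2) hx hy fun q => h (.inr q)

/-- The transformation `α` induces a map of corepresenting Gray-categories, and lifting against it
is lifting in every hom; matching the `Ψ`-parts forces the lifted structure to lie in the intended
hom. -/
theorem exists_hasLiftingProperty_iff_lifts {Φ Ψ : TwoCat.{u} ⥤ Type u} (α : Φ ⟶ Ψ)
    (hΦ : ∃ U, Nonempty ((localFunctor Φ).CorepresentableBy U))
    (hΨ : ∃ V, Nonempty ((localFunctor Ψ).CorepresentableBy V)) :
    ∃ (V U : GrayCat.{u}) (p : V ⟶ U), ∀ {A B : GrayCat.{u}} (F : A ⟶ B),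
      HasLiftingProperty p F ↔ ∀ X Y, TwoFunctor.Lifts α (F.hom X Y) := by
  obtain ⟨U, ⟨hU⟩⟩ := hΦ
  obtain ⟨V, ⟨hV⟩⟩ := hΨ
  let β : ∀ A, (localFunctor Φ).obj A → (localFunctor Ψ).obj A :=
    fun A a => ⟨a.1, a.2.1, α.app _ a.2.2⟩
  obtain ⟨p, hp⟩ := exists_hom_of_corepresentableBy hU hV β fun {A B} F ⟨X, Y, a⟩ =>
      congrArg (fun b => (⟨_, _, b⟩ : Σ X Y : B.Obj, Ψ.obj (B.Hom X Y)))
        (ConcreteCategory.congr_hom (α.naturality (F.hom X Y)) a).symm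
  refine ⟨V, U, p, fun {A B} F => (hasLiftingProperty_iff hU hV β p hp F).trans ⟨?_, ?_⟩⟩
  · intro h X Y b a hab
    obtain ⟨⟨X', Y', a'⟩, h₁, h₂⟩ := h ⟨F.obj X, F.obj Y, b⟩ ⟨X, Y, a⟩
      (congrArg (fun b => (⟨_, _, b⟩ : Σ X Y : B.Obj, Ψ.obj (B.Hom X Y))) hab)
    obtain rfl : X' = X := congrArg Sigma.fst h₂
    obtain rfl : Y' = Y := congrArg (fun a => a.2.1) h₂
    refine ⟨a', ?_, ?_⟩
    · exact eq_of_heq (Sigma.mk.inj (eq_of_heq (Sigma.mk.inj h₁).2)).2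
    · exact eq_of_heq (Sigma.mk.inj (eq_of_heq (Sigma.mk.inj h₂).2)).2
  · rintro h ⟨X', Y', b⟩ ⟨X, Y, a⟩ hab
    obtain rfl : F.obj X = X' := congrArg Sigma.fst hab
    obtain rfl : F.obj Y = Y' := congrArg (fun a => a.2.1) hab
    obtain ⟨a', h₁, h₂⟩ := h X Y b a (eq_of_heq (Sigma.mk.inj (eq_of_heq (Sigma.mk.inj hab).2)).2)
    exact ⟨⟨X, Y, a'⟩, congrArg (fun b => (⟨_, _, b⟩ : Σ X Y : B.Obj, Φ.obj (B.Hom X Y))) h₁,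
      congrArg (fun b => (⟨_, _, b⟩ : Σ X Y : A.Obj, Ψ.obj (A.Hom X Y))) h₂⟩

theorem exists_isSmall_rlp_eq_isLocallyFibration :
    ∃ I : MorphismProperty GrayCat.{u}, MorphismProperty.IsSmall.{u} I ∧
      I.rlp = GrayFunctor.IsLocallyFibration := by
  obtain ⟨V₁, U₁, p₁, h₁⟩ := exists_hasLiftingProperty_iff_lifts TwoCat.adjEquivTgt.{u}
    (exists_localFunctor_corepresentableBy _ (fun e => adjEquivCell e)
      (by rintro A B F X Y a (_ | _) <;> rfl) SubProduct.exists_adjEquiv)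
    (exists_localFunctor_corepresentableBy _ (Q := PUnit) (fun f _ => .c0 f) (fun _ _ _ _ _ => rfl)
      fun a h => SubProduct.exists_c0 a (h ⟨⟩))
  obtain ⟨V₂, U₂, p₂, h₂⟩ := exists_hasLiftingProperty_iff_lifts TwoCat.isoTgt.{u}
    (exists_localFunctor_corepresentableBy _ (Q := PUnit) (fun a _ => .c2 a.1)
      (fun _ _ _ _ _ => rfl) fun a h => by
        obtain ⟨a', ha⟩ := SubProduct.exists_c2 (fun m => (a m).1) (h ⟨⟩)
        exact ⟨⟨a', SubProduct.isIso2_of_π fun m => by rw [congrFun ha m]; exact (a m).2⟩,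
          funext fun m => Subtype.ext (congrFun ha m)⟩)
    (exists_localFunctor_corepresentableBy _ (Q := PUnit) (fun f _ => .c1 f) (fun _ _ _ _ _ => rfl)
      fun a h => SubProduct.exists_c1 a (h ⟨⟩))
  refine ⟨MorphismProperty.ofHoms (X := fun b : Bool => bif b then V₁ else V₂)
    (Y := fun b : Bool => bif b then U₁ else U₂) fun b => match b with | true => p₁ | false => p₂,
    MorphismProperty.isSmall_ofHoms _, ?_⟩
  ext A B F
  constructor
  · intro h X Y
    exact (TwoFunctor.isFibration_iff_lifts _).2
      ⟨(h₁ F).1 (h _ ⟨true⟩) X Y, (h₂ F).1 (h _ ⟨false⟩) X Y⟩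
  · rintro h _ _ _ ⟨_ | _⟩
    · exact (h₂ F).2 fun X Y => ((TwoFunctor.isFibration_iff_lifts _).1 (h X Y)).2
    · exact (h₁ F).2 fun X Y => ((TwoFunctor.isFibration_iff_lifts _).1 (h X Y)).1

end GrayCat

end

/-! ### Reversing adjoint equivalences, and mates. -/

namespace TwoCat

variable {X : TwoCat.{u}}

theorem inv_inv {a : X.C2} (ha : X.IsIso2 a) : X.inv (X.inv a ha) (isIso2_inv ha) = a :=
  (eq_inv_of_vcomp (isIso2_inv ha) (b := a) (by simp) (by simp)).symm

theorem inv_wl {a : X.C2} (ha : X.IsIso2 a) (f : X.C1) (h) :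
    X.inv (X.wl f a h) (ha.wl f h) = X.wl f (X.inv a ha) (by simpa using h) :=
  (eq_inv_of_vcomp (ha.wl f h) (by simp)
    ((wl_vcomp f a _ (by simp) (by simpa using h)).symm.trans (by simp))).symm

theorem inv_wr {a : X.C2} (ha : X.IsIso2 a) (f : X.C1) (h) :
    X.inv (X.wr a f h) (ha.wr f h) = X.wr (X.inv a ha) f (by simpa using h) :=
  (eq_inv_of_vcomp (ha.wr f h) (by simp)
    ((wr_vcomp a _ f (by simp) (by simpa using h)).symm.trans (by simp))).symm

theorem inv_vcomp_inv {a b : X.C2} (ha : X.IsIso2 a) (hb : X.IsIso2 b) (h)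
    (e : X.vcomp a b h = X.id2 (X.s2 a)) (h') :
    X.vcomp (X.inv b hb) (X.inv a ha) h' = X.id2 (X.s2 a) := by
  obtain rfl := eq_inv_of_vcomp ha h e
  exact (vcomp_congr (inv_inv ha) rfl _).trans (vcomp_inv ha _)

namespace AdjEquiv

/-- The adjoint equivalence with the two adjoints exchanged. -/
@[simps]
noncomputable def symm (e : X.AdjEquiv) : X.AdjEquiv where
  l := e.r
  r := e.l
  t_l := e.t_r
  t_r := e.t_l
  unit := X.inv e.counit e.counit_iso
  counit := X.inv e.unit e.unit_iso
  s_unit := by simp [e.t_counit]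
  t_unit := by simp [e.s_counit]
  s_counit := by simp [e.t_unit]
  t_counit := by simp [e.s_unit]
  unit_iso := isIso2_inv _
  counit_iso := isIso2_inv _
  triangle_l := by
    have h₁ : X.t1 e.r = X.s1 (X.s2 e.unit) := by simp [e.s_unit, e.t_r]
    have h₂ : X.t1 (X.s2 e.counit) = X.s1 e.r := by simp [e.s_counit, e.t_l]
    refine (vcomp_congr (inv_wr e.counit_iso e.r h₂).symm (inv_wl e.unit_iso e.r h₁).symm _).trans
      ((inv_vcomp_inv (e.unit_iso.wl e.r h₁) (e.counit_iso.wr e.r h₂) ?_ ?_ ?_).trans ?_)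
    · simp [e.t_unit, e.s_counit]
    · exact e.triangle_r.trans (by simp [e.s_unit, ← e.t_r])
    · simp [e.t_unit, e.s_counit]
    · simp [e.s_unit, ← e.t_r]
  triangle_r := by
    have h₁ : X.t1 (X.s2 e.unit) = X.s1 e.l := by simp [e.s_unit]
    have h₂ : X.t1 e.l = X.s1 (X.s2 e.counit) := by simp [e.s_counit, e.t_l]
    refine (vcomp_congr (inv_wl e.counit_iso e.l h₂).symm (inv_wr e.unit_iso e.l h₁).symm _).trans
      ((inv_vcomp_inv (e.unit_iso.wr e.l h₁) (e.counit_iso.wl e.l h₂) ?_ ?_ ?_).trans ?_)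
    · simp [e.t_unit, e.s_counit]
    · exact e.triangle_l.trans (by simp [e.s_unit])
    · simp [e.t_unit, e.s_counit]
    · simp [e.s_unit]

theorem symm_symm (e : X.AdjEquiv) : e.symm.symm = e :=
  AdjEquiv.ext rfl rfl (inv_inv _) (inv_inv _)

theorem _root_.TwoFunctor.mapAdjEquiv_symm {Y : TwoCat.{u}} (P : TwoFunctor X Y) (e : X.AdjEquiv) :
    P.mapAdjEquiv e.symm = (P.mapAdjEquiv e).symm :=
  AdjEquiv.ext rfl rfl (P.map_inv _ _) (P.map_inv _ _)

section Mate

variable (P Q : X.AdjEquiv) (h : X.t1 P.l = X.s1 Q.l)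

/-- The isomorphism `Q.r ≫ (P.r ≫ P.l) ≫ Q.l ≅ 1`. -/
def compCounit : X.C2 :=
  X.vcomp (X.wl Q.r (X.wr P.counit Q.l (by simp [P.s_counit, h]))
      (by simp [P.s_counit, Q.t_r, ← h, P.t_l])) Q.counit
    (by simp [P.t_counit, Q.s_counit])

theorem s2_compCounit : X.s2 (compCounit P Q h) = X.comp1 (X.comp1 Q.r P.r
    (by rw [Q.t_r, ← h, P.t_l])) (X.comp1 P.l Q.l h) (by simp [P.t_r]) := by
  simp [compCounit, P.s_counit]

theorem t2_compCounit : X.t2 (compCounit P Q h) = X.id1 (X.t1 Q.l) := by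
  simp [compCounit, Q.t_counit, Q.t_l]

theorem compCounit_iso : X.IsIso2 (compCounit P Q h) :=
  ((P.counit_iso.wr _ _).wl _ _).vcomp Q.counit_iso _

/-- The mate of a 2-cell `1 ⟶ P.l ≫ Q.l`. -/
def mate (T : X.C2) (hT : X.t2 T = X.comp1 P.l Q.l h) : X.C2 :=
  X.vcomp (X.wl (X.comp1 Q.r P.r (by rw [Q.t_r, ← h, P.t_l])) T
    (by rw [← s1_t2, hT, t1_comp1, s1_comp1, P.t_r])) (compCounit P Q h)
    (by simp only [t2_wl, s2_compCounit, hT])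

theorem mate_congr {P P' Q Q' : X.AdjEquiv} (hP : P = P') (hQ : Q = Q') (h h') {T : X.C2}
    (hT hT') : mate P Q h T hT = mate P' Q' h' T hT' := by
  subst hP hQ
  rfl

theorem s2_mate (T : X.C2) (hT) (sT : X.s2 T = X.id1 (X.s1 P.l)) :
    X.s2 (mate P Q h T hT) = X.comp1 Q.r P.r (by rw [Q.t_r, ← h, P.t_l]) := by
  simp [mate, sT, ← P.t_r]

theorem t2_mate (T : X.C2) (hT) : X.t2 (mate P Q h T hT) = X.id1 (X.t1 Q.l) := by
  simp [mate, t2_compCounit]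

theorem mate_iso {T : X.C2} (iT : X.IsIso2 T) (hT) : X.IsIso2 (mate P Q h T hT) :=
  (iT.wl _ _).vcomp (compCounit_iso P Q h) _

/-- Taking mates is whiskering by an equivalence followed by composition with an invertible cell,
both of which can be cancelled; `exists_mate_eq` inverts both. -/
theorem mate_injective {T T' : X.C2} (hT hT') (h' : X.s2 T = X.s2 T')
    (e : mate P Q h T hT = mate P Q h T' hT') : T = T' :=
  (Q.isEquivalence_r.comp1 P.isEquivalence_r _).wl_cancel _ _ h' (hT.trans hT'.symm)
    ((compCounit_iso P Q h).cancel_right _ _ e)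

theorem exists_mate_eq {R : X.C2} (hR : X.IsIso2 R)
    (sR : X.s2 R = X.comp1 Q.r P.r (by rw [Q.t_r, ← h, P.t_l])) (tR : X.t2 R = X.id1 (X.t1 Q.l)) :
    ∃ (T : X.C2) (_ : X.s2 T = X.id1 (X.s1 P.l)) (hT : X.t2 T = X.comp1 P.l Q.l h),
      X.IsIso2 T ∧ mate P Q h T hT = R := by
  have hc := compCounit_iso P Q h
  have hRc : X.t2 R = X.s2 (X.inv _ hc) := by rw [tR, s2_inv, t2_compCounit]
  have hq := Q.isEquivalence_r.comp1 P.isEquivalence_r (by rw [Q.t_r, ← h, P.t_l])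
  obtain ⟨T, sT, tT, e⟩ := hq.exists_wl_eq (c := X.vcomp R (X.inv _ hc) hRc)
    (f := X.id1 (X.s1 P.l)) (g := X.comp1 P.l Q.l h) (by simp [P.t_r]) (by simp [P.t_r])
    (by simp [sR, ← P.t_r]) (by simp only [t2_vcomp, t2_inv, s2_compCounit])
  refine ⟨T, sT, tT, hq.isIso2_of_wl _ (by rw [e]; exact hR.vcomp (isIso2_inv hc) _), ?_⟩
  refine (vcomp_congr e rfl _).trans ((vcomp_vcomp _ _ _ _ _).trans ?_)
  simp only [inv_vcomp, t2_compCounit, ← tR, vcomp_id2]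

theorem _root_.TwoFunctor.map_mate {Y : TwoCat.{u}} (F : TwoFunctor X Y) (T : X.C2) (hT) :
    F.f2 (mate P Q h T hT) = mate (F.mapAdjEquiv P) (F.mapAdjEquiv Q) (by simp [h]) (F.f2 T)
      (by simp [hT]) := by
  simp [mate, compCounit]

end Mate

end AdjEquiv

end TwoCat

noncomputable section

namespace GrayCat

/-! ### Reversing adjoint biequivalences -/

namespace BiequivCore

variable {B : GrayCat.{u}}

/-- Exchanging the two 1-cells. -/
def swap (c : B.BiequivCore) : B.BiequivCore where
  src := c.tgt
  tgt := c.src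
  f := c.g
  g := c.f
  η := c.ε.symm
  ε := c.η.symm
  s_η := by simp [← c.ε.t_l, c.t_ε]
  t_η := by simp [c.ε.t_r, c.s_ε]
  s_ε := by simp [← c.η.t_l, c.t_η]
  t_ε := by simp [c.η.t_r, c.s_η]

theorem swap_swap (c : B.BiequivCore) : c.swap.swap = c := by
  obtain ⟨src, tgt, f, g, η, ε, _, _, _, _⟩ := c
  simp only [swap, TwoCat.AdjEquiv.symm_symm]

section Mate

variable (c : B.BiequivCore)

theorem t1_pre_η : (B.Hom c.tgt c.src).t1 ((B.pre c.g).mapAdjEquiv c.η).l =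
    (B.Hom c.tgt c.src).s1 ((B.post c.g).mapAdjEquiv c.ε).l := by
  simp [c.t_η, c.s_ε, post_f0, cmp_assoc]

theorem s1_pre_η : (B.Hom c.tgt c.src).s1 ((B.pre c.g).mapAdjEquiv c.η).l = c.g := by
  simp [c.s_η, cmp_one]

theorem t1_post_ε : (B.Hom c.tgt c.src).t1 ((B.post c.g).mapAdjEquiv c.ε).l = c.g := by
  simp [c.t_ε, post_f0, one_cmp]

variable {c}

/-- The 3-cell `S` of the reversed adjoint biequivalence. -/
def mateCell (T : c.TCell) : c.swap.SCell where
  cell := TwoCat.AdjEquiv.mate ((B.pre c.g).mapAdjEquiv c.η) ((B.post c.g).mapAdjEquiv c.ε)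
    c.t1_pre_η T.cell T.t_cell
  s_cell := TwoCat.AdjEquiv.s2_mate ((B.pre c.g).mapAdjEquiv c.η) ((B.post c.g).mapAdjEquiv c.ε)
    c.t1_pre_η T.cell T.t_cell (T.s_cell.trans (congrArg _ c.s1_pre_η.symm))
  t_cell := (TwoCat.AdjEquiv.t2_mate ((B.pre c.g).mapAdjEquiv c.η)
    ((B.post c.g).mapAdjEquiv c.ε) c.t1_pre_η T.cell T.t_cell).trans (congrArg _ c.t1_post_ε)
  iso := TwoCat.AdjEquiv.mate_iso _ _ _ T.iso _

variable (c)

theorem mateCell_bijective : Function.Bijective (mateCell : c.TCell → c.swap.SCell) := by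
  refine ⟨fun T T' h => ?_, fun S => ?_⟩
  · exact TCell.ext (TwoCat.AdjEquiv.mate_injective _ _ c.t1_pre_η T.t_cell T'.t_cell
      (T.s_cell.trans T'.s_cell.symm) (congrArg SCell.cell h))
  · obtain ⟨T, sT, tT, iT, h⟩ := TwoCat.AdjEquiv.exists_mate_eq ((B.pre c.g).mapAdjEquiv c.η)
      ((B.post c.g).mapAdjEquiv c.ε) c.t1_pre_η S.iso S.s_cell
      (S.t_cell.trans (congrArg _ c.t1_post_ε.symm))
    exact ⟨⟨T, sT.trans (congrArg _ c.s1_pre_η), tT, iT⟩, SCell.ext h⟩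

end Mate

end BiequivCore

/-- Reversing adjoint biequivalences. -/
def AdjBiequiv.swap (B : GrayCat.{u}) : B.AdjBiequiv ≃ B.AdjBiequiv :=
  -- Only `T` is kept on one side and only `S` on the other, so the tetrahedron equations need not
  -- be compared under reversal: any bijection between the two kinds of 3-cells will do, and mates
  -- provide one that Gray-functors preserve.
  equivTCell.trans ((Equiv.sigmaCongr ⟨BiequivCore.swap, BiequivCore.swap, BiequivCore.swap_swap,
    BiequivCore.swap_swap⟩ fun c => Equiv.ofBijective _ c.mateCell_bijective).trans
      equivSCell.symm)

theorem AdjBiequiv.map_swap {A B : GrayCat.{u}} (F : A ⟶ B) (e : A.AdjBiequiv) :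
    F.mapAdjBiequiv (swap A e) = swap B (F.mapAdjBiequiv e) := by
  refine ext_of_sCell (BiequivCore.ext rfl rfl HEq.rfl HEq.rfl
    (heq_of_eq (TwoFunctor.mapAdjEquiv_symm _ e.ε))
    (heq_of_eq (TwoFunctor.mapAdjEquiv_symm _ e.η))) (heq_of_eq ?_)
  have hP : (F.hom e.tgt e.src).mapAdjEquiv ((A.pre e.g).mapAdjEquiv e.η) =
      (B.pre ((F.hom _ _).f0 e.g)).mapAdjEquiv ((F.hom _ _).mapAdjEquiv e.η) := by
    ext <;> simp
  have hQ : (F.hom e.tgt e.src).mapAdjEquiv ((A.post e.g).mapAdjEquiv e.ε) =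
      (B.post ((F.hom _ _).f0 e.g)).mapAdjEquiv ((F.hom _ _).mapAdjEquiv e.ε) := by
    ext <;> simp
  exact (TwoFunctor.map_mate ((A.pre e.g).mapAdjEquiv e.η) ((A.post e.g).mapAdjEquiv e.ε)
    e.core.t1_pre_η (F.hom e.tgt e.src) e.T e.t_T).trans
      (TwoCat.AdjEquiv.mate_congr hP hQ _ _ _ (F.mapAdjBiequiv e).t_T)

/-! ### The universal adjoint biequivalence -/

/-- The Gray-category with a single cell of each dimension between any two objects. -/
def codiscrete (O : Type u) : GrayCat.{u} where
  Obj := O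
  Hom _ _ := TwoCat.point
  one _ := ⟨⟩
  comp _ _ _ := point.comp ⟨⟩ ⟨⟩ ⟨⟩
  snd_one _ _ := rfl
  fst_one _ _ := rfl
  fst_fst _ _ := rfl
  snd_fst _ _ := rfl
  snd_snd _ _ := rfl
  fst_inter _ _ _ := rfl
  inter_assoc _ _ _ := rfl
  snd_inter _ _ _ := rfl

/-- The adjoint equivalence in the terminal 2-category. -/
def pointAdjEquiv : TwoCat.point.{u}.AdjEquiv :=
  ⟨⟨⟩, ⟨⟩, rfl, rfl, ⟨⟩, ⟨⟩, rfl, rfl, rfl, rfl, ⟨⟨⟩, rfl, rfl, rfl, rfl⟩,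
    ⟨⟨⟩, rfl, rfl, rfl, rfl⟩, rfl, rfl⟩

/-- The adjoint biequivalence between two objects of a codiscrete Gray-category. -/
def codiscreteAdjBiequiv {O : Type u} (x y : O) : (codiscrete O).AdjBiequiv :=
  ⟨⟨x, y, ⟨⟩, ⟨⟩, pointAdjEquiv, pointAdjEquiv, rfl, rfl, rfl, rfl, ⟨⟩, rfl, rfl,
    ⟨⟨⟩, rfl, rfl, rfl, rfl⟩, ⟨⟩, rfl, rfl, ⟨⟨⟩, rfl, rfl, rfl, rfl⟩⟩, rfl, rfl⟩

/-- The boundary objects of a cell satisfy `P`. -/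
def Cell.All {A : GrayCat.{u}} (P : A.Obj → Prop) : A.Cell → Prop
  | .obj X => P X
  | @Cell.c0 _ X Y _ => P X ∧ P Y
  | @Cell.c1 _ X Y _ => P X ∧ P Y
  | @Cell.c2 _ X Y _ => P X ∧ P Y

theorem Rel.all {A : GrayCat.{u}} {P : A.Obj → Prop} {k : Op} {a b z : A.Cell} (h : A.Rel k a b z)
    (ha : a.All P) (hb : b.All P) : z.All P := by
  cases h <;> simp only [Cell.All] at * <;> tauto

/-- The full sub-Gray-category on the objects satisfying `P`. -/
def full (A : GrayCat.{u}) (P : A.Obj → Prop) : SubProduct (fun _ : PUnit.{1} => A) where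
  Mem z := (z ⟨⟩).All P
  closed _ _ _ _ ha hb h := (h ⟨⟩).all ha hb
  small := inferInstance

section Universal

variable {U : GrayCat.{u}} (hU : adjBiequivFunctor.{u}.CorepresentableBy U)

/-- The universal adjoint biequivalence. -/
def universal : U.AdjBiequiv := hU.homEquiv (𝟙 U)

theorem homEquiv_eq {A : GrayCat.{u}} (F : U ⟶ A) :
    hU.homEquiv F = F.mapAdjBiequiv (universal hU) := by
  have := hU.homEquiv_comp F (𝟙 U)
  rwa [Category.id_comp] at this

theorem exists_mapAdjBiequiv_universal_eq {A : GrayCat.{u}} (e : A.AdjBiequiv) :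
    ∃ F : U ⟶ A, F.mapAdjBiequiv (universal hU) = e :=
  ⟨hU.homEquiv.symm e, (homEquiv_eq hU _).symm.trans (hU.homEquiv.apply_symm_apply e)⟩

/-- The universal structure lies in the full sub-Gray-category on its source and target. The induced
map into it, followed by the inclusion, is the identity by universality, so every object of `U` lies
there. -/
theorem obj_eq_src_or_tgt (X : U.Obj) : X = (universal hU).src ∨ X = (universal hU).tgt := by
  let S := full U fun X => X = (universal hU).src ∨ X = (universal hU).tgt
  obtain ⟨e, he⟩ := SubProduct.exists_adjBiequiv (S := S) (fun _ => universal hU) fun q => by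
    change (adjBiequivCell (universal hU) q).All _
    rcases q with _ | _ | _ | _ | (_ | _) | (_ | _) | _ <;>
      simp [adjBiequivCell, adjEquivCell, Cell.All]
  obtain ⟨F, hF⟩ := exists_mapAdjBiequiv_universal_eq hU e
  have h : F ≫ S.π ⟨⟩ = 𝟙 U := hU.homEquiv.injective ((homEquiv_eq hU _).trans
    ((congrArg (S.π ⟨⟩).mapAdjBiequiv hF).trans (he ⟨⟩)))
  have hX : (fun X => X = (universal hU).src ∨ X = (universal hU).tgt) ((F ≫ S.π ⟨⟩).obj X) :=
    SubProduct.mem_cell (S := S) (.obj (F.obj X))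
  rwa [h] at hX

/-- It suffices to have one adjoint biequivalence between distinct objects, and a codiscrete
Gray-category on two objects contains one. -/
theorem src_ne_tgt : (universal hU).src ≠ (universal hU).tgt := by
  intro h
  obtain ⟨F, hF⟩ := exists_mapAdjBiequiv_universal_eq hU
    (codiscreteAdjBiequiv (ULift.up true : ULift.{u} Bool) ⟨false⟩)
  have h₁ := congrArg (fun e : (codiscrete (ULift.{u} Bool)).AdjBiequiv => e.src) hF
  have h₂ := congrArg (fun e : (codiscrete (ULift.{u} Bool)).AdjBiequiv => e.tgt) hF
  have h₃ : (ULift.up true : ULift.{u} Bool) = ⟨false⟩ :=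
    h₁.symm.trans ((congrArg F.obj h).trans h₂)
  exact Bool.noConfusion (congrArg ULift.down h₃)

include hU in
theorem card_obj_eq_two : Nat.card U.Obj = 2 := by
  rw [Nat.card_eq_two_iff]
  exact ⟨_, _, src_ne_tgt hU, Set.eq_univ_of_forall fun X => obj_eq_src_or_tgt hU X⟩

include hU in
-- If `p` picks the target, this is the lifting property translated by corepresentability. If it
-- picks the source, the natural bijection `AdjBiequiv.swap` exchanges the two cases.
theorem liftsAdjBiequiv_iff (p : point.{u} ⟶ U) {A B : GrayCat.{u}} (F : A ⟶ B) :
    GrayFunctor.LiftsAdjBiequiv F ↔ HasLiftingProperty p F := by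
  rcases obj_eq_src_or_tgt hU (p.obj ⟨⟩) with hp | hp
  · refine Iff.trans ⟨fun h e X hX => ?_, fun h X e hX => ?_⟩ (hasLiftingProperty_iff hU
      pointCorepresentableBy (fun A (e : A.AdjBiequiv) => e.src) p (fun {A} k =>
        (congrArg k.obj hp).trans
          (congrArg (fun e : A.AdjBiequiv => e.src) (homEquiv_eq hU k).symm)) F).symm
    · obtain ⟨e', he', h'⟩ := h X (AdjBiequiv.swap B e) hX.symm
      obtain ⟨e', rfl⟩ := (AdjBiequiv.swap A).surjective e'
      exact ⟨e', (AdjBiequiv.swap B).injective ((AdjBiequiv.map_swap F _).symm.trans h'), he'⟩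
    · obtain ⟨e, rfl⟩ := (AdjBiequiv.swap B).surjective e
      obtain ⟨e', h', he'⟩ := h e X hX.symm
      exact ⟨AdjBiequiv.swap A e', he',
        (AdjBiequiv.map_swap F _).trans (congrArg (AdjBiequiv.swap B) h')⟩
  · refine Iff.trans ⟨fun h e X hX => ?_, fun h X e hX => ?_⟩ (hasLiftingProperty_iff hU
      pointCorepresentableBy (fun A (e : A.AdjBiequiv) => e.tgt) p (fun {A} k =>
        (congrArg k.obj hp).trans
          (congrArg (fun e : A.AdjBiequiv => e.tgt) (homEquiv_eq hU k).symm)) F).symm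
    · obtain ⟨e', he', h'⟩ := h X e hX.symm
      exact ⟨e', h', he'⟩
    · obtain ⟨e', h', he'⟩ := h e X hX.symm
      exact ⟨e', he', h'⟩

end Universal

end GrayCat

end

/-! ### Assembly of the theorem. -/

theorem mainTheorem6 :
    (∀ {A B : GrayCat.{u}} (F : A ⟶ B),
      GrayFunctor.IsFibration F ↔
        GrayFunctor.LiftsAdjBiequiv F ∧ GrayFunctor.IsLocallyFibration F) ∧
    (∃ U : GrayCat.{u}, Nonempty (adjBiequivFunctor.{u}.CorepresentableBy U)) ∧
    (∀ (U : GrayCat.{u}), adjBiequivFunctor.{u}.CorepresentableBy U →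
      Nat.card U.Obj = 2 ∧
      ∀ (p : GrayCat.point.{u} ⟶ U) {A B : GrayCat.{u}} (F : A ⟶ B),
        GrayFunctor.LiftsAdjBiequiv F ↔ HasLiftingProperty p F) ∧
    (∃ I : MorphismProperty GrayCat.{u},
      MorphismProperty.IsSmall.{u} I ∧
      I.rlp = GrayFunctor.IsLocallyFibration ∧
      ∀ (U : GrayCat.{u}), adjBiequivFunctor.{u}.CorepresentableBy U →
        ∀ (p : GrayCat.point.{u} ⟶ U),
          (I ⊔ MorphismProperty.ofHoms (fun _ : PUnit.{1} => p)).rlp = GrayFunctor.IsFibration) ∧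
    MorphismProperty.IsWeakFactorizationSystem
      GrayFunctor.IsFibration.{u}.llp GrayFunctor.IsFibration.{u} := by
  obtain ⟨I, hI, hI'⟩ := GrayCat.exists_isSmall_rlp_eq_isLocallyFibration.{u}
  have key : ∀ (U : GrayCat.{u}), adjBiequivFunctor.{u}.CorepresentableBy U →
      ∀ (p : GrayCat.point.{u} ⟶ U),
        (I ⊔ MorphismProperty.ofHoms (fun _ : PUnit.{1} => p)).rlp = GrayFunctor.IsFibration := by
    intro U hU p
    ext A B F
    refine Iff.trans ?_ (GrayFunctor.isFibration_iff F).symm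
    rw [GrayCat.liftsAdjBiequiv_iff hU p, ← hI']
    constructor
    · exact fun h => ⟨h p (Or.inr ⟨⟨⟩⟩), fun _ _ i hi => h i (Or.inl hi)⟩
    · rintro ⟨h, h'⟩ _ _ i (hi | ⟨⟨⟩⟩)
      exacts [h' i hi, h]
  refine ⟨GrayFunctor.isFibration_iff, GrayCat.exists_adjBiequivFunctor_corepresentableBy,
    fun U hU => ⟨GrayCat.card_obj_eq_two hU, GrayCat.liftsAdjBiequiv_iff hU⟩,
    ⟨I, hI, hI', key⟩, ?_⟩
  obtain ⟨U, ⟨hU⟩⟩ := GrayCat.exists_adjBiequivFunctor_corepresentableBy.{u}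
  -- Either object of `U` would do. It exhibits the fibrations as the right class of a small set of
  -- maps, to which the factorization applies.
  rw [← key U hU (GrayCat.ofObj (GrayCat.universal hU).src)]
  have : MorphismProperty.IsSmall.{u} (I ⊔ MorphismProperty.ofHoms
      (fun _ : PUnit.{1} => GrayCat.ofObj (GrayCat.universal hU).src)) := by
    rw [sup_eq_iSup]
    have : ∀ b : Bool, MorphismProperty.IsSmall.{u} (cond b I (MorphismProperty.ofHoms
        (fun _ : PUnit.{1} => GrayCat.ofObj (GrayCat.universal hU).src))) :=
      Bool.rec (MorphismProperty.isSmall_iff_eq_ofHoms.{u} _ |>.2 ⟨PUnit.{u + 1}, _, _, fun _ =>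
        GrayCat.ofObj (GrayCat.universal hU).src, by ext; constructor <;> exact fun ⟨_⟩ => ⟨⟨⟩⟩⟩) hI
    infer_instance
  exact GrayCat.isWeakFactorizationSystem _
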